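/- A set system consists of a finite universe $\mathcal E$ and a finite family $\mathcal S$ of subsets of $\mathcal E$ with union $\mathcal E$; sets and elements carry natural-number identifiers. A set cover is a subfamily of $\mathcal S$ with union $\mathcal E$. Let $\mathrm{OPT}(\mathcal S,\mathcal E)$ be the optimal fractional set cover value, i.e. the infimum of $\sum_{S\in\mathcal S}x_S$ over all $x\in\mathbb R_{\ge 0}^{\mathcal S}$ with $\sum_{S\ni e}x_S\ge 1$ for every $e\in\mathcal E$. A neighbor query asks "what is the $i$-th element of the set $S$?" or "what is the $i$-th set containing the element $e$?", where the elements of each set and the sets containing each element are listed in an arbitrary order, and the reply says so if there is no $i$-th one. A local computation algorithm (LCA) for set cover is an algorithm that is given $s$, $t$ and the identifier of a set $S\in\mathcal S$, can adaptively make neighbor queries to the input and read bits of an infinite tape of independent fair random bits, and answers yes or no; no state other than the tape is shared between different calls. Theorem. There are a constant $C>0$ and an LCA such that the following holds for all integers $s,t\ge 2$ and every set system $(\mathcal S,\mathcal E)$ in which every set has at most $s$ elements and every element lies in at most $t$ sets. There is a set cover $\mathcal C=\mathcal C(\omega)$, depending only on $(\mathcal S,\mathcal E)$ (with its identifiers),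 $s$, $t$ and the random tape $\omega$, such that for every tape $\omega$ and every $S\in\mathcal S$ the LCA, asked about $S$, makes at most $$s^{\,C\log_2 s}\cdot t^{\,C\log_2 s\cdot(\log_2\log_2 s+\log_2\log_2 t)}$$ neighbor queries and correctly answers whether $S\in\mathcal C(\omega)$, whatever the order of the neighbor lists; and $$\mathbb E_\omega\big[|\mathcal C(\omega)|\big]\le C\log_2 s\cdot \mathrm{OPT}(\mathcal S,\mathcal E).$$ -/

import Mathlib

/-- A finite set system. Sets and elements carry natural-number identifiers, `elts S` is the set of
elements of the set with identifier `S` (only meaningful for `S ∈ sets`), and the union of all sets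
is the universe `univ`. -/
structure SetSystem where
  sets : Finset ℕ
  univ : Finset ℕ
  elts : ℕ → Finset ℕ
  elts_subset : ∀ S ∈ sets, elts S ⊆ univ
  exists_mem : ∀ e ∈ univ, ∃ S ∈ sets, e ∈ elts S

namespace SetSystem

/-- The sets containing the element `e`. -/
def setsOf (I : SetSystem) (e : ℕ) : Finset ℕ := {S ∈ I.sets | e ∈ I.elts S}

/-- Every set has at most `s` elements and every element lies in at most `t` sets. -/
def Bounded (I : SetSystem) (s t : ℕ) : Prop :=
  (∀ S ∈ I.sets, (I.elts S).card ≤ s) ∧ ∀ e ∈ I.univ, (I.setsOf e).card ≤ t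

/-- `D` is a set cover: a subfamily whose union is the universe. -/
def IsCover (I : SetSystem) (D : Finset ℕ) : Prop :=
  D ⊆ I.sets ∧ ∀ e ∈ I.univ, ∃ S ∈ D, e ∈ I.elts S

/-- `x` is a fractional set cover: a nonnegative weighting of the sets which gives total weight at
least one to the sets containing any given element. -/
def IsFractionalCover (I : SetSystem) (x : ℕ → ℝ) : Prop :=
  (∀ S ∈ I.sets, 0 ≤ x S) ∧ ∀ e ∈ I.univ, 1 ≤ ∑ S ∈ I.setsOf e, x S

/-- The optimal fractional set cover value. -/
noncomputable def opt (I : SetSystem) : ℝ :=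
  sInf {v : ℝ | ∃ x : ℕ → ℝ, I.IsFractionalCover x ∧ v = ∑ S ∈ I.sets, x S}

/-- A bipartite adjacency-list representation of a set system, with the neighbors of each set and
of each element listed in an arbitrary order. Identifiers that are not in use have an empty list. -/
structure Representation (I : SetSystem) where
  setList : ℕ → List ℕ
  elemList : ℕ → List ℕ
  setList_nodup : ∀ S, (setList S).Nodup
  elemList_nodup : ∀ e, (elemList e).Nodup
  mem_setList : ∀ S e, e ∈ setList S ↔ S ∈ I.sets ∧ e ∈ I.elts S
  mem_elemList : ∀ e S, S ∈ elemList e ↔ S ∈ I.sets ∧ e ∈ I.elts S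

end SetSystem

/-- What a local algorithm can do next. -/
inductive LCAAction where
  /-- the neighbor query: what is the `i`-th element of the set `S`? (counting from `0`) -/
  | querySet (S i : ℕ)
  /-- the neighbor query: what is the `i`-th set containing the element `e`? (counting from `0`) -/
  | queryElem (e i : ℕ)
  /-- read the `j`-th bit of the random tape -/
  | readBit (j : ℕ)
  /-- stop and answer `b` -/
  | answer (b : Bool)

namespace LCAAction

/-- Actions as a sum of standard types, used only to transport their standard coding. -/
def equivSum : LCAAction ≃ (ℕ × ℕ) ⊕ (ℕ × ℕ) ⊕ ℕ ⊕ Bool where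
  toFun
    | querySet S i => .inl (S, i)
    | queryElem e i => .inr (.inl (e, i))
    | readBit j => .inr (.inr (.inl j))
    | answer b => .inr (.inr (.inr b))
  invFun
    | .inl (S, i) => querySet S i
    | .inr (.inl (e, i)) => queryElem e i
    | .inr (.inr (.inl j)) => readBit j
    | .inr (.inr (.inr b)) => answer b
  left_inv a := by cases a <;> rfl
  right_inv a := by rcases a with _ | _ | _ | _ <;> rfl

instance primcodable : Primcodable LCAAction := Primcodable.ofEquiv _ equivSum

end LCAAction

/-- A local computation algorithm. It is given the parameters `s` and `t` and the identifier `S` of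
the set it is asked about; its next action is a computable function of these and of the list of
the responses it has received so far (its working memory). It knows nothing else about the input,
and nothing is carried over from one call to another. -/
structure LocalAlgorithm where
  next : (s t S : ℕ) → List (Option ℕ) → LCAAction
  computable :
    Computable fun p : ℕ × ℕ × ℕ × List (Option ℕ) => next p.1 p.2.1 p.2.2.1 p.2.2.2

namespace LocalAlgorithm

/-- `A.Run s t S R ω h q b`: on input representation `R` and random tape `ω`, the algorithm `A`,
called with parameters `s`, `t` on the set `S` and having received the responses `h`, will stop
after making exactly `q` further neighbor queries and answer `b`. The response to a query for the
`i`-th neighbor is `none` if there are at most `i` neighbors. -/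
inductive Run (A : LocalAlgorithm) (s t S : ℕ) {I : SetSystem} (R : I.Representation)
    (ω : ℕ → Bool) : List (Option ℕ) → ℕ → Bool → Prop
  | answer {h : List (Option ℕ)} {b : Bool} (ha : A.next s t S h = .answer b) :
      Run A s t S R ω h 0 b
  | querySet {h : List (Option ℕ)} {S' i q : ℕ} {b : Bool} (ha : A.next s t S h = .querySet S' i)
      (hr : Run A s t S R ω (h ++ [(R.setList S')[i]?]) q b) : Run A s t S R ω h (q + 1) b
  | queryElem {h : List (Option ℕ)} {e i q : ℕ} {b : Bool} (ha : A.next s t S h = .queryElem e i)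
      (hr : Run A s t S R ω (h ++ [(R.elemList e)[i]?]) q b) : Run A s t S R ω h (q + 1) b
  | readBit {h : List (Option ℕ)} {j q : ℕ} {b : Bool} (ha : A.next s t S h = .readBit j)
      (hr : Run A s t S R ω (h ++ [some (ω j).toNat]) q b) : Run A s t S R ω h q b

/-- On the representation `R` and the tape `ω`, and called with parameters `s`, `t` on the set `S`,
the algorithm `A` stops after making at most `Q` neighbor queries, and answers `b`. -/
def Answers (A : LocalAlgorithm) (s t S : ℕ) {I : SetSystem} (R : I.Representation)
    (ω : ℕ → Bool) (Q : ℝ) (b : Bool) : Prop :=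
  ∃ q : ℕ, A.Run s t S R ω [] q b ∧ (q : ℝ) ≤ Q

end LocalAlgorithm

/-- The law of the random tape: independent fair bits. -/
noncomputable def tapeMeasure : MeasureTheory.Measure (ℕ → Bool) :=
  MeasureTheory.Measure.infinitePi fun _ => (PMF.uniformOfFintype Bool).toMeasure

/-- The query bound `s ^ (C log s) * t ^ (C log s (log log s + log log t))`, with binary
logarithms. -/
noncomputable def queryBound (C : ℝ) (s t : ℕ) : ℝ :=
  (s : ℝ) ^ (C * Real.logb 2 s) *
    (t : ℝ) ^ (C * (Real.logb 2 s * (Real.logb 2 (Real.logb 2 s) + Real.logb 2 (Real.logb 2 t))))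

/-!
The algorithm simulates a parallel version of the greedy algorithm. In stage `j` of the greedy
algorithm the sets with about `2 ^ (L - j)` uncovered elements are worth adding; each of them joins
with a probability that starts near `1 / t` and doubles from round to round, so that an element is
typically covered when only a few sets are about to join over it. A set that joins is charged to
the uncovered elements it covers; every element then carries a constant charge in expectation, and
a set carries a charge of `O(log s)`, so that the charges form, up to this factor, a fractional
packing.

Whether a set has many uncovered elements depends on the earlier rounds, and asking about all of
its elements in all rounds is too expensive. Hence in the stages of high level only a sample of the
elements is looked at. The thresholds are checked on fresh samples, and a set is taken at once if
a sample or the number of sets in the race over a sampled element is too large. By concentration,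
this has probability at most `1 / (s * t)`, which is affordable, and it bounds the branching of the
recursion in each round by a power of `log (s * t)`.
-/

namespace LocalSetCover

open Finset

/-! ### Independent coins -/

section FiniteSpace

open MeasureTheory

variable {Ω : Type*} [MeasurableSpace Ω] [DiscreteMeasurableSpace Ω] {μ : Measure Ω}

lemma integral_ite_eq_measureReal (p : Ω → Prop) [DecidablePred p] :
    ∫ x, (if p x then 1 else 0 : ℝ) ∂μ = μ.real {x | p x} := by
  rw [← integral_indicator_one .of_discrete]
  exact integral_congr_ae (.of_forall fun x => by simp [Set.indicator_apply])

variable [Finite Ω]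

lemma integral_le_of_forall_le [IsProbabilityMeasure μ] {f : Ω → ℝ} {c : ℝ} (h : ∀ x, f x ≤ c) :
    ∫ x, f x ∂μ ≤ c :=
  (integral_mono .of_finite (integrable_const c) h).trans_eq (by simp)

lemma integral_card_filter [IsFiniteMeasure μ] {ι : Type*} (s : Finset ι) (p : ι → Ω → Prop)
    [∀ i, DecidablePred (p i)] :
    ∫ x, (#{i ∈ s | p i x} : ℝ) ∂μ = ∑ i ∈ s, μ.real {x | p i x} := by
  simp_rw [← integral_ite_eq_measureReal, card_filter, Nat.cast_sum, Nat.cast_ite, Nat.cast_one,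
    Nat.cast_zero]
  exact integral_finsetSum _ fun _ _ => .of_finite

lemma measureReal_setOf_le_div [IsFiniteMeasure μ] {p : Ω → Prop} {f : Ω → ℝ} {a b : ℝ}
    (ha : 0 < a) (hf : ∀ x, 0 ≤ f x) (h : ∀ x, p x → a ≤ f x) (hb : ∫ x, f x ∂μ ≤ b) :
    μ.real {x | p x} ≤ b / a := by
  rw [le_div_iff₀' ha]
  calc a * μ.real {x | p x} ≤ a * μ.real {x | a ≤ f x} :=
        mul_le_mul_of_nonneg_left (measureReal_mono h) ha.le
    _ ≤ ∫ x, f x ∂μ := mul_meas_ge_le_integral_of_nonneg (.of_forall hf) .of_finite a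
    _ ≤ b := hb

end FiniteSpace

section FiniteMeasure

open MeasureTheory

variable {Ω : Type*} [MeasurableSpace Ω] {μ : Measure Ω}

lemma measureReal_setOf_mono [IsFiniteMeasure μ] {p q : Ω → Prop} (h : ∀ x, p x → q x) :
    μ.real {x | p x} ≤ μ.real {x | q x} :=
  measureReal_mono h

lemma measureReal_setOf_or_le (p q : Ω → Prop) :
    μ.real {x | p x ∨ q x} ≤ μ.real {x | p x} + μ.real {x | q x} :=
  measureReal_union_le _ _

lemma measureReal_setOf_exists_mem_le {ι : Type*} {s : Finset ι} {p : ι → Ω → Prop} {b : ℝ}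
    (h : ∀ i ∈ s, μ.real {x | p i x} ≤ b) : μ.real {x | ∃ i ∈ s, p i x} ≤ #s * b := by
  have hunion : {x | ∃ i ∈ s, p i x} = ⋃ i ∈ s, {x | p i x} := by ext; simp
  rw [hunion, ← nsmul_eq_mul]
  exact (measureReal_biUnion_finset_le _ _).trans (sum_le_card_nsmul _ _ _ h)

end FiniteMeasure

section Independence

open MeasureTheory ProbabilityTheory

variable {κ α : Type*} [Fintype κ] [Finite α] [MeasurableSpace α] [MeasurableSingletonClass α]
  (μ : κ → Measure α) [∀ k, IsProbabilityMeasure (μ k)]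

lemma integral_mul_prod_pi {s : Finset κ} {f : (κ → α) → ℝ} (hf : DependsOn f (↑s)ᶜ)
    (g : κ → α → ℝ) :
    ∫ x, f x * ∏ k ∈ s, g k (x k) ∂Measure.pi μ =
      (∫ x, f x ∂Measure.pi μ) * ∏ k ∈ s, ∫ b, g k b ∂μ k := by
  classical
  rw [← coe_compl] at hf
  obtain ⟨f', rfl⟩ := dependsOn_iff_exists_comp.1 hf
  have hcoord : iIndepFun (fun k (x : κ → α) => x k) (Measure.pi μ) :=
    iIndepFun_pi fun _ => aemeasurable_id
  have hindep := (hcoord.indepFun_finset sᶜ s disjoint_compl_left measurable_pi_apply).comp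
    (.of_discrete (f := f')) (.of_discrete (f := fun y : s → α => ∏ k : s, g k (y k)))
  have hprod : ∫ x, ∏ k : s, g k (x k) ∂Measure.pi μ = ∏ k : s, ∫ b, g k b ∂μ k := by
    rw [(hcoord.precomp Subtype.val_injective).integral_fun_prod_comp
      (fun _ => (measurable_pi_apply _).aemeasurable)
      (fun _ => (StronglyMeasurable.of_discrete).aestronglyMeasurable)]
    refine prod_congr rfl fun k _ => ?_
    rw [← (measurePreserving_eval μ (k : κ)).map_eq, integral_map
      (measurable_pi_apply _).aemeasurable (StronglyMeasurable.of_discrete).aestronglyMeasurable]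
  simp_rw [← prod_coe_sort s]
  rw [← hprod]
  exact hindep.integral_fun_mul_eq_mul_integral
    (StronglyMeasurable.of_discrete).aestronglyMeasurable
    (StronglyMeasurable.of_discrete).aestronglyMeasurable

lemma integral_mul_prod_pi_of_subset {s : Finset κ} {f : (κ → α) → ℝ} {A : (κ → α) → Finset κ}
    (hf : DependsOn f (↑s)ᶜ) (hA : DependsOn A (↑s)ᶜ) (hAs : ∀ x, A x ⊆ s) (g : κ → α → ℝ) :
    ∫ x, f x * ∏ k ∈ A x, g k (x k) ∂Measure.pi μ =
      ∫ x, f x * ∏ k ∈ A x, ∫ b, g k b ∂μ k ∂Measure.pi μ := by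
  classical
  have hsplit : ∀ G : (κ → α) → κ → ℝ, ∫ x, f x * ∏ k ∈ A x, G x k ∂Measure.pi μ =
      ∑ a ∈ s.powerset, ∫ x, (if A x = a then f x else 0) * ∏ k ∈ a, G x k ∂Measure.pi μ := by
    intro G
    rw [← integral_finsetSum _ fun _ _ => .of_finite]
    refine integral_congr_ae (.of_forall fun x => ?_)
    simp [ite_mul, hAs x]
  rw [hsplit, hsplit]
  refine sum_congr rfl fun a ha => ?_
  have hfa : DependsOn (fun x => if A x = a then f x else 0) (↑s)ᶜ := fun x y hxy => by
    simp only [hA hxy, hf hxy]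
  rw [integral_mul_prod_pi μ (hfa.mono (Set.compl_subset_compl.2 (mod_cast mem_powerset.1 ha))),
    integral_mul_const]

end Independence

section Tape

open MeasureTheory Measure ProbabilityTheory unitInterval

/-- The probability `2 ^ (- n)`, as a point of the unit interval. -/
noncomputable def halfPow (n : ℕ) : I :=
  ⟨(1 / 2) ^ n, by positivity, pow_le_one₀ (by norm_num) (by norm_num)⟩

instance : IsProbabilityMeasure tapeMeasure :=
  inferInstanceAs (IsProbabilityMeasure (infinitePi _))

lemma measurable_decide_forall_lt (n : ℕ) :
    Measurable fun ω : ℕ → Bool => decide (∀ r < n, ω r) := by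
  refine measurable_to_bool ?_
  have : (fun ω : ℕ → Bool => decide (∀ r < n, ω r)) ⁻¹' {true} =
      ⋂ r, ⋂ _ : r < n, (fun ω : ℕ → Bool => ω r) ⁻¹' {true} := by ext; simp
  rw [this]
  exact .iInter fun r => .iInter fun _ => measurable_pi_apply r (.singleton _)

lemma tapeMeasure_real_forall_lt (n : ℕ) : tapeMeasure.real {ω | ∀ r < n, ω r} = (1 / 2) ^ n := by
  have hset : {ω : ℕ → Bool | ∀ r < n, ω r} = Set.pi ↑(range n) fun _ => {true} := by
    ext; simp [Set.mem_pi]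
  rw [hset, measureReal_def, tapeMeasure, infinitePi_pi _ fun _ _ => .singleton _]
  simp

lemma map_forall_lt_tapeMeasure (n : ℕ) :
    tapeMeasure.map (fun ω => decide (∀ r < n, ω r)) = Ber(true, false, halfPow n) := by
  have := isProbabilityMeasure_map (μ := tapeMeasure)
    (measurable_decide_forall_lt n).aemeasurable
  have htrue : tapeMeasure.map (fun ω => decide (∀ r < n, ω r)) {true} =
      Ber(true, false, halfPow n) {true} := by
    rw [← measureReal_eq_measureReal_iff, measureReal_def,
      map_apply (measurable_decide_forall_lt n) (.singleton _), ← measureReal_def,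
      bernoulliMeasure_real_apply_of_mem_of_notMem _ (.singleton _) rfl (by simp)]
    simpa [Set.preimage, halfPow] using tapeMeasure_real_forall_lt n
  have hfalse : ({false} : Set Bool) = {true}ᶜ := by ext b; cases b <;> simp
  refine ext_of_singleton fun b => ?_
  cases b
  · rw [hfalse, prob_compl_eq_one_sub (.singleton _), htrue, prob_compl_eq_one_sub (.singleton _)]
  · exact htrue

lemma map_coins_tapeMeasure {κ : Type*} [Fintype κ] (expo : κ → ℕ) {pos : κ → ℕ → ℕ}
    (hpos : Function.Injective fun i : κ × ℕ => pos i.1 i.2) :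
    tapeMeasure.map (fun ω k => decide (∀ r < expo k, ω (pos k r))) =
      Measure.pi fun k => Ber(true, false, halfPow (expo k)) := by
  have hbits : tapeMeasure.map (fun ω (k : κ) r => ω (pos k r)) =
      infinitePi fun _ : κ => tapeMeasure := by
    simp only [tapeMeasure]
    rw [← infinitePi_map_curry fun (_ : κ) (_ : ℕ) => (PMF.uniformOfFintype Bool).toMeasure,
      ← map_infinitePi_infinitePi_of_inj (P := fun _ => (PMF.uniformOfFintype Bool).toMeasure) hpos,
      Measure.map_map (by fun_prop) (by fun_prop)]
    rfl
  have hconj := infinitePi_map_pi (fun _ : κ => tapeMeasure) fun k =>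
    measurable_decide_forall_lt (expo k)
  simp_rw [map_forall_lt_tapeMeasure] at hconj
  rw [← infinitePi_eq_pi, ← hconj, ← hbits, Measure.map_map _ (by fun_prop)]
  · rfl
  · exact measurable_pi_lambda _ fun k =>
      (measurable_decide_forall_lt _).comp (measurable_pi_apply k)

end Tape

/-! ### The parallel algorithm -/

/-- The parameters of the parallel algorithm, which has `L + 1` stages of `T + 1` rounds each; in a
stage of high level, a set needs `2 ^ ℓ` counted uncovered elements to stay in the race. -/
structure Schedule where
  L : ℕ
  T : ℕ
  ℓ : ℕ

/-- The names of the coins: `(true, S, τ)` decides whether the set `S` may join the cover in round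
`τ`, and `(false, e, τ)` whether the element `e` is counted in round `τ`. -/
abbrev Key := Bool × ℕ × ℕ

namespace Schedule

variable (P : Schedule)

/-- The total number of rounds. -/
def numRounds : ℕ := (P.L + 1) * (P.T + 1)

/-- The number of the round within its stage. -/
def round (τ : ℕ) : ℕ := τ % (P.T + 1)

/-- The first round of the stage. -/
def start (τ : ℕ) : ℕ := τ - τ % (P.T + 1)

/-- The level of a stage: it treats sets with about `2 ^ level` uncovered elements. -/
def level (τ : ℕ) : ℕ := P.L - τ / (P.T + 1)

/-- The join coins (`true`) and count coins (`false`) of round `τ` show `true` with probability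
`2 ^ (- expo)`. The join probability doubles from round to round and is `1` in the last one. -/
def expo (b : Bool) (τ : ℕ) : ℕ := if b then P.T - P.round τ else P.level τ - P.ℓ

/-- The number of counted uncovered elements that a set needs to stay in the race. -/
def thr (τ : ℕ) : ℕ := 2 ^ min (P.level τ) P.ℓ

/-- The number of sets in the race, `d` rounds ago, that may contain a given element and be allowed
to join now before the local simulation gives up. -/
def cap (d : ℕ) : ℕ := 2 ^ (P.ℓ + 1 + d)

/-- The number of counted elements of a set above which the local simulation gives up. -/
def maxSample : ℕ := 17 * 2 ^ P.ℓ

/-- The probability that a join coin (`true`) or a count coin (`false`) of round `τ` shows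
`true`. -/
noncomputable def prob (b : Bool) (τ : ℕ) : ℝ := (1 / 2) ^ P.expo b τ

/-- The probability that a given set may join in round `τ`. -/
noncomputable abbrev joinProb (τ : ℕ) : ℝ := P.prob true τ

/-- The probability that a given element is counted in round `τ`. -/
noncomputable abbrev sampleProb (τ : ℕ) : ℝ := P.prob false τ

lemma prob_pos (b : Bool) (τ : ℕ) : 0 < P.prob b τ := by unfold prob; positivity

lemma prob_le_one (b : Bool) (τ : ℕ) : P.prob b τ ≤ 1 :=
  pow_le_one₀ (by norm_num) (by norm_num)

lemma thr_pos (τ : ℕ) : 0 < P.thr τ := by unfold thr; positivity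

lemma start_add_round (τ : ℕ) : P.start τ + P.round τ = τ := Nat.sub_add_cancel (Nat.mod_le _ _)

lemma start_le (τ : ℕ) : P.start τ ≤ τ := Nat.sub_le _ _

lemma round_le (τ : ℕ) : P.round τ ≤ P.T := Nat.lt_succ_iff.1 (Nat.mod_lt _ (Nat.succ_pos _))

variable {P}

lemma start_stage_add {σ j : ℕ} (hj : j ≤ P.T) : P.start (σ * (P.T + 1) + j) = σ * (P.T + 1) := by
  rw [start, Nat.mul_add_mod', Nat.mod_eq_of_lt (Nat.lt_succ_of_le hj), Nat.add_sub_cancel]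

lemma round_stage_add {σ j : ℕ} (hj : j ≤ P.T) : P.round (σ * (P.T + 1) + j) = j := by
  rw [round, Nat.mul_add_mod', Nat.mod_eq_of_lt (Nat.lt_succ_of_le hj)]

lemma level_stage_add {σ j : ℕ} (hj : j ≤ P.T) : P.level (σ * (P.T + 1) + j) = P.L - σ := by
  rw [level, Nat.mul_comm σ, Nat.mul_add_div (Nat.succ_pos _),
    Nat.div_eq_of_lt (Nat.lt_succ_of_le hj), add_zero]

lemma stage_add_lt_numRounds {σ j : ℕ} (hσ : σ ≤ P.L) (hj : j ≤ P.T) :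
    σ * (P.T + 1) + j < P.numRounds := by
  have := Nat.mul_le_mul_right (P.T + 1) hσ
  rw [numRounds, add_mul]
  omega

lemma start_eq (τ : ℕ) : P.start τ = τ / (P.T + 1) * (P.T + 1) := by
  have := Nat.div_add_mod' τ (P.T + 1)
  unfold start
  omega

lemma round_start_add {τ k : ℕ} (hk : k ≤ P.T) : P.round (P.start τ + k) = k := by
  rw [start_eq, round_stage_add hk]

lemma round_succ {τ : ℕ} (h : P.round (τ + 1) ≠ 0) : P.round (τ + 1) = P.round τ + 1 := by
  have hτ := P.start_add_round τ
  rcases (P.round_le τ).lt_or_eq with hlt | heq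
  · rw [← hτ, add_assoc, round_start_add hlt, round_start_add (P.round_le τ)]
  · refine absurd ?_ h
    rw [← hτ, heq, start_eq, add_assoc, ← Nat.succ_mul]
    exact Nat.mul_mod_left _ _

lemma joinProb_succ {τ : ℕ} (h : P.round (τ + 1) ≠ 0) :
    P.joinProb (τ + 1) = 2 * P.joinProb τ := by
  have hle := P.round_le (τ + 1)
  rw [round_succ h] at hle
  have hexpo : P.expo true τ = P.expo true (τ + 1) + 1 := by
    simp only [expo, if_true, round_succ h]
    omega
  rw [joinProb, joinProb, prob, prob, hexpo, pow_succ]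
  ring

lemma sampleProb_mul_two_pow (τ : ℕ) : P.sampleProb τ * 2 ^ P.level τ = P.thr τ := by
  have hlevel : P.level τ = P.expo false τ + min (P.level τ) P.ℓ := by
    simp only [expo, Bool.false_eq_true, if_false]
    omega
  calc P.sampleProb τ * 2 ^ P.level τ
      = (1 / 2 * 2) ^ P.expo false τ * 2 ^ min (P.level τ) P.ℓ := by
        rw [mul_pow, mul_assoc, ← pow_add, ← hlevel]; rfl
    _ = P.thr τ := by simp [thr]

end Schedule

/-- The names of the coins used on the set system `I`. -/
def keySet (P : Schedule) (I : SetSystem) : Finset Key :=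
  Finset.univ ×ˢ ((I.sets ∪ I.univ) ×ˢ range P.numRounds)

/-- The outcomes of the coins, as a finite probability space. -/
abbrev Outcome (P : Schedule) (I : SetSystem) : Type := keySet P I → Bool

section Rounds

variable {P : Schedule} {I : SetSystem} (x : Outcome P I)

/-- What the coin `k` shows. Coins of probability one show `true` even on the null set of outcomes
that say otherwise, so that the algorithm always ends with a cover; so do the coins not in use. -/
def coin (k : Key) : Bool :=
  decide (P.expo k.1 k.2.2 = 0) || if h : k ∈ keySet P I then x ⟨k, h⟩ else true

/-- The elements of `S` counted in round `τ`, if `al` is the set of uncovered elements. -/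
def sample (al : Finset ℕ) (τ S : ℕ) : Finset ℕ :=
  {e ∈ I.elts S ∩ al | coin x (false, e, τ)}

/-- The uncovered elements and the sets still in the race before round `τ`. -/
def rounds : ℕ → Finset ℕ × Finset ℕ
  | 0 => (I.univ, I.sets)
  | τ + 1 =>
    let ac := {S ∈ (rounds τ).2 | P.thr τ ≤ #(sample x (rounds τ).1 τ S)}
    ((rounds τ).1 \ {S ∈ ac | coin x (true, S, τ)}.biUnion I.elts,
      if P.round (τ + 1) = 0 then I.sets else ac)

/-- The elements not covered before round `τ`. -/
def alive (τ : ℕ) : Finset ℕ := (rounds x τ).1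

/-- The sets in the race before round `τ`. -/
def cand (τ : ℕ) : Finset ℕ := (rounds x τ).2

/-- `S` has enough counted uncovered elements in round `τ`. -/
def Passes (τ S : ℕ) : Prop := P.thr τ ≤ #(sample x (alive x τ) τ S)

instance (τ S : ℕ) : Decidable (Passes x τ S) := inferInstanceAs (Decidable (_ ≤ _))

/-- The sets that may join the cover in round `τ`. -/
def active (τ : ℕ) : Finset ℕ := {S ∈ cand x τ | Passes x τ S}

/-- The sets that join the cover in round `τ`. -/
def joined (τ : ℕ) : Finset ℕ := {S ∈ active x τ | coin x (true, S, τ)}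

variable {x}

lemma coin_of_expo_eq_zero {k : Key} (h : P.expo k.1 k.2.2 = 0) : coin x k = true := by
  simp [coin, h]

variable (x)

lemma alive_succ (τ : ℕ) : alive x (τ + 1) = alive x τ \ (joined x τ).biUnion I.elts := rfl

lemma cand_succ (τ : ℕ) :
    cand x (τ + 1) = if P.round (τ + 1) = 0 then I.sets else active x τ := rfl

lemma cand_of_round_eq_zero {τ : ℕ} (h : P.round τ = 0) : cand x τ = I.sets := by
  cases τ with
  | zero => rfl
  | succ τ => rw [cand_succ, if_pos h]

lemma cand_start (τ : ℕ) : cand x (P.start τ) = I.sets :=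
  cand_of_round_eq_zero x (Schedule.round_start_add (k := 0) (Nat.zero_le P.T))

lemma cand_start_succ {τ k : ℕ} (hk : k + 1 ≤ P.T) :
    cand x (P.start τ + (k + 1)) = active x (P.start τ + k) := by
  rw [← add_assoc, cand_succ, if_neg]
  rw [add_assoc, Schedule.round_start_add hk]
  exact Nat.succ_ne_zero k

lemma active_subset_cand (τ : ℕ) : active x τ ⊆ cand x τ := filter_subset _ _

lemma cand_subset (τ : ℕ) : cand x τ ⊆ I.sets := by
  induction τ with
  | zero => exact subset_rfl
  | succ τ ih =>
    rw [cand_succ]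
    split_ifs
    · exact subset_rfl
    · exact (active_subset_cand x τ).trans ih

lemma active_subset (τ : ℕ) : active x τ ⊆ I.sets :=
  (active_subset_cand x τ).trans (cand_subset x τ)

lemma joined_subset (τ : ℕ) : joined x τ ⊆ I.sets := (filter_subset _ _).trans (active_subset x τ)

lemma alive_antitone : Antitone (alive x) := antitone_nat_of_succ_le fun _ => sdiff_subset

lemma alive_subset (τ : ℕ) : alive x τ ⊆ I.univ := alive_antitone x (Nat.zero_le τ)

lemma mem_alive_succ {τ e : ℕ} : e ∈ alive x (τ + 1) ↔
    e ∈ alive x τ ∧ ∀ S ∈ active x τ, coin x (true, S, τ) = true → e ∉ I.elts S := by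
  simp [alive_succ, joined]

lemma exists_joined_of_notMem_alive {τ e : ℕ} (he : e ∈ I.univ) (h : e ∉ alive x τ) :
    ∃ τ' < τ, ∃ S ∈ joined x τ', e ∈ I.elts S := by
  induction τ with
  | zero => exact absurd he h
  | succ τ ih =>
    by_cases h' : e ∈ alive x τ
    · rw [alive_succ, mem_sdiff, not_and, not_not] at h
      obtain ⟨S, hS, heS⟩ := mem_biUnion.1 (h h')
      exact ⟨τ, τ.lt_succ_self, S, hS, heS⟩
    · obtain ⟨τ', hτ', hjoin⟩ := ih h'
      exact ⟨τ', hτ'.trans τ.lt_succ_self, hjoin⟩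

variable {x}

-- At these levels all coins count.
lemma passes_of_level_le {τ S : ℕ} (hτ : P.level τ ≤ P.ℓ)
    (h : 2 ^ P.level τ ≤ #(I.elts S ∩ alive x τ)) : Passes x τ S := by
  have hsample : sample x (alive x τ) τ S = I.elts S ∩ alive x τ :=
    filter_true_of_mem fun e _ => coin_of_expo_eq_zero (by simp [Schedule.expo, hτ])
  rwa [Passes, hsample, Schedule.thr, min_eq_left hτ]

lemma mem_active_of_forall_passes {σ j S : ℕ} (hj : j ≤ P.T) (hS : S ∈ I.sets)
    (h : ∀ i ≤ j, Passes x (σ * (P.T + 1) + i) S) : S ∈ active x (σ * (P.T + 1) + j) := by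
  refine mem_filter.2 ⟨?_, h j le_rfl⟩
  induction j with
  | zero => rwa [cand_of_round_eq_zero x (Schedule.round_stage_add hj)]
  | succ j ih =>
    have hround : P.round (σ * (P.T + 1) + j + 1) ≠ 0 := by
      rw [add_assoc, Schedule.round_stage_add hj]
      exact j.succ_ne_zero
    rw [← add_assoc, cand_succ, if_neg hround]
    exact mem_filter.2 ⟨ih (by omega) fun i hi => h i (by omega), h j j.le_succ⟩

lemma notMem_alive_of_forall_passes {σ S e : ℕ} (hS : S ∈ I.sets) (he : e ∈ I.elts S)
    (h : ∀ j ≤ P.T, Passes x (σ * (P.T + 1) + j) S) : e ∉ alive x ((σ + 1) * (P.T + 1)) := by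
  rw [Nat.succ_mul, ← add_assoc, mem_alive_succ]
  intro halive
  refine halive.2 S (mem_active_of_forall_passes le_rfl hS h) (coin_of_expo_eq_zero ?_) he
  simp [Schedule.expo, Schedule.round_stage_add]

variable (x) in
lemma alive_numRounds : alive x P.numRounds = ∅ := by
  refine eq_empty_iff_forall_notMem.2 fun e he => ?_
  obtain ⟨S, hS, heS⟩ := I.exists_mem e (alive_subset x _ he)
  refine notMem_alive_of_forall_passes (σ := P.L) hS heS (fun j hj => ?_) he
  have hlevel : P.level (P.L * (P.T + 1) + j) = 0 := by
    rw [Schedule.level_stage_add hj, Nat.sub_self]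
  have hlive := alive_antitone x (Schedule.stage_add_lt_numRounds le_rfl hj).le he
  refine passes_of_level_le (hlevel.trans_le (Nat.zero_le _)) ?_
  rw [hlevel]
  exact card_pos.2 ⟨e, mem_inter.2 ⟨heS, hlive⟩⟩

end Rounds

section Failure

variable {P : Schedule} {I : SetSystem} (x : Outcome P I)

/-- The sets containing `e` which may join in round `τ` and are in the race before round `k` of
the stage of `τ`. -/
def hitList (τ e k : ℕ) : Finset ℕ :=
  {S ∈ I.setsOf e ∩ cand x (P.start τ + k) | coin x (true, S, τ)}

/-- The elements of `S` counted in round `τ` among those uncovered at the start of the stage. -/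
def preSample (τ S : ℕ) : Finset ℕ := sample x (alive x (P.start τ)) τ S

/-- `Fail false τ e`: the local simulation gives up when asked whether the element `e` is uncovered
before round `τ`. `Fail true τ S`: it gives up when asked whether the set `S` has enough counted
uncovered elements in round `τ`. -/
inductive Fail : Bool → ℕ → ℕ → Prop
  | prev {τ e : ℕ} (h : Fail false τ e) : Fail false (τ + 1) e
  | cap {τ e k : ℕ} (he : e ∈ alive x τ) (hk : k ≤ P.round τ)
      (h : P.cap (P.round τ - k) < #(hitList x τ e k)) : Fail false (τ + 1) e
  | hit {τ e k S : ℕ} (he : e ∈ alive x τ) (hk : k ≤ P.round τ)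
      (hS : S ∈ hitList x τ e k) (h : Fail true (P.start τ + k) S) : Fail false (τ + 1) e
  | start {τ S e : ℕ} (he : e ∈ I.elts S) (hc : coin x (false, e, τ) = true)
      (h : Fail false (P.start τ) e) : Fail true τ S
  | sample {τ S : ℕ} (h : P.maxSample < #(preSample x τ S)) : Fail true τ S
  | elem {τ S e : ℕ} (he : e ∈ preSample x τ S) (h : Fail false τ e) : Fail true τ S

/-- The local simulation gives up when asked about the set `S`. -/
def FailSet (S : ℕ) : Prop :=
  ∃ τ < P.numRounds, coin x (true, S, τ) = true ∧
    ∃ k ≤ P.round τ, S ∈ cand x (P.start τ + k) ∧ Fail x true (P.start τ + k) S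

open Classical in
/-- The set cover: the sets that join, and those about which the local simulation gives up. -/
noncomputable def cover : Finset ℕ :=
  {S ∈ I.sets | (∃ τ < P.numRounds, S ∈ joined x τ) ∨ FailSet x S}

lemma isCover_cover : I.IsCover (cover x) := by
  classical
  refine ⟨filter_subset _ _, fun e he => ?_⟩
  obtain ⟨τ, hτ, S, hS, heS⟩ :=
    exists_joined_of_notMem_alive x (τ := P.numRounds) he (by simp [alive_numRounds])
  exact ⟨S, mem_filter.2 ⟨joined_subset x τ hS, .inl ⟨τ, hτ, hS⟩⟩, heS⟩

end Failure

section Law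

open MeasureTheory ProbabilityTheory

variable {P : Schedule} {I : SetSystem}

/-- The law of the coins. -/
noncomputable def law (P : Schedule) (I : SetSystem) : Measure (Outcome P I) :=
  Measure.pi fun k => Ber(true, false, halfPow (P.expo k.1.1 k.1.2.2))

instance : IsProbabilityMeasure (law P I) := inferInstanceAs (IsProbabilityMeasure (Measure.pi _))

/-- The coins of the rounds before round `τ`. -/
def coinsBefore (P : Schedule) (I : SetSystem) (τ : ℕ) : Set (keySet P I) := {k | k.1.2.2 < τ}

/-- The join coins (`true`) or the count coins (`false`) of round `τ`. -/
def coinsAt (P : Schedule) (I : SetSystem) (b : Bool) (τ : ℕ) : Set (keySet P I) :=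
  {k | k.1.1 = b ∧ k.1.2.2 = τ}

lemma coinsBefore_subset_compl_coinsAt {τ τ' : ℕ} (h : τ' ≤ τ) (b : Bool) :
    coinsBefore P I τ' ⊆ (coinsAt P I b τ)ᶜ :=
  fun _ hk hk' => absurd (hk'.2 ▸ hk : τ < τ') h.not_gt

lemma mem_keySet {b : Bool} {i τ : ℕ} :
    (b, i, τ) ∈ keySet P I ↔ i ∈ I.sets ∪ I.univ ∧ τ < P.numRounds := by
  simp [keySet, or_and_right]

lemma integral_coin (k : keySet P I) (g : Bool → ℝ) :
    ∫ c, g (decide (P.expo k.1.1 k.1.2.2 = 0) || c)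
        ∂Ber(true, false, halfPow (P.expo k.1.1 k.1.2.2)) =
      P.prob k.1.1 k.1.2.2 * g true + (1 - P.prob k.1.1 k.1.2.2) * g false := by
  rw [integral_bernoulliMeasure]
  by_cases h : P.expo k.1.1 k.1.2.2 = 0 <;> simp [h, halfPow, Schedule.prob]

lemma integral_mul_prod_coin {b : Bool} {τ : ℕ} (hτ : τ < P.numRounds) {f : Outcome P I → ℝ}
    {A : Outcome P I → Finset ℕ} (hf : DependsOn f (coinsAt P I b τ)ᶜ)
    (hA : DependsOn A (coinsAt P I b τ)ᶜ) (hAI : ∀ x, A x ⊆ I.sets ∪ I.univ) (g : Bool → ℝ) :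
    ∫ x, f x * ∏ i ∈ A x, g (coin x (b, i, τ)) ∂law P I =
      ∫ x, f x * (P.prob b τ * g true + (1 - P.prob b τ) * g false) ^ #(A x) ∂law P I := by
  classical
  let s : Finset (keySet P I) := {k | k.1.1 = b ∧ k.1.2.2 = τ}
  let B x : Finset (keySet P I) := {k ∈ s | k.1.2.1 ∈ A x}
  let G (k : keySet P I) (c : Bool) : ℝ := g (decide (P.expo k.1.1 k.1.2.2 = 0) || c)
  have hs : (s : Set (keySet P I)) = coinsAt P I b τ := by ext; simp [s, coinsAt]
  rw [← hs] at hf hA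
  have hB : DependsOn B (↑s)ᶜ := fun x y hxy => by simp only [B, hA hxy]
  have hprod : ∀ (x : Outcome P I) (u : keySet P I → ℝ) (v : ℕ → ℝ),
      (∀ k : keySet P I, k.1.1 = b → k.1.2.2 = τ → u k = v k.1.2.1) →
      ∏ k ∈ B x, u k = ∏ i ∈ A x, v i := by
    intro x u v huv
    refine prod_bij (fun k _ => k.1.2.1) (fun k hk => (mem_filter.1 hk).2) ?_ ?_ ?_
    · rintro ⟨⟨b₁, i, τ₁⟩, _⟩ h₁ ⟨⟨b₂, j, τ₂⟩, _⟩ h₂ rfl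
      simp_all [B, s]
    · exact fun i hi => ⟨⟨(b, i, τ), mem_keySet.2 ⟨hAI x hi, hτ⟩⟩, by simp [B, s, hi], rfl⟩
    · intro k hk
      simp only [B, s, mem_filter] at hk
      exact huv k hk.1.2.1 hk.1.2.2
  calc ∫ x, f x * ∏ i ∈ A x, g (coin x (b, i, τ)) ∂law P I
      = ∫ x, f x * ∏ k ∈ B x, G k (x k) ∂law P I := by
        congr! 3 with x
        refine (hprod x _ _ ?_).symm
        rintro ⟨⟨_, i, _⟩, hk⟩ rfl rfl
        simp [G, coin, hk]
    _ = ∫ x, f x * ∏ k ∈ B x, ∫ c, G k c ∂Ber(true, false, halfPow (P.expo k.1.1 k.1.2.2))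
          ∂law P I := integral_mul_prod_pi_of_subset _ hf hB (fun _ => filter_subset _ _) G
    _ = ∫ x, f x * (P.prob b τ * g true + (1 - P.prob b τ) * g false) ^ #(A x) ∂law P I := by
        congr! 3 with x
        rw [← prod_const]
        refine hprod x _ _ ?_
        rintro ⟨⟨_, i, _⟩, hk⟩ rfl rfl
        exact integral_coin _ g

lemma integral_mul_pow_card_coin {b : Bool} {τ : ℕ} (hτ : τ < P.numRounds) {f : Outcome P I → ℝ}
    {A : Outcome P I → Finset ℕ} (hf : DependsOn f (coinsAt P I b τ)ᶜ)
    (hA : DependsOn A (coinsAt P I b τ)ᶜ) (hAI : ∀ x, A x ⊆ I.sets ∪ I.univ) (c : ℝ) :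
    ∫ x, f x * (1 + c) ^ #{i ∈ A x | coin x (b, i, τ)} ∂law P I =
      ∫ x, f x * (1 + P.prob b τ * c) ^ #(A x) ∂law P I := by
  have := integral_mul_prod_coin hτ hf hA hAI fun b => if b then 1 + c else 1
  simp only [prod_ite, prod_const, one_pow, mul_one, if_true, Bool.false_eq_true, if_false] at this
  rw [this]
  congr! 4
  ring

lemma integral_mul_ite_coin {b : Bool} {i τ : ℕ} (hi : i ∈ I.sets ∪ I.univ) (hτ : τ < P.numRounds)
    {f : Outcome P I → ℝ} (hf : DependsOn f (coinsAt P I b τ)ᶜ) :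
    ∫ x, f x * (if coin x (b, i, τ) then 1 else 0) ∂law P I = P.prob b τ * ∫ x, f x ∂law P I := by
  have := integral_mul_prod_coin hτ hf ((dependsOn_const {i}).mono (Set.empty_subset _))
    (fun _ => singleton_subset_iff.2 hi) (fun c => if c then 1 else 0)
  simp only [prod_singleton, card_singleton, pow_one] at this
  rw [this, integral_mul_const]
  simp [mul_comm]

lemma coin_congr {x y : Outcome P I} {k : Key} (h : ∀ hk : k ∈ keySet P I, x ⟨k, hk⟩ = y ⟨k, hk⟩) :
    coin x k = coin y k := by
  unfold coin
  split_ifs with hk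
  · rw [h hk]
  · rfl

lemma rounds_congr {x y : Outcome P I} {τ : ℕ} (h : ∀ k ∈ coinsBefore P I τ, x k = y k) :
    rounds x τ = rounds y τ := by
  induction τ with
  | zero => rfl
  | succ τ ih =>
    have hprev := ih fun k hk => h k (hk.trans τ.lt_succ_self)
    have hcoin : ∀ b i, coin x (b, i, τ) = coin y (b, i, τ) := fun b i =>
      coin_congr fun hk => h ⟨_, hk⟩ τ.lt_succ_self
    simp only [rounds, hprev, sample, hcoin]
    congr!

lemma alive_congr {x y : Outcome P I} {τ : ℕ} (h : ∀ k ∈ coinsBefore P I τ, x k = y k) :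
    alive x τ = alive y τ :=
  congrArg Prod.fst (rounds_congr h)

lemma cand_congr {x y : Outcome P I} {τ : ℕ} (h : ∀ k ∈ coinsBefore P I τ, x k = y k) :
    cand x τ = cand y τ :=
  congrArg Prod.snd (rounds_congr h)

lemma active_congr {x y : Outcome P I} {τ : ℕ} (h : ∀ k ∈ (coinsAt P I true τ)ᶜ, x k = y k) :
    active x τ = active y τ := by
  have hcoin : ∀ e, coin x (false, e, τ) = coin y (false, e, τ) := fun e =>
    coin_congr fun hk =>
      h ⟨_, hk⟩ fun hmem => Bool.false_ne_true hmem.1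
  have hbefore : ∀ k ∈ coinsBefore P I τ, x k = y k := fun k hk =>
    h k (coinsBefore_subset_compl_coinsAt le_rfl true hk)
  simp only [active, Passes, sample, cand_congr hbefore, alive_congr hbefore, hcoin]
  congr!

end Law

section Estimates

open MeasureTheory ProbabilityTheory

variable {P : Schedule} {I : SetSystem}

lemma mem_setsOf {e S : ℕ} : S ∈ I.setsOf e ↔ S ∈ I.sets ∧ e ∈ I.elts S := by
  simp [SetSystem.setsOf]

lemma sum_sets_elts {M : Type*} [AddCommMonoid M] (F : ℕ → ℕ → M) :
    ∑ S ∈ I.sets, ∑ e ∈ I.elts S, F S e = ∑ e ∈ I.univ, ∑ S ∈ I.setsOf e, F S e := by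
  refine sum_comm' fun S e => ?_
  rw [mem_setsOf]
  exact ⟨fun h => ⟨h, I.elts_subset S h.1 h.2⟩, fun h => h.1⟩

lemma ite_mem_alive_succ (x : Outcome P I) (τ e : ℕ) :
    (if e ∈ alive x (τ + 1) then 1 else 0 : ℝ) = (if e ∈ alive x τ then 1 else 0) *
      ∏ S ∈ I.setsOf e ∩ active x τ, if coin x (true, S, τ) = false then 1 else 0 := by
  have hmem : e ∈ alive x (τ + 1) ↔
      e ∈ alive x τ ∧ ∀ S ∈ I.setsOf e ∩ active x τ, coin x (true, S, τ) = false := by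
    refine (mem_alive_succ x).trans (and_congr_right fun _ => forall_congr' fun S => ?_)
    rw [mem_inter, mem_setsOf, ← Bool.not_eq_true]
    have := @active_subset _ _ x τ S
    tauto
  simp only [prod_ite_zero, prod_const_one, hmem, ite_and, ite_mul, one_mul, zero_mul]

lemma integral_mul_ite_mem_alive_succ {τ e : ℕ} (hτ : τ < P.numRounds) {f : Outcome P I → ℝ}
    (hf : DependsOn f (coinsAt P I true τ)ᶜ) :
    ∫ x, f x * (if e ∈ alive x (τ + 1) then 1 else 0) ∂law P I =
      ∫ x, f x * (if e ∈ alive x τ then 1 else 0) *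
        (1 - P.joinProb τ) ^ #(I.setsOf e ∩ active x τ) ∂law P I := by
  have hactive : DependsOn (fun x => I.setsOf e ∩ active x τ) (coinsAt P I true τ)ᶜ :=
    fun x y h => congrArg _ (active_congr h)
  have halive : DependsOn (fun x => f x * if e ∈ alive x τ then 1 else 0)
      (coinsAt P I true τ)ᶜ := fun x y h => by
    simp only [hf h, alive_congr fun k hk => h k (coinsBefore_subset_compl_coinsAt le_rfl true hk)]
  simp_rw [ite_mem_alive_succ, ← mul_assoc]
  rw [integral_mul_prod_coin hτ halive hactive (fun x => inter_subset_left.trans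
    ((filter_subset _ _).trans subset_union_left)) fun c => if c = false then 1 else 0]
  simp

lemma mul_pow_le_one_sub {p : ℝ} (h0 : 0 ≤ p) (h1 : p ≤ 1) (d : ℕ) :
    d * p * (1 - p) ^ d ≤ 1 - (1 - p) ^ d := by
  have hbernoulli : 1 + d * p ≤ (1 + p) ^ d := one_add_mul_le_pow (by linarith) d
  have hprod : (1 + p) ^ d * (1 - p) ^ d ≤ 1 := by
    rw [← mul_pow]; exact pow_le_one₀ (by nlinarith) (by nlinarith)
  have hpow : 0 ≤ (1 - p) ^ d := pow_nonneg (by linarith) d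
  linarith [mul_le_mul_of_nonneg_right hbernoulli hpow]

-- A set that joins in round `τ` is charged to the `thr τ` or more counted elements letting it in.
lemma thr_mul_card_joined_le (x : Outcome P I) (τ : ℕ) :
    (P.thr τ * #(joined x τ) : ℝ) ≤ ∑ S ∈ I.sets, ∑ e ∈ I.elts S,
      (if S ∈ cand x τ ∧ e ∈ alive x τ then 1 else 0) * (if coin x (false, e, τ) then 1 else 0) *
        (if coin x (true, S, τ) then 1 else 0) := by
  have hjoined : joined x τ = {S ∈ I.sets | S ∈ joined x τ} :=
    (filter_mem_eq_inter.trans (inter_eq_right.2 (joined_subset x τ))).symm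
  rw [hjoined, card_filter, Nat.cast_sum, mul_sum]
  refine sum_le_sum fun S _ => ?_
  by_cases hS : S ∈ joined x τ
  · rw [if_pos hS]
    obtain ⟨hactive, hcoin⟩ := mem_filter.1 hS
    obtain ⟨hcand, hpass⟩ := mem_filter.1 hactive
    have hsample : (#(sample x (alive x τ) τ S) : ℝ) = ∑ e ∈ I.elts S,
        (if e ∈ alive x τ then 1 else 0) * if coin x (false, e, τ) then 1 else 0 := by
      simp only [sample, ← filter_mem_eq_inter, filter_filter, card_filter, Nat.cast_sum,
        Nat.cast_ite, Nat.cast_one, Nat.cast_zero, ite_and, ite_mul, one_mul, zero_mul]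
    simp only [hcand, hcoin, true_and, if_true, mul_one, ← hsample, Nat.cast_one]
    exact_mod_cast hpass
  · rw [if_neg hS, Nat.cast_zero, mul_zero]
    exact sum_nonneg fun e _ => by positivity

lemma integral_ite_mul_coin_mul_coin {τ S e : ℕ} (hτ : τ < P.numRounds) (hS : S ∈ I.sets)
    (he : e ∈ I.elts S) :
    ∫ x, (if S ∈ cand x τ ∧ e ∈ alive x τ then 1 else 0) *
        (if coin x (false, e, τ) then 1 else 0) * (if coin x (true, S, τ) then 1 else 0) ∂law P I =
      P.joinProb τ * (P.sampleProb τ *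
        ∫ x, (if S ∈ cand x τ ∧ e ∈ alive x τ then 1 else 0) ∂law P I) := by
  have hbase : DependsOn (fun x : Outcome P I =>
      if S ∈ cand x τ ∧ e ∈ alive x τ then (1 : ℝ) else 0) (coinsBefore P I τ) := fun x y h => by
    simp only [cand_congr h, alive_congr h]
  have hcount : DependsOn (fun x : Outcome P I =>
      (if S ∈ cand x τ ∧ e ∈ alive x τ then (1 : ℝ) else 0) *
        if coin x (false, e, τ) then 1 else 0) (coinsAt P I true τ)ᶜ := fun x y h => by
    have hcoin : coin x (false, e, τ) = coin y (false, e, τ) :=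
      coin_congr fun hk => h ⟨_, hk⟩ fun hmem => Bool.false_ne_true hmem.1
    simp only [hbase.mono (coinsBefore_subset_compl_coinsAt le_rfl true) h, hcoin]
  rw [integral_mul_ite_coin (mem_union_left _ hS) hτ hcount, integral_mul_ite_coin
    (mem_union_right _ (I.elts_subset S hS he)) hτ
    (hbase.mono (coinsBefore_subset_compl_coinsAt le_rfl false))]

lemma integral_card_joined_le {τ : ℕ} (hτ : τ < P.numRounds) :
    ∫ x, (#(joined x τ) : ℝ) ∂law P I ≤ (1 / 2) ^ P.level τ * ∑ e ∈ I.univ, P.joinProb τ *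
      ∫ x, (#(I.setsOf e ∩ cand x τ) : ℝ) * (if e ∈ alive x τ then 1 else 0) ∂law P I := by
  have hthr : (0 : ℝ) < P.thr τ := mod_cast P.thr_pos τ
  have hcharge := integral_mono (μ := law P I) .of_finite .of_finite
    fun x => thr_mul_card_joined_le x τ
  rw [integral_const_mul, ← le_div_iff₀' hthr] at hcharge
  refine hcharge.trans_eq ?_
  have hpow : P.sampleProb τ / P.thr τ = (1 / 2) ^ P.level τ := by
    rw [← P.sampleProb_mul_two_pow τ, div_mul_cancel_left₀ (P.prob_pos _ _).ne', one_div, inv_pow]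
  have hcard : ∀ e,
      ∫ x, (#(I.setsOf e ∩ cand x τ) : ℝ) * (if e ∈ alive x τ then 1 else 0) ∂law P I =
      ∑ S ∈ I.setsOf e, ∫ x, (if S ∈ cand x τ ∧ e ∈ alive x τ then 1 else 0) ∂law P I := by
    intro e
    rw [← integral_finsetSum _ fun _ _ => .of_finite]
    congr! 2 with x
    simp only [← filter_mem_eq_inter, card_filter, Nat.cast_sum, Nat.cast_ite, Nat.cast_one,
      Nat.cast_zero, sum_mul, ite_mul, one_mul, zero_mul, ite_and]
  calc (∫ x, ∑ S ∈ I.sets, ∑ e ∈ I.elts S, _ ∂law P I) / P.thr τ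
      = (∑ S ∈ I.sets, ∑ e ∈ I.elts S, P.joinProb τ * (P.sampleProb τ *
          ∫ x, (if S ∈ cand x τ ∧ e ∈ alive x τ then 1 else 0) ∂law P I)) / P.thr τ := by
        rw [integral_finsetSum _ fun _ _ => .of_finite]
        congr! 2 with S hS
        rw [integral_finsetSum _ fun _ _ => .of_finite]
        exact sum_congr rfl fun e he => integral_ite_mul_coin_mul_coin hτ hS he
    _ = _ := by
        simp_rw [sum_sets_elts, hcard, ← mul_sum, ← hpow]
        ring

lemma joinProb_mul_integral_le_of_round_eq_zero {τ e : ℕ} (he : #(I.setsOf e) ≤ 2 ^ P.T)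
    (hτ : P.round τ = 0) : P.joinProb τ * ∫ x, (#(I.setsOf e ∩ cand x τ) : ℝ) *
        (if e ∈ alive x τ then 1 else 0) ∂law P I ≤ (law P I).real {x | e ∈ alive x τ} := by
  rw [← integral_ite_eq_measureReal, ← integral_const_mul]
  refine integral_mono .of_finite .of_finite fun x => ?_
  have hcard : (#(I.setsOf e ∩ cand x τ) : ℝ) ≤ 2 ^ P.T :=
    mod_cast (card_le_card inter_subset_left).trans he
  have hprob : P.joinProb τ * 2 ^ P.T = 1 := by
    simp [Schedule.joinProb, Schedule.prob, Schedule.expo, hτ]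
  calc P.joinProb τ * (#(I.setsOf e ∩ cand x τ) * if e ∈ alive x τ then 1 else 0)
      ≤ P.joinProb τ * (2 ^ P.T * if e ∈ alive x τ then 1 else 0) := by
        have := (P.prob_pos true τ).le
        gcongr
    _ = if e ∈ alive x τ then 1 else 0 := by rw [← mul_assoc, hprob, one_mul]

lemma joinProb_succ_mul_integral_le {τ e : ℕ} (hτ : τ < P.numRounds) (hr : P.round (τ + 1) ≠ 0) :
    P.joinProb (τ + 1) * ∫ x, (#(I.setsOf e ∩ cand x (τ + 1)) : ℝ) *
        (if e ∈ alive x (τ + 1) then 1 else 0) ∂law P I ≤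
      2 * ((law P I).real {x | e ∈ alive x τ} - (law P I).real {x | e ∈ alive x (τ + 1)}) := by
  have hcand : ∀ x : Outcome P I, cand x (τ + 1) = active x τ := fun x => by
    rw [cand_succ, if_neg hr]
  have hactive : DependsOn (fun x : Outcome P I => (#(I.setsOf e ∩ active x τ) : ℝ))
      (coinsAt P I true τ)ᶜ := fun x y h => by
    simp only [active_congr h]
  have hsurvive := integral_mul_ite_mem_alive_succ (P := P) (I := I) (e := e) (f := fun _ => 1) hτ
    ((dependsOn_const 1).mono (Set.empty_subset _))
  simp only [one_mul] at hsurvive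
  simp_rw [hcand]
  rw [Schedule.joinProb_succ hr, integral_mul_ite_mem_alive_succ hτ hactive,
    ← integral_ite_eq_measureReal, ← integral_ite_eq_measureReal, hsurvive,
    ← integral_sub .of_finite .of_finite, mul_assoc, ← integral_const_mul (P.joinProb τ)]
  refine mul_le_mul_of_nonneg_left (integral_mono .of_finite .of_finite fun x => ?_) two_pos.le
  have := mul_pow_le_one_sub (P.prob_pos true τ).le (P.prob_le_one true τ)
    #(I.setsOf e ∩ active x τ)
  by_cases h : e ∈ alive x τ <;> simp only [h, if_true, if_false] <;> linarith

-- The number of sets that may join over an element telescopes, as its being uncovered does.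
lemma sum_joinProb_mul_integral_le {σ e n : ℕ} (hσ : σ ≤ P.L) (he : #(I.setsOf e) ≤ 2 ^ P.T)
    (hn : n ≤ P.T) :
    ∑ j ∈ range (n + 1), P.joinProb (σ * (P.T + 1) + j) *
        ∫ x, (#(I.setsOf e ∩ cand x (σ * (P.T + 1) + j)) : ℝ) *
          (if e ∈ alive x (σ * (P.T + 1) + j) then 1 else 0) ∂law P I ≤
      3 * (law P I).real {x | e ∈ alive x (σ * (P.T + 1))} -
        2 * (law P I).real {x | e ∈ alive x (σ * (P.T + 1) + n)} := by
  induction n with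
  | zero =>
    have := joinProb_mul_integral_le_of_round_eq_zero (P := P) he
      (Schedule.round_stage_add (σ := σ) hn)
    simp only [zero_add, sum_range_one, add_zero] at this ⊢
    linarith
  | succ n ih =>
    rw [sum_range_succ]
    have hround := Schedule.round_stage_add (σ := σ) hn
    have := joinProb_succ_mul_integral_le (I := I) (e := e)
      (Schedule.stage_add_lt_numRounds hσ (n.le_succ.trans hn))
      (by rw [add_assoc, hround]; exact n.succ_ne_zero)
    rw [add_assoc] at this
    linarith [ih (n.le_succ.trans hn)]

lemma sum_integral_card_joined_le {σ : ℕ} (hσ : σ ≤ P.L)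
    (hI : ∀ e ∈ I.univ, #(I.setsOf e) ≤ 2 ^ P.T) :
    ∑ j ∈ range (P.T + 1), ∫ x, (#(joined x (σ * (P.T + 1) + j)) : ℝ) ∂law P I ≤
      3 * (1 / 2) ^ (P.L - σ) *
        ∑ e ∈ I.univ, (law P I).real {x | e ∈ alive x (σ * (P.T + 1))} := by
  calc ∑ j ∈ range (P.T + 1), ∫ x, (#(joined x (σ * (P.T + 1) + j)) : ℝ) ∂law P I
      ≤ ∑ j ∈ range (P.T + 1), (1 / 2) ^ (P.L - σ) * ∑ e ∈ I.univ,
          P.joinProb (σ * (P.T + 1) + j) * ∫ x, (#(I.setsOf e ∩ cand x (σ * (P.T + 1) + j)) : ℝ) *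
            (if e ∈ alive x (σ * (P.T + 1) + j) then 1 else 0) ∂law P I := by
        refine sum_le_sum fun j hj => ?_
        have hj : j ≤ P.T := Nat.lt_succ_iff.1 (mem_range.1 hj)
        simpa only [Schedule.level_stage_add hj] using
          integral_card_joined_le (I := I) (Schedule.stage_add_lt_numRounds hσ hj)
    _ ≤ (1 / 2) ^ (P.L - σ) *
          ∑ e ∈ I.univ, 3 * (law P I).real {x | e ∈ alive x (σ * (P.T + 1))} := by
        rw [← mul_sum, sum_comm]
        gcongr with e he
        exact (sum_joinProb_mul_integral_le hσ (hI e he) le_rfl).trans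
          (sub_le_self _ (by positivity))
    _ = _ := by rw [← mul_sum]; ring

end Estimates

/-! ### Concentration of the estimates -/

section Concentration

open MeasureTheory ProbabilityTheory

variable {P : Schedule} {I : SetSystem}

lemma one_add_pow_le_exp {q : ℝ} (hq : -1 ≤ q) (n : ℕ) : (1 + q) ^ n ≤ Real.exp (n * q) := by
  rw [Real.exp_nat_mul]
  exact pow_le_pow_left₀ (by linarith) ((add_comm 1 q).trans_le (Real.add_one_le_exp q)) n

lemma one_sub_half_pow_le {q : ℝ} (hq : q ≤ 1) {n m : ℕ} (h : 4 * m ≤ n * q) :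
    (1 - q / 2) ^ n ≤ (1 / 4) ^ m := by
  have hexp : Real.exp (-2) ≤ 1 / 4 := by
    rw [Real.exp_neg, one_div]
    refine inv_anti₀ (by norm_num) ?_
    calc (4 : ℝ) = 2 ^ 2 := by norm_num
      _ ≤ Real.exp 1 ^ 2 := pow_le_pow_left₀ (by norm_num) Real.exp_one_gt_two.le 2
      _ = Real.exp 2 := by rw [← Real.exp_nat_mul]; norm_num
  calc (1 - q / 2) ^ n = (1 + -(q / 2)) ^ n := by rw [sub_eq_add_neg]
    _ ≤ Real.exp (n * -(q / 2)) := one_add_pow_le_exp (by linarith) n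
    _ ≤ Real.exp (m * -2) := Real.exp_le_exp.2 (by linarith)
    _ = Real.exp (-2) ^ m := Real.exp_nat_mul _ _
    _ ≤ (1 / 4) ^ m := pow_le_pow_left₀ (Real.exp_pos _).le hexp m

lemma one_add_pow_le_four_pow {q : ℝ} (hq : 0 ≤ q) {n m : ℕ} (h : n * q ≤ m) :
    (1 + q) ^ n ≤ 4 ^ m := by
  calc (1 + q) ^ n ≤ Real.exp (n * q) := one_add_pow_le_exp (by linarith) n
    _ ≤ Real.exp (m * 1) := Real.exp_le_exp.2 (by linarith)
    _ = Real.exp 1 ^ m := Real.exp_nat_mul _ _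
    _ ≤ 4 ^ m := pow_le_pow_left₀ (Real.exp_pos _).le (by linarith [Real.exp_one_lt_d9]) m

lemma two_le_one_add_half_pow_pow (d : ℕ) : (2 : ℝ) ≤ (1 + (1 / 2) ^ d) ^ 2 ^ d := by
  have hpow : (0 : ℝ) ≤ (1 / 2) ^ d := by positivity
  calc (2 : ℝ) = 1 + (2 ^ d : ℕ) * (1 / 2) ^ d := by
        push_cast
        rw [← mul_pow]
        norm_num
    _ ≤ _ := one_add_mul_le_pow (by linarith) (2 ^ d)

lemma one_add_half_pow_succ_pow_le {n d : ℕ} (h : n ≤ 2 ^ d) :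
    (1 + (1 / 2 : ℝ) ^ (d + 1)) ^ n ≤ 2 := by
  have hpow : (0 : ℝ) ≤ (1 / 2) ^ (d + 1) := by positivity
  have hle : (n * (1 / 2) ^ (d + 1) : ℝ) ≤ 1 / 2 := by
    calc (n * (1 / 2) ^ (d + 1) : ℝ) ≤ 2 ^ d * (1 / 2) ^ (d + 1) := by
          gcongr
          exact_mod_cast h
      _ = 1 / 2 := by rw [pow_succ, ← mul_assoc, ← mul_pow]; norm_num
  have hsq : Real.exp (1 / 2) ^ 2 = Real.exp 1 := by rw [← Real.exp_nat_mul]; norm_num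
  calc (1 + (1 / 2 : ℝ) ^ (d + 1)) ^ n ≤ Real.exp (n * (1 / 2) ^ (d + 1)) :=
        one_add_pow_le_exp (by linarith) n
    _ ≤ Real.exp (1 / 2) := Real.exp_le_exp.2 hle
    _ ≤ 2 := by nlinarith [Real.exp_one_lt_d9, Real.exp_pos (1 / 2)]

lemma integral_mul_pow_card_sample {τ τ' S : ℕ} (hS : S ∈ I.sets) (hτ : τ < P.numRounds)
    (hτ' : τ' ≤ τ) (f : ℕ → ℝ) (c : ℝ) :
    ∫ x, f #(I.elts S ∩ alive x τ') * (1 + c) ^ #(sample x (alive x τ') τ S) ∂law P I =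
      ∫ x, f #(I.elts S ∩ alive x τ') *
        (1 + P.sampleProb τ * c) ^ #(I.elts S ∩ alive x τ') ∂law P I := by
  have hlive : DependsOn (fun x : Outcome P I => I.elts S ∩ alive x τ')
      (coinsAt P I false τ)ᶜ := fun x y h => by
    simp only [alive_congr fun k hk => h k (coinsBefore_subset_compl_coinsAt hτ' false hk)]
  exact integral_mul_pow_card_coin hτ (fun x y h => congrArg (fun A => f #A) (hlive h)) hlive
    (fun _ => inter_subset_left.trans ((I.elts_subset S hS).trans subset_union_right)) c

lemma law_real_not_passes_le {τ S : ℕ} (hS : S ∈ I.sets) (hτ : τ < P.numRounds) :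
    (law P I).real {x | 2 ^ (P.level τ + 2) < #(I.elts S ∩ alive x τ) ∧ ¬Passes x τ S} ≤
      (1 / 2) ^ 2 ^ P.ℓ := by
  rcases Nat.lt_or_ge (P.level τ) P.ℓ with hl | hl
  · have hempty : {x : Outcome P I | 2 ^ (P.level τ + 2) < #(I.elts S ∩ alive x τ) ∧
        ¬Passes x τ S} = ∅ := Set.eq_empty_of_forall_notMem fun x hx => hx.2 <|
      passes_of_level_le hl.le ((Nat.pow_le_pow_right two_pos (by omega)).trans hx.1.le)
    rw [hempty, measureReal_empty]
    positivity
  have hthr : P.thr τ = 2 ^ P.ℓ := by rw [Schedule.thr, min_eq_right hl]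
  have hquot : ((1 / 4) ^ P.thr τ / (1 / 2) ^ P.thr τ : ℝ) = (1 / 2) ^ 2 ^ P.ℓ := by
    rw [← div_pow, hthr]
    norm_num
  rw [← hquot]
  refine measureReal_setOf_le_div (f := fun x =>
      (if 2 ^ (P.level τ + 2) < #(I.elts S ∩ alive x τ) then 1 else 0) *
        (1 + -(1 / 2)) ^ #(sample x (alive x τ) τ S))
    (by positivity) (fun x => by positivity) (fun x hx => ?_) ?_
  · rw [if_pos hx.1, one_mul, show (1 + -(1 / 2) : ℝ) = 1 / 2 by norm_num]
    exact pow_le_pow_of_le_one (by norm_num) (by norm_num) (not_le.1 hx.2).le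
  · rw [integral_mul_pow_card_sample hS hτ le_rfl
      (fun n => if 2 ^ (P.level τ + 2) < n then 1 else 0)]
    refine integral_le_of_forall_le fun x => ?_
    split_ifs with h
    · have hcard : (2 : ℝ) ^ (P.level τ + 2) ≤ #(I.elts S ∩ alive x τ) := mod_cast h.le
      have hmean : (4 * P.thr τ : ℝ) ≤ #(I.elts S ∩ alive x τ) * P.sampleProb τ := by
        rw [← P.sampleProb_mul_two_pow τ]
        rw [pow_add] at hcard
        linarith [mul_le_mul_of_nonneg_right hcard (P.prob_pos false τ).le]
      rw [one_mul]
      convert one_sub_half_pow_le (P.prob_le_one false τ) hmean using 2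
      ring
    · rw [zero_mul]
      positivity

lemma law_real_two_pow_lt_card_after_stage_le {σ S : ℕ} (hS : S ∈ I.sets) (hσ : σ ≤ P.L) :
    (law P I).real {x | 2 ^ (P.L - σ + 2) < #(I.elts S ∩ alive x ((σ + 1) * (P.T + 1)))} ≤
      (P.T + 1) * (1 / 2) ^ 2 ^ P.ℓ := by
  have hexists : ∀ x : Outcome P I,
      2 ^ (P.L - σ + 2) < #(I.elts S ∩ alive x ((σ + 1) * (P.T + 1))) →
      ∃ j ∈ range (P.T + 1), 2 ^ (P.level (σ * (P.T + 1) + j) + 2) <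
        #(I.elts S ∩ alive x (σ * (P.T + 1) + j)) ∧ ¬Passes x (σ * (P.T + 1) + j) S := by
    intro x hx
    obtain ⟨e, he⟩ := card_pos.1 ((Nat.zero_le _).trans_lt hx)
    have hfail : ∃ j ≤ P.T, ¬Passes x (σ * (P.T + 1) + j) S := by
      by_contra! hpass
      exact notMem_alive_of_forall_passes hS (mem_inter.1 he).1 hpass (mem_inter.1 he).2
    obtain ⟨j, hj, hfail⟩ := hfail
    refine ⟨j, mem_range_succ_iff.2 hj, ?_, hfail⟩
    rw [Schedule.level_stage_add hj]
    refine hx.trans_le (card_le_card (inter_subset_inter_left (alive_antitone x ?_)))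
    rw [add_one_mul]
    omega
  refine ((measureReal_setOf_mono hexists).trans (measureReal_setOf_exists_mem_le fun j hj =>
    law_real_not_passes_le hS
      (Schedule.stage_add_lt_numRounds hσ (mem_range_succ_iff.1 hj)))).trans_eq ?_
  simp

lemma law_real_two_pow_lt_card_start_le {τ S : ℕ} (hS : S ∈ I.sets) (hτ : τ < P.numRounds)
    (hcard : #(I.elts S) ≤ 2 ^ P.L) :
    (law P I).real {x | 2 ^ (P.level τ + 3) < #(I.elts S ∩ alive x (P.start τ))} ≤
      (P.T + 1) * (1 / 2) ^ 2 ^ P.ℓ := by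
  have hσ : τ / (P.T + 1) ≤ P.L :=
    Nat.lt_succ_iff.1 (Nat.div_lt_of_lt_mul (hτ.trans_eq (mul_comm _ _)))
  rw [Schedule.start_eq, Schedule.level]
  cases hstage : τ / (P.T + 1) with
  | zero =>
    have hempty : {x : Outcome P I |
        2 ^ (P.L - 0 + 3) < #(I.elts S ∩ alive x (0 * (P.T + 1)))} = ∅ :=
      Set.eq_empty_of_forall_notMem fun x hx => hx.not_ge <|
        (card_le_card inter_subset_left).trans <| hcard.trans <|
          Nat.pow_le_pow_right two_pos (by omega)
    rw [hempty, measureReal_empty]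
    positivity
  | succ σ =>
    rw [hstage] at hσ
    have hexp : P.L - (σ + 1) + 3 = P.L - σ + 2 := by omega
    rw [hexp]
    exact law_real_two_pow_lt_card_after_stage_le hS (Nat.le_of_succ_le hσ)

lemma law_real_maxSample_lt_of_card_start_le {τ S : ℕ} (hS : S ∈ I.sets) (hτ : τ < P.numRounds) :
    (law P I).real {x | #(I.elts S ∩ alive x (P.start τ)) ≤ 2 ^ (P.level τ + 3) ∧
      P.maxSample < #(preSample x τ S)} ≤ (1 / 2) ^ 2 ^ P.ℓ := by
  have hquot : (4 ^ (8 * 2 ^ P.ℓ) / 2 ^ P.maxSample : ℝ) = (1 / 2) ^ 2 ^ P.ℓ := by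
    rw [Schedule.maxSample, show 17 * 2 ^ P.ℓ = 2 * (8 * 2 ^ P.ℓ) + 2 ^ P.ℓ by ring, pow_add,
      pow_mul 2 2, show (2 : ℝ) ^ 2 = 4 by norm_num, ← div_div, div_self (by positivity),
      one_div_pow]
  rw [← hquot]
  refine measureReal_setOf_le_div (f := fun x =>
      (if #(I.elts S ∩ alive x (P.start τ)) ≤ 2 ^ (P.level τ + 3) then 1 else 0) *
        (1 + 1) ^ #(preSample x τ S))
    (by positivity) (fun x => by positivity) (fun x hx => ?_) ?_
  · rw [if_pos hx.1, one_mul, one_add_one_eq_two]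
    exact pow_le_pow_right₀ one_le_two hx.2.le
  · unfold preSample
    rw [integral_mul_pow_card_sample hS hτ (P.start_le τ)
      (fun n => if n ≤ 2 ^ (P.level τ + 3) then 1 else 0)]
    refine integral_le_of_forall_le fun x => ?_
    split_ifs with h
    · have hcard : (#(I.elts S ∩ alive x (P.start τ)) : ℝ) ≤ 2 ^ (P.level τ + 3) := mod_cast h
      have hthr : (P.thr τ : ℝ) ≤ 2 ^ P.ℓ :=
        mod_cast Nat.pow_le_pow_right two_pos (min_le_right _ _)
      have hmean : #(I.elts S ∩ alive x (P.start τ)) * P.sampleProb τ ≤ (8 * 2 ^ P.ℓ : ℕ) := by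
        push_cast
        rw [pow_add] at hcard
        linarith [P.sampleProb_mul_two_pow τ,
          mul_le_mul_of_nonneg_right hcard (P.prob_pos false τ).le]
      rw [one_mul, mul_one]
      exact one_add_pow_le_four_pow (P.prob_pos false τ).le hmean
    · rw [zero_mul]
      positivity

/-- A bound for the probability of each of the elementary reasons to give up. -/
noncomputable def Schedule.slack (P : Schedule) : ℝ := (P.T + 2) * (1 / 2) ^ 2 ^ P.ℓ

lemma law_real_maxSample_lt_le {τ S : ℕ} (hS : S ∈ I.sets) (hτ : τ < P.numRounds)
    (hcard : #(I.elts S) ≤ 2 ^ P.L) :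
    (law P I).real {x | P.maxSample < #(preSample x τ S)} ≤ P.slack := by
  calc (law P I).real {x | P.maxSample < #(preSample x τ S)}
      ≤ (law P I).real {x | 2 ^ (P.level τ + 3) < #(I.elts S ∩ alive x (P.start τ)) ∨
          #(I.elts S ∩ alive x (P.start τ)) ≤ 2 ^ (P.level τ + 3) ∧
            P.maxSample < #(preSample x τ S)} :=
        measureReal_setOf_mono fun x hx => (lt_or_ge _ _).imp_right fun h => ⟨h, hx⟩
    _ ≤ (P.T + 1) * (1 / 2) ^ 2 ^ P.ℓ + (1 / 2) ^ 2 ^ P.ℓ :=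
        (measureReal_setOf_or_le _ _).trans <|
          add_le_add (law_real_two_pow_lt_card_start_le hS hτ hcard)
            (law_real_maxSample_lt_of_card_start_le hS hτ)
    _ = P.slack := by rw [Schedule.slack]; ring

-- If many sets were about to join, the element would hardly have survived the round before.
lemma integral_ite_mul_pow_card_le {τ k e : ℕ} (hτ : P.start τ + k < P.numRounds) (hk : k ≤ P.T)
    (he : #(I.setsOf e) ≤ 2 ^ P.T) :
    ∫ x, (if e ∈ alive x (P.start τ + k) then 1 else 0) *
      (1 + (1 / 2 : ℝ) ^ (P.T + 1 - k)) ^ #(I.setsOf e ∩ cand x (P.start τ + k)) ∂law P I ≤ 2 := by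
  cases k with
  | zero =>
    refine integral_le_of_forall_le fun x => ?_
    refine (mul_le_of_le_one_left (by positivity) (by split_ifs <;> norm_num)).trans ?_
    exact one_add_half_pow_succ_pow_le ((card_le_card inter_subset_left).trans he)
  | succ k =>
    have hq : P.joinProb (P.start τ + k) = (1 / 2) ^ (P.T + 1 - (k + 1)) := by
      simp [Schedule.joinProb, Schedule.prob, Schedule.expo,
        Schedule.round_start_add (τ := τ) (Nat.le_of_succ_le hk)]
    have hdep : DependsOn (fun x : Outcome P I => (1 + P.joinProb (P.start τ + k)) ^
        #(I.setsOf e ∩ active x (P.start τ + k))) (coinsAt P I true (P.start τ + k))ᶜ :=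
      fun x y h => by simp only [active_congr h]
    simp_rw [cand_start_succ _ hk, ← hq, mul_comm (ite _ _ _), ← add_assoc]
    rw [integral_mul_ite_mem_alive_succ (by omega) hdep]
    refine integral_le_of_forall_le fun x => ?_
    have hpos := (P.prob_pos true (P.start τ + k)).le
    have hle := P.prob_le_one true (P.start τ + k)
    rw [mul_right_comm, ← mul_pow]
    refine (mul_le_one₀ (pow_le_one₀ ?_ ?_) (by positivity) (by split_ifs <;> norm_num)).trans
      one_le_two <;> nlinarith

lemma law_real_cap_lt_le {τ e k : ℕ} (hτ : τ < P.numRounds) (hk : k ≤ P.round τ)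
    (he : #(I.setsOf e) ≤ 2 ^ P.T) :
    (law P I).real {x | e ∈ alive x τ ∧ P.cap (P.round τ - k) < #(hitList x τ e k)} ≤
      P.slack := by
  have hkτ : P.start τ + k ≤ τ := by have := P.start_add_round τ; omega
  have hround := P.round_le τ
  set c : ℝ := (1 / 2) ^ (P.round τ - k + 1) with hc
  have hslack : (2 / 2 ^ 2 ^ P.ℓ : ℝ) ≤ P.slack := by
    rw [Schedule.slack, one_div_pow, div_eq_mul_one_div]
    gcongr
    linarith [(Nat.cast_nonneg P.T : (0 : ℝ) ≤ P.T)]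
  refine (measureReal_setOf_le_div (f := fun x => (if e ∈ alive x (P.start τ + k) then 1 else 0) *
    (1 + c) ^ #(hitList x τ e k)) (by positivity) (fun x => by positivity)
    (fun x hx => ?_) ?_).trans hslack
  · rw [if_pos (alive_antitone x hkτ hx.1), one_mul]
    calc (2 : ℝ) ^ 2 ^ P.ℓ ≤ ((1 + c) ^ 2 ^ (P.round τ - k + 1)) ^ 2 ^ P.ℓ :=
          pow_le_pow_left₀ (by norm_num) (two_le_one_add_half_pow_pow _) _
      _ = (1 + c) ^ P.cap (P.round τ - k) := by
          rw [← pow_mul, ← pow_add, Schedule.cap]; congr 2; ring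
      _ ≤ _ := pow_le_pow_right₀ (le_add_of_nonneg_right (by positivity)) hx.2.le
  · have hprob : P.joinProb τ * c = (1 / 2) ^ (P.T + 1 - k) := by
      rw [Schedule.joinProb, Schedule.prob, hc, ← pow_add]
      congr 1
      simp only [Schedule.expo, if_true]
      omega
    have hbefore := coinsBefore_subset_compl_coinsAt (P := P) (I := I) hkτ true
    have hf : DependsOn (fun x : Outcome P I =>
        if e ∈ alive x (P.start τ + k) then (1 : ℝ) else 0) (coinsAt P I true τ)ᶜ :=
      fun x y h => by simp only [alive_congr fun k hk => h k (hbefore hk)]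
    have hA : DependsOn (fun x : Outcome P I => I.setsOf e ∩ cand x (P.start τ + k))
        (coinsAt P I true τ)ᶜ :=
      fun x y h => by simp only [cand_congr fun k hk => h k (hbefore hk)]
    have hsets : ∀ x : Outcome P I, I.setsOf e ∩ cand x (P.start τ + k) ⊆ I.sets ∪ I.univ :=
      fun _ => inter_subset_left.trans ((filter_subset _ _).trans subset_union_left)
    refine (integral_mul_pow_card_coin hτ hf hA hsets c).trans_le ?_
    rw [hprob]
    exact integral_ite_mul_pow_card_le (hkτ.trans_lt hτ) (hk.trans hround) he

end Concentration

section FailureProbability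

open MeasureTheory

variable {P : Schedule} {I : SetSystem}

/-- The factor by which the failure probability grows from one round to the next. -/
noncomputable def Schedule.growth (P : Schedule) (s t : ℕ) : ℝ := 8 * s * t * (P.T + 1)

lemma Schedule.slack_nonneg : 0 ≤ P.slack := by unfold slack; positivity

lemma Schedule.one_le_growth {s t : ℕ} (hs : 1 ≤ s) (ht : 1 ≤ t) : 1 ≤ P.growth s t := by
  have hnat : 1 ≤ 8 * s * t * (P.T + 1) := Nat.succ_le_of_lt (by positivity)
  rw [growth]
  exact_mod_cast hnat

lemma Fail.of_succ {x : Outcome P I} {τ e : ℕ} (h : Fail x false (τ + 1) e) :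
    Fail x false τ e ∨
      (∃ k ∈ range (P.round τ + 1),
        e ∈ alive x τ ∧ P.cap (P.round τ - k) < #(hitList x τ e k)) ∨
      ∃ S ∈ I.setsOf e, ∃ k ∈ range (P.round τ + 1), Fail x true (P.start τ + k) S := by
  cases h with
  | prev h => exact .inl h
  | cap he hk h => exact .inr (.inl ⟨_, mem_range_succ_iff.2 hk, he, h⟩)
  | hit he hk hS h =>
    exact .inr (.inr ⟨_, (mem_inter.1 (mem_filter.1 hS).1).1, _, mem_range_succ_iff.2 hk, h⟩)

lemma Fail.of_true {x : Outcome P I} {τ S : ℕ} (h : Fail x true τ S) :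
    P.maxSample < #(preSample x τ S) ∨
      (∃ e ∈ I.elts S, Fail x false (P.start τ) e) ∨ ∃ e ∈ I.elts S, Fail x false τ e := by
  cases h with
  | start he _ h => exact .inr (.inl ⟨_, he, h⟩)
  | sample h => exact .inl h
  | elem he h => exact .inr (.inr ⟨_, (mem_inter.1 (mem_filter.1 he).1).1, h⟩)

lemma FailSet.nonempty {x : Outcome P I} {S : ℕ} (h : FailSet x S) : (I.elts S).Nonempty := by
  obtain ⟨τ, _, _, k, _, _, h⟩ := h
  rcases h.of_true with h | ⟨e, he, _⟩ | ⟨e, he, _⟩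
  · obtain ⟨e, he⟩ := card_pos.1 ((Nat.zero_le _).trans_lt h)
    exact ⟨e, (mem_inter.1 (mem_filter.1 he).1).1⟩
  · exact ⟨e, he⟩
  · exact ⟨e, he⟩

variable {s t τ : ℕ} {a : ℝ}

lemma law_real_fail_true_le (hI : I.Bounded s t) (hsL : s ≤ 2 ^ P.L) (hs : 1 ≤ s)
    (hτ : τ < P.numRounds) {S : ℕ} (hS : S ∈ I.sets) (ha : P.slack ≤ a)
    (h : ∀ τ' ≤ τ, ∀ e ∈ I.univ, (law P I).real {x | Fail x false τ' e} ≤ a) :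
    (law P I).real {x | Fail x true τ S} ≤ 3 * s * a := by
  have ha0 : 0 ≤ a := P.slack_nonneg.trans ha
  have hs' : (1 : ℝ) ≤ s := mod_cast hs
  have hsample : (law P I).real {x | P.maxSample < #(preSample x τ S)} ≤ s * a :=
    (law_real_maxSample_lt_le hS hτ ((hI.1 S hS).trans hsL)).trans
      (ha.trans (le_mul_of_one_le_left ha0 hs'))
  have helem : ∀ τ' ≤ τ, (law P I).real {x | ∃ e ∈ I.elts S, Fail x false τ' e} ≤ s * a := by
    intro τ' hτ'
    refine (measureReal_setOf_exists_mem_le fun e he => h τ' hτ' e (I.elts_subset S hS he)).trans ?_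
    exact mul_le_mul_of_nonneg_right (mod_cast hI.1 S hS) ha0
  calc (law P I).real {x | Fail x true τ S}
      ≤ (law P I).real {x | P.maxSample < #(preSample x τ S) ∨
          (∃ e ∈ I.elts S, Fail x false (P.start τ) e) ∨ ∃ e ∈ I.elts S, Fail x false τ e} :=
        measureReal_setOf_mono fun x => Fail.of_true
    _ ≤ s * a + (s * a + s * a) :=
        (measureReal_setOf_or_le _ _).trans (add_le_add hsample ((measureReal_setOf_or_le _ _).trans
          (add_le_add (helem _ (P.start_le τ)) (helem τ le_rfl))))
    _ = 3 * s * a := by ring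

lemma law_real_exists_fail_true_le (hI : I.Bounded s t) (hsL : s ≤ 2 ^ P.L) (hs : 1 ≤ s)
    (hτ : τ < P.numRounds) {S : ℕ} (hS : S ∈ I.sets) (ha : P.slack ≤ a)
    (h : ∀ τ' ≤ τ, ∀ e ∈ I.univ, (law P I).real {x | Fail x false τ' e} ≤ a) :
    (law P I).real {x | ∃ k ∈ range (P.round τ + 1), Fail x true (P.start τ + k) S} ≤
      (P.T + 1) * (3 * s * a) := by
  have ha0 : 0 ≤ a := P.slack_nonneg.trans ha
  have hround : ((P.round τ + 1 : ℕ) : ℝ) ≤ P.T + 1 := mod_cast Nat.succ_le_succ (P.round_le τ)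
  calc (law P I).real {x | ∃ k ∈ range (P.round τ + 1), Fail x true (P.start τ + k) S}
      ≤ #(range (P.round τ + 1)) * (3 * s * a) := by
        refine measureReal_setOf_exists_mem_le fun k hk => ?_
        have hkτ : P.start τ + k ≤ τ := by
          have := P.start_add_round τ
          have := mem_range_succ_iff.1 hk
          omega
        exact law_real_fail_true_le hI hsL hs (hkτ.trans_lt hτ) hS ha
          fun τ' hτ' => h τ' (hτ'.trans hkτ)
    _ ≤ (P.T + 1) * (3 * s * a) := by rw [card_range]; gcongr

lemma law_real_fail_false_succ_le (hI : I.Bounded s t) (hsL : s ≤ 2 ^ P.L) (htT : t ≤ 2 ^ P.T)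
    (hs : 1 ≤ s) (ht : 1 ≤ t) (hτ : τ < P.numRounds) (ha : P.slack ≤ a)
    (h : ∀ τ' ≤ τ, ∀ e ∈ I.univ, (law P I).real {x | Fail x false τ' e} ≤ a)
    {e : ℕ} (he : e ∈ I.univ) :
    (law P I).real {x | Fail x false (τ + 1) e} ≤ P.growth s t * a := by
  have ha0 : 0 ≤ a := P.slack_nonneg.trans ha
  have hround : ((P.round τ + 1 : ℕ) : ℝ) ≤ P.T + 1 := mod_cast Nat.succ_le_succ (P.round_le τ)
  have hcap : (law P I).real {x | ∃ k ∈ range (P.round τ + 1),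
      e ∈ alive x τ ∧ P.cap (P.round τ - k) < #(hitList x τ e k)} ≤ (P.T + 1) * a := by
    refine (measureReal_setOf_exists_mem_le fun k hk =>
      (law_real_cap_lt_le hτ (mem_range_succ_iff.1 hk) ((hI.2 e he).trans htT)).trans ha).trans ?_
    rw [card_range]
    gcongr
  have hhit : (law P I).real {x | ∃ S ∈ I.setsOf e, ∃ k ∈ range (P.round τ + 1),
      Fail x true (P.start τ + k) S} ≤ t * ((P.T + 1) * (3 * s * a)) := by
    refine (measureReal_setOf_exists_mem_le fun S hS =>
      law_real_exists_fail_true_le hI hsL hs hτ (mem_filter.1 hS).1 ha h).trans ?_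
    gcongr
    exact hI.2 e he
  have hst : (1 : ℝ) ≤ s * t := mod_cast Nat.mul_pos hs ht
  have hT : (P.T + 1 : ℝ) ≤ s * t * (P.T + 1) := le_mul_of_one_le_left (by positivity) hst
  calc (law P I).real {x | Fail x false (τ + 1) e}
      ≤ a + ((P.T + 1) * a + t * ((P.T + 1) * (3 * s * a))) :=
        (measureReal_setOf_mono fun x => Fail.of_succ).trans <|
          (measureReal_setOf_or_le _ _).trans <| add_le_add (h τ le_rfl e he) <|
            (measureReal_setOf_or_le _ _).trans (add_le_add hcap hhit)
    _ = (1 + (P.T + 1) + 3 * (s * t * (P.T + 1))) * a := by ring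
    _ ≤ P.growth s t * a := by
        rw [Schedule.growth]
        gcongr
        linarith

lemma law_real_fail_false_le (hI : I.Bounded s t) (hsL : s ≤ 2 ^ P.L) (htT : t ≤ 2 ^ P.T)
    (hs : 1 ≤ s) (ht : 1 ≤ t) {n : ℕ} (hn : n ≤ P.numRounds) :
    ∀ τ ≤ n, ∀ e ∈ I.univ, (law P I).real {x | Fail x false τ e} ≤ P.growth s t ^ n * P.slack := by
  have hgrowth : 1 ≤ P.growth s t := P.one_le_growth hs ht
  have hslack : 0 ≤ P.slack := P.slack_nonneg
  induction n with
  | zero =>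
    intro τ hτ e _
    have hempty : {x : Outcome P I | Fail x false τ e} = ∅ :=
      Set.eq_empty_of_forall_notMem fun x hx => by
        obtain rfl := Nat.le_zero.1 hτ
        nomatch hx
    rw [hempty, measureReal_empty]
    positivity
  | succ n ih =>
    intro τ hτ e he
    rw [pow_succ', mul_assoc]
    rcases hτ.lt_or_eq with hlt | rfl
    · exact (ih (by omega) τ (Nat.lt_succ_iff.1 hlt) e he).trans
        (le_mul_of_one_le_left (by positivity) hgrowth)
    · exact law_real_fail_false_succ_le hI hsL htT hs ht hn
        (le_mul_of_one_le_left hslack (one_le_pow₀ hgrowth)) (ih (by omega)) he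

/-- A bound for the probability that the simulation gives up on a given set. -/
noncomputable def Schedule.failBound (P : Schedule) (s t : ℕ) : ℝ :=
  P.numRounds * ((P.T + 1) * (3 * s * (P.growth s t ^ P.numRounds * P.slack)))

lemma law_real_failSet_le (hI : I.Bounded s t) (hsL : s ≤ 2 ^ P.L) (htT : t ≤ 2 ^ P.T)
    (hs : 1 ≤ s) (ht : 1 ≤ t) {S : ℕ} (hS : S ∈ I.sets) :
    (law P I).real {x | FailSet x S} ≤ P.failBound s t := by
  have hfail := law_real_fail_false_le hI hsL htT hs ht le_rfl
  have hslack : P.slack ≤ P.growth s t ^ P.numRounds * P.slack :=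
    le_mul_of_one_le_left P.slack_nonneg (one_le_pow₀ (P.one_le_growth hs ht))
  have hexists : ∀ x : Outcome P I, FailSet x S → ∃ τ ∈ range P.numRounds,
      ∃ k ∈ range (P.round τ + 1), Fail x true (P.start τ + k) S :=
    fun x ⟨τ, hτ, _, k, hk, _, h⟩ => ⟨τ, mem_range.2 hτ, k, mem_range_succ_iff.2 hk, h⟩
  refine ((measureReal_setOf_mono hexists).trans
    (measureReal_setOf_exists_mem_le fun τ hτ => ?_)).trans_eq (by rw [card_range]; rfl)
  exact law_real_exists_fail_true_le hI hsL hs (mem_range.1 hτ) hS hslack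
    fun τ' hτ' => hfail τ' (hτ'.trans (mem_range.1 hτ).le)

end FailureProbability

/-! ### The size of the cover -/

section Size

open MeasureTheory

variable {P : Schedule} {I : SetSystem}

-- Weak linear programming duality: `y / M` is a fractional packing.
lemma sum_le_mul_opt {y : ℕ → ℝ} {M : ℝ} (hy : ∀ e ∈ I.univ, 0 ≤ y e) (hM : 0 < M)
    (h : ∀ S ∈ I.sets, ∑ e ∈ I.elts S, y e ≤ M) : ∑ e ∈ I.univ, y e ≤ M * I.opt := by
  rw [← div_le_iff₀' hM]
  refine le_csInf ⟨_, fun _ => 1, ⟨fun _ _ => zero_le_one, fun e he => ?_⟩, rfl⟩ ?_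
  · obtain ⟨S, hS, he⟩ := I.exists_mem e he
    rw [sum_const, nsmul_eq_mul, mul_one]
    exact_mod_cast card_pos.2 ⟨S, mem_setsOf.2 ⟨hS, he⟩⟩
  · rintro v ⟨x, ⟨hx0, hx1⟩, rfl⟩
    rw [div_le_iff₀' hM]
    calc ∑ e ∈ I.univ, y e ≤ ∑ e ∈ I.univ, ∑ S ∈ I.setsOf e, x S * y e := by
          refine sum_le_sum fun e he => ?_
          rw [← sum_mul]
          exact le_mul_of_one_le_left (hy e he) (hx1 e he)
      _ = ∑ S ∈ I.sets, ∑ e ∈ I.elts S, x S * y e := (sum_sets_elts fun S e => x S * y e).symm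
      _ ≤ ∑ S ∈ I.sets, x S * M := by
          refine sum_le_sum fun S hS => ?_
          rw [← mul_sum]
          exact mul_le_mul_of_nonneg_left (h S hS) (hx0 S hS)
      _ = M * ∑ S ∈ I.sets, x S := by rw [← sum_mul, mul_comm]

lemma sum_range_numRounds (f : ℕ → ℝ) :
    ∑ τ ∈ range P.numRounds, f τ =
      ∑ σ ∈ range (P.L + 1), ∑ j ∈ range (P.T + 1), f (σ * (P.T + 1) + j) := by
  rw [Schedule.numRounds]
  induction P.L + 1 with
  | zero => simp
  | succ n ih => rw [Nat.succ_mul, sum_range_add, ih, sum_range_succ _ n]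

open Classical in
lemma card_cover_le (x : Outcome P I) :
    #(cover x) ≤ ∑ τ ∈ range P.numRounds, #(joined x τ) + #{S ∈ I.sets | FailSet x S} := by
  have hsub : cover x ⊆ (range P.numRounds).biUnion (joined x) ∪ {S ∈ I.sets | FailSet x S} := by
    intro S hS
    obtain ⟨hS, ⟨τ, hτ, h⟩ | h⟩ := mem_filter.1 hS
    · exact mem_union_left _ (mem_biUnion.2 ⟨τ, mem_range.2 hτ, h⟩)
    · exact mem_union_right _ (mem_filter.2 ⟨hS, h⟩)
  exact (card_le_card hsub).trans
    ((card_union_le _ _).trans (Nat.add_le_add_right card_biUnion_le _))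

variable {s t : ℕ}

lemma Schedule.failBound_nonneg (hs : 1 ≤ s) (ht : 1 ≤ t) : 0 ≤ P.failBound s t := by
  have hgrowth := zero_le_one.trans (P.one_le_growth hs ht)
  have hslack := P.slack_nonneg
  unfold Schedule.failBound
  positivity

/-- The charge of the element `e` for the sets in the cover, in expectation. -/
noncomputable def charge (P : Schedule) (I : SetSystem) (s t e : ℕ) : ℝ :=
  ∑ σ ∈ range (P.L + 1), 3 * (1 / 2) ^ (P.L - σ) *
    (law P I).real {x | e ∈ alive x (σ * (P.T + 1))} + t * P.failBound s t

lemma charge_nonneg (hs : 1 ≤ s) (ht : 1 ≤ t) (e : ℕ) : 0 ≤ charge P I s t e :=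
  add_nonneg (sum_nonneg fun _ _ => by positivity)
    (mul_nonneg t.cast_nonneg (Schedule.failBound_nonneg hs ht))

lemma sum_law_real_failSet_le (hI : I.Bounded s t) (hsL : s ≤ 2 ^ P.L) (htT : t ≤ 2 ^ P.T)
    (hs : 1 ≤ s) (ht : 1 ≤ t) :
    ∑ S ∈ I.sets, (law P I).real {x | FailSet x S} ≤ ∑ _e ∈ I.univ, t * P.failBound s t := by
  have hnonneg := P.failBound_nonneg hs ht
  calc ∑ S ∈ I.sets, (law P I).real {x | FailSet x S}
      ≤ ∑ S ∈ I.sets, ∑ _e ∈ I.elts S, P.failBound s t := by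
        refine sum_le_sum fun S hS => ?_
        rcases (I.elts S).eq_empty_or_nonempty with hempty | hnonempty
        · have hfail : {x : Outcome P I | FailSet x S} = ∅ :=
            Set.eq_empty_of_forall_notMem fun x hx => hx.nonempty.ne_empty hempty
          rw [hfail, measureReal_empty, hempty, sum_empty]
        · rw [sum_const, nsmul_eq_mul]
          exact (law_real_failSet_le hI hsL htT hs ht hS).trans
            (le_mul_of_one_le_left hnonneg (mod_cast card_pos.2 hnonempty))
    _ = ∑ e ∈ I.univ, ∑ _S ∈ I.setsOf e, P.failBound s t :=
        sum_sets_elts fun _ _ => P.failBound s t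
    _ ≤ ∑ _e ∈ I.univ, t * P.failBound s t := by
        refine sum_le_sum fun e he => ?_
        rw [sum_const, nsmul_eq_mul]
        exact mul_le_mul_of_nonneg_right (mod_cast hI.2 e he) hnonneg

lemma integral_card_cover_le_sum_charge (hI : I.Bounded s t) (hsL : s ≤ 2 ^ P.L)
    (htT : t ≤ 2 ^ P.T) (hs : 1 ≤ s) (ht : 1 ≤ t) :
    ∫ x, (#(cover x) : ℝ) ∂law P I ≤ ∑ e ∈ I.univ, charge P I s t e := by
  classical
  calc ∫ x, (#(cover x) : ℝ) ∂law P I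
      ≤ ∫ x, (∑ τ ∈ range P.numRounds, (#(joined x τ) : ℝ)) + #{S ∈ I.sets | FailSet x S}
          ∂law P I := integral_mono .of_finite .of_finite fun x => by
            dsimp only
            exact_mod_cast card_cover_le x
    _ = ∑ σ ∈ range (P.L + 1), ∑ j ∈ range (P.T + 1),
          ∫ x, (#(joined x (σ * (P.T + 1) + j)) : ℝ) ∂law P I +
            ∑ S ∈ I.sets, (law P I).real {x | FailSet x S} := by
        rw [integral_add .of_finite .of_finite, integral_finsetSum _ fun _ _ => .of_finite,
          integral_card_filter I.sets fun S x => FailSet x S, sum_range_numRounds]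
    _ ≤ ∑ σ ∈ range (P.L + 1), 3 * (1 / 2) ^ (P.L - σ) *
            ∑ e ∈ I.univ, (law P I).real {x | e ∈ alive x (σ * (P.T + 1))} +
          ∑ _e ∈ I.univ, t * P.failBound s t :=
        add_le_add (sum_le_sum fun σ hσ => sum_integral_card_joined_le (mem_range_succ_iff.1 hσ)
          fun e he => (hI.2 e he).trans htT) (sum_law_real_failSet_le hI hsL htT hs ht)
    _ = ∑ e ∈ I.univ, charge P I s t e := by
        simp_rw [charge, mul_sum]
        rw [sum_comm, sum_add_distrib]

lemma sum_law_real_mem_alive_le (hI : I.Bounded s t) (hsL : s ≤ 2 ^ P.L) {S σ : ℕ}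
    (hS : S ∈ I.sets) (hσ : σ ≤ P.L) (hslack : s * P.slack ≤ 1) :
    ∑ e ∈ I.elts S, (law P I).real {x | e ∈ alive x (σ * (P.T + 1))} ≤
      2 ^ (P.L - σ + 3) + 1 := by
  have hlevel := Schedule.level_stage_add (P := P) (σ := σ) P.T.zero_le
  have hstart := Schedule.start_stage_add (P := P) (σ := σ) P.T.zero_le
  have hprob : (law P I).real
      {x | 2 ^ (P.L - σ + 3) < #(I.elts S ∩ alive x (σ * (P.T + 1)))} ≤ P.slack := by
    have := law_real_two_pow_lt_card_start_le hS (Schedule.stage_add_lt_numRounds hσ P.T.zero_le)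
      ((hI.1 S hS).trans hsL)
    rw [hlevel, hstart] at this
    refine this.trans ?_
    unfold Schedule.slack
    gcongr
    norm_num
  calc ∑ e ∈ I.elts S, (law P I).real {x | e ∈ alive x (σ * (P.T + 1))}
      = ∫ x, (#(I.elts S ∩ alive x (σ * (P.T + 1))) : ℝ) ∂law P I := by
        simp_rw [← filter_mem_eq_inter]
        rw [integral_card_filter (I.elts S) fun e x => e ∈ alive x (σ * (P.T + 1))]
    _ ≤ ∫ x, (2 : ℝ) ^ (P.L - σ + 3) + s * (if 2 ^ (P.L - σ + 3) <
          #(I.elts S ∩ alive x (σ * (P.T + 1))) then 1 else 0) ∂law P I := by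
        refine integral_mono .of_finite .of_finite fun x => ?_
        have hcard : (#(I.elts S ∩ alive x (σ * (P.T + 1))) : ℝ) ≤ s :=
          mod_cast (card_le_card inter_subset_left).trans (hI.1 S hS)
        dsimp only
        split_ifs with h
        · linarith [show (0 : ℝ) ≤ 2 ^ (P.L - σ + 3) by positivity]
        · rw [mul_zero, add_zero]
          exact_mod_cast not_lt.1 h
    _ = 2 ^ (P.L - σ + 3) + s * (law P I).real
          {x | 2 ^ (P.L - σ + 3) < #(I.elts S ∩ alive x (σ * (P.T + 1)))} := by
        rw [integral_add .of_finite .of_finite, integral_const_mul, ← integral_ite_eq_measureReal]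
        simp
    _ ≤ 2 ^ (P.L - σ + 3) + 1 := by
        gcongr
        exact (mul_le_mul_of_nonneg_left hprob s.cast_nonneg).trans hslack

lemma sum_charge_le (hI : I.Bounded s t) (hsL : s ≤ 2 ^ P.L) (hs : 1 ≤ s) (ht : 1 ≤ t)
    (hslack : s * P.slack ≤ 1) (hfail : s * (t * P.failBound s t) ≤ 1) {S : ℕ} (hS : S ∈ I.sets) :
    ∑ e ∈ I.elts S, charge P I s t e ≤ 28 * (P.L + 1) := by
  have hstage : ∀ σ ∈ range (P.L + 1), ∑ e ∈ I.elts S, 3 * (1 / 2 : ℝ) ^ (P.L - σ) *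
      (law P I).real {x | e ∈ alive x (σ * (P.T + 1))} ≤ 27 := by
    intro σ hσ
    have halive := sum_law_real_mem_alive_le hI hsL hS (mem_range_succ_iff.1 hσ) hslack
    have hcancel : (1 / 2 : ℝ) ^ (P.L - σ) * 2 ^ (P.L - σ) = 1 := by rw [← mul_pow]; norm_num
    calc ∑ e ∈ I.elts S, 3 * (1 / 2 : ℝ) ^ (P.L - σ) *
          (law P I).real {x | e ∈ alive x (σ * (P.T + 1))}
        ≤ 3 * (1 / 2 : ℝ) ^ (P.L - σ) * (2 ^ (P.L - σ + 3) + 1) := by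
          rw [← mul_sum]
          gcongr
      _ = 24 * ((1 / 2 : ℝ) ^ (P.L - σ) * 2 ^ (P.L - σ)) + 3 * (1 / 2 : ℝ) ^ (P.L - σ) := by ring
      _ ≤ 24 * 1 + 3 * 1 := by
          rw [hcancel]
          gcongr
          exact pow_le_one₀ (by norm_num) (by norm_num)
      _ = 27 := by norm_num
  have hgiveUp : ∑ _e ∈ I.elts S, (t : ℝ) * P.failBound s t ≤ 1 := by
    rw [sum_const, nsmul_eq_mul]
    refine (mul_le_mul_of_nonneg_right (mod_cast hI.1 S hS) ?_).trans hfail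
    exact mul_nonneg t.cast_nonneg (Schedule.failBound_nonneg hs ht)
  have hstages := sum_le_sum hstage
  simp only [sum_const, card_range, nsmul_eq_mul, Nat.cast_add, Nat.cast_one] at hstages
  simp_rw [charge, sum_add_distrib]
  rw [sum_comm]
  linarith [P.L.cast_nonneg (α := ℝ)]

lemma integral_card_cover_le (hI : I.Bounded s t) (hsL : s ≤ 2 ^ P.L) (htT : t ≤ 2 ^ P.T)
    (hs : 1 ≤ s) (ht : 1 ≤ t) (hslack : s * P.slack ≤ 1)
    (hfail : s * (t * P.failBound s t) ≤ 1) :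
    ∫ x, (#(cover x) : ℝ) ∂law P I ≤ 28 * (P.L + 1) * I.opt :=
  (integral_card_cover_le_sum_charge hI hsL htT hs ht).trans
    (sum_le_mul_opt (fun e _ => charge_nonneg hs ht e) (by positivity)
      fun _ hS => sum_charge_le hI hsL hs ht hslack hfail hS)

end Size

/-! ### Subroutines as local computation -/

/-- The results of subroutines; `none` means that the simulation gives up. -/
abbrev Val := Option (List ℕ)

/-- A subroutine call: the name of the subroutine, a round, an auxiliary number and a list. -/
abbrev Task := ℕ × ℕ × ℕ × List ℕ

/-- A running subroutine, with the list of results that it has obtained so far. -/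
abbrev Frame := Task × List Val

/-- What a running subroutine does next: call a subroutine, query the input or the tape, or
return. -/
abbrev Instr := Task ⊕ LCAAction ⊕ Val

namespace Machine

/-- Hand a result to the topmost subroutine. -/
def push (st : List Frame) (v : Val) : List Frame :=
  st.modifyHead fun f => (f.1, f.2 ++ [v])

/-- One step of the machine, on receiving a response. -/
def step (body : Frame → Instr) (st : List Frame) (o : Option ℕ) : List Frame :=
  match st.head?.map body with
  | none => []
  | some (.inl b) => (b, []) :: st
  | some (.inr (.inl _)) => push st (o.map fun n => [n])
  | some (.inr (.inr v)) => push st.tail v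

/-- The next action of the machine. Calls and returns read an irrelevant tape bit, and the value
`some []` returned by the outermost subroutine is the answer `false`. -/
def action (body : Frame → Instr) (st : List Frame) : LCAAction :=
  match st.head?.map body with
  | none => .answer false
  | some (.inl _) => .readBit 0
  | some (.inr (.inl a)) => a
  | some (.inr (.inr v)) =>
    if st.tail = [] then .answer (decide (v ≠ some [])) else .readBit 0

/-- The state of the machine after the responses `h`. -/
def state (body : Frame → Instr) (root : Task) (h : List (Option ℕ)) : List Frame :=
  h.foldl (step body) [(root, [])]

section Semantics

variable (body : Frame → Instr) {I : SetSystem} (R : I.Representation) (ω : ℕ → Bool)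

/-- `Ev body R ω b acc v q`: the subroutine call `b`, having obtained the results `acc`, returns
`v` after `q` further neighbor queries. -/
inductive Ev : Task → List Val → Val → ℕ → Prop
  | ret {b : Task} {acc : List Val} {v : Val} (h : body (b, acc) = .inr (.inr v)) : Ev b acc v 0
  | call {b b' : Task} {acc : List Val} {v w : Val} {q q' : ℕ} (h : body (b, acc) = .inl b')
      (h₁ : Ev b' [] v q) (h₂ : Ev b (acc ++ [v]) w q') : Ev b acc w (q + q')
  | querySet {b : Task} {acc : List Val} {v : Val} {S i q : ℕ}
      (h : body (b, acc) = .inr (.inl (.querySet S i)))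
      (h₁ : Ev b (acc ++ [(R.setList S)[i]?.map fun n => [n]]) v q) : Ev b acc v (q + 1)
  | queryElem {b : Task} {acc : List Val} {v : Val} {e i q : ℕ}
      (h : body (b, acc) = .inr (.inl (.queryElem e i)))
      (h₁ : Ev b (acc ++ [(R.elemList e)[i]?.map fun n => [n]]) v q) : Ev b acc v (q + 1)
  | readBit {b : Task} {acc : List Val} {v : Val} {j q : ℕ}
      (h : body (b, acc) = .inr (.inl (.readBit j)))
      (h₁ : Ev b (acc ++ [some [(ω j).toNat]]) v q) : Ev b acc v q

variable {body R ω}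

lemma state_append_singleton (root : Task) (h : List (Option ℕ)) (o : Option ℕ) :
    state body root (h ++ [o]) = step body (state body root h) o :=
  List.foldl_concat ..

-- Induction on the evaluation, in continuation-passing style: `hret` is the run after the return.
lemma Ev.run {A : LocalAlgorithm} {s t S : ℕ} {root : Task}
    (hA : ∀ h, A.next s t S h = action body (state body root h))
    {b : Task} {acc : List Val} {v : Val} {q : ℕ} (hev : Ev body R ω b acc v q)
    {st : List Frame} {h : List (Option ℕ)} {q' : ℕ} {res : Bool}
    (hst : state body root h = (b, acc) :: st)
    (hret : ∀ h' acc', state body root h' = (b, acc') :: st → body (b, acc') = .inr (.inr v) →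
      A.Run s t S R ω h' q' res) : A.Run s t S R ω h (q + q') res := by
  induction hev generalizing st h q' with
  | ret hbody => exact (zero_add q').symm ▸ hret h _ hst hbody
  | @call b _ acc _ _ _ _ hbody _ _ ih₁ ih₂ =>
    refine .readBit (j := 0) (by simp [hA, hst, action, hbody]) ?_
    rw [add_assoc]
    refine ih₁ (st := (b, acc) :: st) (by simp [state_append_singleton, hst, step, hbody])
      fun h' acc' hst' hbody' => ?_
    refine .readBit (j := 0) (by simp [hA, hst', action, hbody']) ?_
    exact ih₂ (by simp [state_append_singleton, hst', step, hbody', push]) hret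
  | @querySet b acc v S i q hbody _ ih =>
    rw [add_right_comm]
    exact .querySet (S' := S) (i := i) (by simp [hA, hst, action, hbody])
      (ih (by simp [state_append_singleton, hst, step, hbody, push]) hret)
  | @queryElem b acc v e i q hbody _ ih =>
    rw [add_right_comm]
    exact .queryElem (e := e) (i := i) (by simp [hA, hst, action, hbody])
      (ih (by simp [state_append_singleton, hst, step, hbody, push]) hret)
  | @readBit b acc v j q hbody _ ih =>
    exact .readBit (j := j) (by simp [hA, hst, action, hbody])
      (ih (by simp [state_append_singleton, hst, step, hbody, push]) hret)

lemma Ev.run_nil {A : LocalAlgorithm} {s t S : ℕ} {root : Task}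
    (hA : ∀ h, A.next s t S h = action body (state body root h)) {v : Val} {q : ℕ}
    (hev : Ev body R ω root [] v q) : A.Run s t S R ω [] q (decide (v ≠ some [])) :=
  hev.run hA (q' := 0) rfl fun _ _ hst hbody => .answer (by simp [hA, hst, action, hbody])

variable (body R ω) in
/-- The subroutine call `b`, having obtained the results `acc`, returns `v` after at most `q`
further neighbor queries. -/
def EvLe (b : Task) (acc : List Val) (v : Val) (q : ℕ) : Prop :=
  ∃ q' ≤ q, Ev body R ω b acc v q'

lemma EvLe.mono {b : Task} {acc : List Val} {v : Val} {q q' : ℕ} (h : EvLe body R ω b acc v q)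
    (hq : q ≤ q') : EvLe body R ω b acc v q' :=
  let ⟨p, hp, h⟩ := h
  ⟨p, hp.trans hq, h⟩

lemma EvLe.ret {b : Task} {acc : List Val} {v : Val} (h : body (b, acc) = .inr (.inr v)) (q : ℕ) :
    EvLe body R ω b acc v q :=
  ⟨0, q.zero_le, .ret h⟩

lemma EvLe.call {b b' : Task} {acc : List Val} {v w : Val} {q q' : ℕ}
    (h : body (b, acc) = .inl b') (h₁ : EvLe body R ω b' [] v q)
    (h₂ : EvLe body R ω b (acc ++ [v]) w q') : EvLe body R ω b acc w (q + q') :=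
  let ⟨p, hp, h₁⟩ := h₁
  let ⟨p', hp', h₂⟩ := h₂
  ⟨p + p', Nat.add_le_add hp hp', .call h h₁ h₂⟩

end Semantics

section Computability

variable {α : Type*} [Primcodable α]

lemma primrec_querySet {f g : α → ℕ} (hf : Primrec f) (hg : Primrec g) :
    Primrec fun a => LCAAction.querySet (f a) (g a) :=
  (Primrec.of_equiv_symm (e := LCAAction.equivSum)).comp (Primrec.sumInl.comp (hf.pair hg))

lemma primrec_queryElem {f g : α → ℕ} (hf : Primrec f) (hg : Primrec g) :
    Primrec fun a => LCAAction.queryElem (f a) (g a) :=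
  (Primrec.of_equiv_symm (e := LCAAction.equivSum)).comp
    (Primrec.sumInr.comp (Primrec.sumInl.comp (hf.pair hg)))

lemma primrec_readBit {f : α → ℕ} (hf : Primrec f) : Primrec fun a => LCAAction.readBit (f a) :=
  (Primrec.of_equiv_symm (e := LCAAction.equivSum)).comp
    (Primrec.sumInr.comp (Primrec.sumInr.comp (Primrec.sumInl.comp hf)))

lemma primrec_answer {f : α → Bool} (hf : Primrec f) : Primrec fun a => LCAAction.answer (f a) :=
  (Primrec.of_equiv_symm (e := LCAAction.equivSum)).comp
    (Primrec.sumInr.comp (Primrec.sumInr.comp (Primrec.sumInr.comp hf)))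

lemma primrec_match_instr {β : Type*} [Primcodable β] {i : α → Option Instr} (hi : Primrec i)
    {none' : α → β} {call : α → Task → β} {act : α → LCAAction → β} {ret : α → Val → β}
    (hnone : Primrec none') (hcall : Primrec₂ call) (hact : Primrec₂ act) (hret : Primrec₂ ret) :
    Primrec fun a => match i a with
      | none => none' a
      | some (.inl b) => call a b
      | some (.inr (.inl c)) => act a c
      | some (.inr (.inr v)) => ret a v := by
  have hfst : Primrec fun p : (α × Instr) × (LCAAction ⊕ Val) => p.1.1 := .comp .fst .fst
  have hinner : Primrec₂ fun (p : α × Instr) (j : LCAAction ⊕ Val) =>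
      (j.casesOn (act p.1) (ret p.1) : β) :=
    Primrec.sumCasesOn Primrec.snd (hact.comp₂ (hfst.comp₂ .left) .right)
      (hret.comp₂ (hfst.comp₂ .left) .right)
  have hsome : Primrec₂ fun (a : α) (i : Instr) =>
      (i.casesOn (call a) fun j => j.casesOn (act a) (ret a) : β) :=
    Primrec.sumCasesOn Primrec.snd (hcall.comp₂ (Primrec.fst.comp₂ .left) .right) hinner
  refine (Primrec.option_casesOn hi hnone hsome).of_eq fun a => ?_
  rcases i a with _ | b | c | v <;> rfl

lemma primrec_push {f : α → List Frame} {g : α → Val} (hf : Primrec f) (hg : Primrec g) :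
    Primrec fun a => push (f a) (g a) := by
  have happend : Primrec₂ fun (v : Val) (f : Frame) => ((f.1, f.2 ++ [v]) : Frame) :=
    (Primrec.fst.comp Primrec.snd).pair
      (Primrec.list_concat.comp (Primrec.snd.comp Primrec.snd) Primrec.fst)
  exact (Primrec.list_modifyHead' happend).comp hf hg

variable {body : α → Frame → Instr} {st : α → List Frame}

lemma primrec_step (hbody : Primrec₂ body) (hst : Primrec st) {o : α → Option ℕ}
    (ho : Primrec o) : Primrec fun a => step (body a) (st a) (o a) := by
  have hresult : Primrec fun a => (o a).map fun n => [n] :=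
    Primrec.option_map ho (Primrec.list_cons.comp₂ .right (.const []))
  exact primrec_match_instr (Primrec.option_map (Primrec.list_head?.comp hst) hbody) (.const [])
    (Primrec.list_cons.comp (Primrec.snd.pair (.const [])) (hst.comp Primrec.fst))
    ((primrec_push hst hresult).comp Primrec.fst)
    (primrec_push (Primrec.list_tail.comp (hst.comp Primrec.fst)) Primrec.snd)

lemma primrec_action (hbody : Primrec₂ body) (hst : Primrec st) :
    Primrec fun a => action (body a) (st a) := by
  have hlast : PrimrecPred fun p : α × Val => (st p.1).tail = [] :=
    Primrec.eq.comp (Primrec.list_tail.comp (hst.comp Primrec.fst)) (.const [])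
  have hyes : PrimrecPred fun p : α × Val => p.2 ≠ some [] :=
    (Primrec.eq.comp Primrec.snd (.const (some []))).not
  exact primrec_match_instr (Primrec.option_map (Primrec.list_head?.comp hst) hbody)
    (.const (LCAAction.answer false)) (.const (LCAAction.readBit 0)) .right
    (Primrec.ite hlast (primrec_answer hyes.decide) (.const (LCAAction.readBit 0)))

lemma primrec_action_state (hbody : Primrec₂ body) {root : α → Task} (hroot : Primrec root)
    {h : α → List (Option ℕ)} (hh : Primrec h) :
    Primrec fun a => action (body a) (state (body a) (root a) (h a)) := by
  have hinit : Primrec fun a => ([(root a, [])] : List Frame) :=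
    Primrec.list_cons.comp (hroot.pair (.const [])) (.const [])
  have hstep : Primrec₂ fun (a : α) (p : List Frame × Option ℕ) => step (body a) p.1 p.2 :=
    primrec_step (hbody.comp₂ (Primrec.fst.comp₂ .left) .right) (Primrec.fst.comp Primrec.snd)
      (Primrec.snd.comp Primrec.snd)
  exact primrec_action hbody (Primrec.list_foldl hh hinit hstep)

end Computability

end Machine

/-! ### The local algorithm -/

/-- The position on the tape of the `r`-th bit of a coin. -/
def tapePos (k : Key) (r : ℕ) : ℕ :=
  Nat.pair (Nat.pair k.1.toNat (Nat.pair k.2.1 k.2.2)) r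

lemma tapePos_injective : Function.Injective fun p : Key × ℕ => tapePos p.1 p.2 := by
  rintro ⟨⟨b, i, τ⟩, r⟩ ⟨⟨b', i', τ'⟩, r'⟩ h
  simp only [tapePos, Nat.pair_eq_pair] at h
  obtain ⟨⟨hb, rfl, rfl⟩, rfl⟩ := h
  cases b <;> cases b' <;> simp_all

/-- The names of the subroutines. -/
inductive Op
  | elems | sets | joinCoin | sampleCoin | filter | test | alive | hit | chain | top

instance : Coe Op ℕ := ⟨Op.ctorIdx⟩

/-- The subroutine that reads the join coin of a set or the count coin of an element. -/
def Op.coin (b : Bool) : Op := if b then joinCoin else sampleCoin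

/-- The result of the last call. -/
def lastVal (acc : List Val) : List ℕ := acc.reverse.headI.getD []

/-- The last call has given up, or the last neighbor query has found no neighbor. -/
def LastFailed (acc : List Val) : Prop := acc.reverse.head? = some none

instance (acc : List Val) : Decidable (LastFailed acc) := inferInstanceAs (Decidable (_ = _))

/-- Concatenate all results. -/
def collect (acc : List Val) : List ℕ := acc.flatMap fun v => v.getD []

/-- Call a subroutine. -/
def Instr.call (op τ u : ℕ) (l : List ℕ) : Instr := .inl (op, τ, u, l)

/-- Query the input or the tape. -/
def Instr.act (a : LCAAction) : Instr := .inr (.inl a)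

/-- Return a result. -/
def Instr.ret (v : Val) : Instr := .inr (.inr v)

section Program

variable (P : Schedule) (τ u : ℕ) (l : List ℕ) (acc : List Val)

/-- List the elements of a set. -/
def progElems : Instr :=
  if LastFailed acc then .ret (some (collect acc)) else .act (.querySet l.headI acc.length)

/-- List the sets containing an element. -/
def progSets : Instr :=
  if LastFailed acc then .ret (some (collect acc)) else .act (.queryElem l.headI acc.length)

/-- Read a coin. -/
def progCoin (b : Bool) : Instr :=
  if acc.length < P.expo b τ then .act (.readBit (tapePos (b, l.headI, τ) acc.length))
  else .ret (some (if ∀ v ∈ acc, v = some [1] then [l.headI] else []))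

/-- Filter the list `l` with the subroutine `u`. -/
def progFilter : Instr :=
  if acc.length < l.length then .call u τ 0 [l.getI acc.length] else .ret (some (collect acc))

/-- Does the set have enough counted uncovered elements? -/
def progTest : Instr :=
  if acc.length = 0 then .call Op.elems 0 0 l
  else if acc.length = 1 then .call Op.filter τ Op.sampleCoin (lastVal acc)
  else if acc.length = 2 then .call Op.filter (P.start τ) Op.alive (lastVal acc)
  else if acc.length = 3 then
    if P.maxSample < (lastVal acc).length then .ret none
    else .call Op.filter τ Op.alive (lastVal acc)
  else .ret (some (if P.thr τ ≤ (lastVal acc).length then l else []))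

/-- Is the element uncovered? -/
def progAlive : Instr :=
  if τ = 0 then .ret (some l)
  else if acc.length = 0 then .call Op.alive (τ - 1) 0 l
  else if acc.length = 1 then
    if lastVal acc = [] then .ret (some []) else .call Op.hit (τ - 1) 0 l
  else .ret (some (if lastVal acc = [] then l else []))

/-- Which sets containing the element join in round `τ`? -/
def progHit : Instr :=
  if acc.length = 0 then .call Op.sets 0 0 l
  else if acc.length = 1 then .call Op.filter τ Op.joinCoin (lastVal acc)
  else if acc.length = 2 then .call Op.chain τ 0 (lastVal acc)
  else .ret (some (lastVal acc))

/-- Which sets in the list stay in the race through round `τ`, from round `u` of its stage on? -/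
def progChain : Instr :=
  if P.round τ < u then .ret (some l)
  else if P.cap (P.round τ - u) < l.length then .ret none
  else if acc.length = 0 then .call Op.filter (P.start τ + u) Op.test l
  else if acc.length = 1 then .call Op.chain τ (u + 1) (lastVal acc)
  else .ret (some (lastVal acc))

/-- Has the set joined the cover before round `τ`? -/
def progTop : Instr :=
  if τ = 0 then .ret (some [])
  else if acc.length = 0 then .call Op.top (τ - 1) 0 l
  else if acc.length = 1 then
    if lastVal acc = [] then .call Op.filter (τ - 1) Op.joinCoin l else .ret (some (lastVal acc))
  else if acc.length = 2 then .call Op.chain (τ - 1) 0 (lastVal acc)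
  else .ret (some (lastVal acc))

/-- The program of the local algorithm. The first two subroutines precede the test for failure
because they end with a failing query. -/
def prog (f : Frame) : Instr :=
  let (op, τ, u, l) := f.1
  if op = Op.elems then progElems l f.2
  else if op = Op.sets then progSets l f.2
  else if LastFailed f.2 then .ret none
  else if op = Op.joinCoin then progCoin P τ l f.2 true
  else if op = Op.sampleCoin then progCoin P τ l f.2 false
  else if op = Op.filter then progFilter τ u l f.2
  else if op = Op.test then progTest P τ l f.2
  else if op = Op.alive then progAlive τ l f.2
  else if op = Op.hit then progHit τ l f.2
  else if op = Op.chain then progChain P τ u l f.2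
  else progTop τ l f.2

end Program

/-! ### The program is primitive recursive -/

section Computability

lemma primrec_two_pow : Primrec fun n : ℕ => 2 ^ n :=
  (Primrec₂.unpaired'.1 Nat.Primrec.pow).comp (.const 2) .id

lemma primrec_log_two : Primrec (Nat.log 2) := by
  refine (Primrec.nat_findGreatest .id (p := fun n k => 2 ^ k ≤ n)
    (Primrec.nat_le.comp (primrec_two_pow.comp .snd) .fst)).of_eq fun n => ?_
  obtain rfl | hn := eq_or_ne n 0
  · rfl
  · exact Nat.findGreatest_eq_iff.2 ⟨Nat.log_le_self 2 n, fun _ => Nat.pow_log_le_self 2 hn,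
      fun k hk _ => (Nat.lt_pow_of_log_lt one_lt_two hk).not_ge⟩

variable {α : Type*} [Primcodable α] {L T ℓ τ u n : α → ℕ} {l : α → List ℕ} {acc : α → List Val}

lemma primrec_round (hT : Primrec T) (hτ : Primrec τ) :
    Primrec fun a => Schedule.round ⟨L a, T a, ℓ a⟩ (τ a) :=
  Primrec.nat_mod.comp hτ (Primrec.succ.comp hT)

lemma primrec_start (hT : Primrec T) (hτ : Primrec τ) :
    Primrec fun a => Schedule.start ⟨L a, T a, ℓ a⟩ (τ a) :=
  Primrec.nat_sub.comp hτ (Primrec.nat_mod.comp hτ (Primrec.succ.comp hT))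

lemma primrec_level (hL : Primrec L) (hT : Primrec T) (hτ : Primrec τ) :
    Primrec fun a => Schedule.level ⟨L a, T a, ℓ a⟩ (τ a) :=
  Primrec.nat_sub.comp hL (Primrec.nat_div.comp hτ (Primrec.succ.comp hT))

lemma primrec_expo (hL : Primrec L) (hT : Primrec T) (hℓ : Primrec ℓ) (hτ : Primrec τ) (b : Bool) :
    Primrec fun a => Schedule.expo ⟨L a, T a, ℓ a⟩ b (τ a) :=
  match b with
  | false => Primrec.nat_sub.comp (primrec_level (ℓ := ℓ) hL hT hτ) hℓ
  | true => Primrec.nat_sub.comp hT (primrec_round (L := L) (ℓ := ℓ) hT hτ)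

lemma primrec_thr (hL : Primrec L) (hT : Primrec T) (hℓ : Primrec ℓ) (hτ : Primrec τ) :
    Primrec fun a => Schedule.thr ⟨L a, T a, ℓ a⟩ (τ a) :=
  primrec_two_pow.comp (Primrec.nat_min.comp (primrec_level (ℓ := ℓ) hL hT hτ) hℓ)

lemma primrec_cap (hℓ : Primrec ℓ) (hn : Primrec n) :
    Primrec fun a => Schedule.cap ⟨L a, T a, ℓ a⟩ (n a) :=
  primrec_two_pow.comp (Primrec.nat_add.comp (Primrec.nat_add.comp hℓ (.const 1)) hn)

lemma primrec_maxSample (hℓ : Primrec ℓ) :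
    Primrec fun a => Schedule.maxSample ⟨L a, T a, ℓ a⟩ :=
  Primrec.nat_mul.comp (.const 17) (primrec_two_pow.comp hℓ)

lemma primrec_tapePos (b : Bool) (hn : Primrec n) (hτ : Primrec τ) {r : α → ℕ} (hr : Primrec r) :
    Primrec fun a => tapePos (b, n a, τ a) (r a) :=
  Primrec₂.natPair.comp (Primrec₂.natPair.comp (.const b.toNat) (Primrec₂.natPair.comp hn hτ)) hr

lemma primrec_call {op : α → ℕ} (hop : Primrec op) (hτ : Primrec τ) (hu : Primrec u)
    (hl : Primrec l) : Primrec fun a => Instr.call (op a) (τ a) (u a) (l a) :=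
  Primrec.sumInl.comp (hop.pair (hτ.pair (hu.pair hl)))

lemma primrec_act {f : α → LCAAction} (hf : Primrec f) : Primrec fun a => Instr.act (f a) :=
  Primrec.sumInr.comp (Primrec.sumInl.comp hf)

lemma primrec_ret_some {f : α → List ℕ} (hf : Primrec f) :
    Primrec fun a => Instr.ret (some (f a)) :=
  Primrec.sumInr.comp (Primrec.sumInr.comp (Primrec.option_some.comp hf))

lemma primrec_getD_nil {f : α → Val} (hf : Primrec f) : Primrec fun a => (f a).getD [] :=
  Primrec.option_getD.comp hf (.const [])

lemma primrec_lastVal (hacc : Primrec acc) : Primrec fun a => lastVal (acc a) :=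
  primrec_getD_nil (Primrec.list_headI.comp (Primrec.list_reverse.comp hacc))

lemma primrecPred_lastFailed (hacc : Primrec acc) : PrimrecPred fun a => LastFailed (acc a) :=
  Primrec.eq.comp (Primrec.list_head?.comp (Primrec.list_reverse.comp hacc)) (.const _)

lemma primrec_collect (hacc : Primrec acc) : Primrec fun a => collect (acc a) :=
  Primrec.list_flatMap hacc (primrec_getD_nil Primrec.snd)

lemma primrecPred_eq_const {β : Type*} [Primcodable β] {f : α → β} (hf : Primrec f) (c : β) :
    PrimrecPred fun a => f a = c :=
  Primrec.eq.comp hf (.const c)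

lemma primrec_singleton (hn : Primrec n) : Primrec fun a => [n a] :=
  Primrec.list_cons.comp hn (.const [])

lemma primrec_progElems (hl : Primrec l) (hacc : Primrec acc) :
    Primrec fun a => progElems (l a) (acc a) :=
  Primrec.ite (primrecPred_lastFailed hacc) (primrec_ret_some (primrec_collect hacc))
    (primrec_act (Machine.primrec_querySet (Primrec.list_headI.comp hl)
      (Primrec.list_length.comp hacc)))

lemma primrec_progSets (hl : Primrec l) (hacc : Primrec acc) :
    Primrec fun a => progSets (l a) (acc a) :=
  Primrec.ite (primrecPred_lastFailed hacc) (primrec_ret_some (primrec_collect hacc))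
    (primrec_act (Machine.primrec_queryElem (Primrec.list_headI.comp hl)
      (Primrec.list_length.comp hacc)))

lemma primrec_progCoin (hL : Primrec L) (hT : Primrec T) (hℓ : Primrec ℓ) (hτ : Primrec τ)
    (hl : Primrec l) (hacc : Primrec acc) (b : Bool) :
    Primrec fun a => progCoin ⟨L a, T a, ℓ a⟩ (τ a) (l a) (acc a) b := by
  have hhead := Primrec.list_headI.comp hl
  have hlen := Primrec.list_length.comp hacc
  have hheads : PrimrecPred fun a => ∀ v ∈ acc a, v = some [1] :=
    (primrecPred_eq_const .id _).forall_mem_list.comp hacc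
  exact Primrec.ite (Primrec.nat_lt.comp hlen (primrec_expo hL hT hℓ hτ b))
    (primrec_act (Machine.primrec_readBit (primrec_tapePos b hhead hτ hlen)))
    (primrec_ret_some (Primrec.ite hheads (primrec_singleton hhead) (.const [])))

lemma primrec_progFilter (hτ : Primrec τ) (hu : Primrec u) (hl : Primrec l)
    (hacc : Primrec acc) : Primrec fun a => progFilter (τ a) (u a) (l a) (acc a) := by
  have hlen := Primrec.list_length.comp hacc
  exact Primrec.ite (Primrec.nat_lt.comp hlen (Primrec.list_length.comp hl))
    (primrec_call hu hτ (.const 0) (primrec_singleton (Primrec.list_getI.comp hl hlen)))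
    (primrec_ret_some (primrec_collect hacc))

lemma primrec_progTest (hL : Primrec L) (hT : Primrec T) (hℓ : Primrec ℓ) (hτ : Primrec τ)
    (hl : Primrec l) (hacc : Primrec acc) :
    Primrec fun a => progTest ⟨L a, T a, ℓ a⟩ (τ a) (l a) (acc a) := by
  have hlen := primrecPred_eq_const (Primrec.list_length.comp hacc)
  have hval := primrec_lastVal hacc
  have hvalLen := Primrec.list_length.comp hval
  exact Primrec.ite (hlen 0) (primrec_call (.const _) (.const 0) (.const 0) hl) <|
    Primrec.ite (hlen 1) (primrec_call (.const _) hτ (.const _) hval) <|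
    Primrec.ite (hlen 2) (primrec_call (.const _) (primrec_start hT hτ) (.const _) hval) <|
    Primrec.ite (hlen 3) (Primrec.ite (Primrec.nat_lt.comp (primrec_maxSample hℓ) hvalLen)
      (.const _) (primrec_call (.const _) hτ (.const _) hval)) <|
    primrec_ret_some (Primrec.ite (Primrec.nat_le.comp (primrec_thr hL hT hℓ hτ) hvalLen) hl
      (.const []))

lemma primrec_progAlive (hτ : Primrec τ) (hl : Primrec l) (hacc : Primrec acc) :
    Primrec fun a => progAlive (τ a) (l a) (acc a) := by
  have hlen := primrecPred_eq_const (Primrec.list_length.comp hacc)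
  have hval := primrecPred_eq_const (primrec_lastVal hacc) []
  have hpred := Primrec.pred.comp hτ
  exact Primrec.ite (primrecPred_eq_const hτ 0) (primrec_ret_some hl) <|
    Primrec.ite (hlen 0) (primrec_call (.const _) hpred (.const 0) hl) <|
    Primrec.ite (hlen 1) (Primrec.ite hval (.const _)
      (primrec_call (.const _) hpred (.const 0) hl)) <|
    primrec_ret_some (Primrec.ite hval hl (.const []))

lemma primrec_progHit (hτ : Primrec τ) (hl : Primrec l) (hacc : Primrec acc) :
    Primrec fun a => progHit (τ a) (l a) (acc a) := by
  have hlen := primrecPred_eq_const (Primrec.list_length.comp hacc)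
  have hval := primrec_lastVal hacc
  exact Primrec.ite (hlen 0) (primrec_call (.const _) (.const 0) (.const 0) hl) <|
    Primrec.ite (hlen 1) (primrec_call (.const _) hτ (.const _) hval) <|
    Primrec.ite (hlen 2) (primrec_call (.const _) hτ (.const 0) hval) <| primrec_ret_some hval

lemma primrec_progChain (hT : Primrec T) (hℓ : Primrec ℓ) (hτ : Primrec τ) (hu : Primrec u)
    (hl : Primrec l) (hacc : Primrec acc) :
    Primrec fun a => progChain ⟨L a, T a, ℓ a⟩ (τ a) (u a) (l a) (acc a) := by
  have hlen := primrecPred_eq_const (Primrec.list_length.comp hacc)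
  have hval := primrec_lastVal hacc
  have hround := primrec_round (L := L) (ℓ := ℓ) hT hτ
  exact Primrec.ite (Primrec.nat_lt.comp hround hu) (primrec_ret_some hl) <|
    Primrec.ite (Primrec.nat_lt.comp (primrec_cap hℓ (Primrec.nat_sub.comp hround hu))
      (Primrec.list_length.comp hl)) (.const _) <|
    Primrec.ite (hlen 0) (primrec_call (.const _)
      (Primrec.nat_add.comp (primrec_start hT hτ) hu) (.const _) hl) <|
    Primrec.ite (hlen 1) (primrec_call (.const _) hτ (Primrec.succ.comp hu) hval) <|
    primrec_ret_some hval

lemma primrec_progTop (hτ : Primrec τ) (hl : Primrec l) (hacc : Primrec acc) :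
    Primrec fun a => progTop (τ a) (l a) (acc a) := by
  have hlen := primrecPred_eq_const (Primrec.list_length.comp hacc)
  have hval := primrec_lastVal hacc
  have hpred := Primrec.pred.comp hτ
  exact Primrec.ite (primrecPred_eq_const hτ 0) (.const _) <|
    Primrec.ite (hlen 0) (primrec_call (.const _) hpred (.const 0) hl) <|
    Primrec.ite (hlen 1) (Primrec.ite (primrecPred_eq_const hval [])
      (primrec_call (.const _) hpred (.const _) hl) (primrec_ret_some hval)) <|
    Primrec.ite (hlen 2) (primrec_call (.const _) hpred (.const 0) hval) <| primrec_ret_some hval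

lemma primrec_prog (hL : Primrec L) (hT : Primrec T) (hℓ : Primrec ℓ) {f : α → Frame}
    (hf : Primrec f) : Primrec fun a => prog ⟨L a, T a, ℓ a⟩ (f a) := by
  have htask := Primrec.fst.comp hf
  have hop := primrecPred_eq_const (Primrec.fst.comp htask)
  have hτ := Primrec.fst.comp (Primrec.snd.comp htask)
  have hu := Primrec.fst.comp (Primrec.snd.comp (Primrec.snd.comp htask))
  have hl := Primrec.snd.comp (Primrec.snd.comp (Primrec.snd.comp htask))
  have hacc := Primrec.snd.comp hf
  exact Primrec.ite (hop _) (primrec_progElems hl hacc) <|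
    Primrec.ite (hop _) (primrec_progSets hl hacc) <|
    Primrec.ite (primrecPred_lastFailed hacc) (.const _) <|
    Primrec.ite (hop _) (primrec_progCoin hL hT hℓ hτ hl hacc true) <|
    Primrec.ite (hop _) (primrec_progCoin hL hT hℓ hτ hl hacc false) <|
    Primrec.ite (hop _) (primrec_progFilter hτ hu hl hacc) <|
    Primrec.ite (hop _) (primrec_progTest hL hT hℓ hτ hl hacc) <|
    Primrec.ite (hop _) (primrec_progAlive hτ hl hacc) <|
    Primrec.ite (hop _) (primrec_progHit hτ hl hacc) <|
    Primrec.ite (hop _) (primrec_progChain hT hℓ hτ hu hl hacc) (primrec_progTop hτ hl hacc)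

end Computability

/-- The schedule for sets of size at most `s` and elements in at most `t` sets. -/
def schedule (s t : ℕ) : Schedule where
  L := Nat.log 2 s + 1
  T := Nat.log 2 t + 1
  ℓ := 4 * (Nat.log 2 (Nat.log 2 s + Nat.log 2 t + 18) + 1)

/-- The local computation algorithm. -/
def algorithm : LocalAlgorithm where
  next s t S h := Machine.action (prog (schedule s t))
    (Machine.state (prog (schedule s t)) (Op.top, (schedule s t).numRounds, 0, [S]) h)
  computable := by
    have hlogs : Primrec fun p : ℕ × ℕ × ℕ × List (Option ℕ) => Nat.log 2 p.1 :=
      primrec_log_two.comp .fst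
    have hlogt : Primrec fun p : ℕ × ℕ × ℕ × List (Option ℕ) => Nat.log 2 p.2.1 :=
      primrec_log_two.comp (Primrec.fst.comp .snd)
    have hL := Primrec.succ.comp hlogs
    have hT := Primrec.succ.comp hlogt
    have hℓ : Primrec fun p : ℕ × ℕ × ℕ × List (Option ℕ) => (schedule p.1 p.2.1).ℓ :=
      Primrec.nat_mul.comp (.const 4) (Primrec.succ.comp (primrec_log_two.comp
        (Primrec.nat_add.comp (Primrec.nat_add.comp hlogs hlogt) (.const 18))))
    have hbody : Primrec₂ fun (p : ℕ × ℕ × ℕ × List (Option ℕ)) (f : Frame) =>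
        prog (schedule p.1 p.2.1) f :=
      primrec_prog (hL.comp .fst) (hT.comp .fst) (hℓ.comp .fst) .snd
    have hroot : Primrec fun p : ℕ × ℕ × ℕ × List (Option ℕ) =>
        ((Op.top, (schedule p.1 p.2.1).numRounds, 0, [p.2.2.1]) : Task) :=
      (Primrec.const _).pair ((Primrec.nat_mul.comp (Primrec.succ.comp hL)
        (Primrec.succ.comp hT)).pair ((Primrec.const 0).pair
          (primrec_singleton (Primrec.fst.comp (Primrec.snd.comp .snd)))))
    exact (Machine.primrec_action_state hbody hroot
      (Primrec.snd.comp (Primrec.snd.comp .snd))).to_comp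

/-! ### Correctness of the local algorithm -/

section Subroutines

open Machine

lemma not_lastFailed_nil : ¬LastFailed [] := by simp [LastFailed]

@[simp] lemma lastFailed_append_singleton {acc : List Val} {v : Val} :
    LastFailed (acc ++ [v]) ↔ v = none := by
  simp [LastFailed]

lemma not_lastFailed_append_some (acc : List Val) (l : List ℕ) : ¬LastFailed (acc ++ [some l]) := by
  simp

lemma not_lastFailed_map_some {α : Type*} (f : α → List ℕ) (l : List α) :
    ¬LastFailed (l.map fun a => some (f a)) := by
  cases l using List.reverseRecOn <;> simp [not_lastFailed_nil]

lemma collect_map_some {α : Type*} (f : α → List ℕ) (l : List α) :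
    collect (l.map fun a => some (f a)) = l.flatMap f :=
  List.flatMap_map ..

lemma flatMap_ite_singleton {α : Type*} (p : α → Prop) [DecidablePred p] (l : List α) :
    (l.flatMap fun a => if p a then [a] else []) = l.filter fun a => p a := by
  induction l with
  | nil => rfl
  | cons a l ih => by_cases h : p a <;> simp [h, ih]

section Programs

variable {P : Schedule} {τ u : ℕ} {l : List ℕ} {acc : List Val}

lemma prog_of_lastFailed {op : ℕ} (hop : 2 ≤ op) (h : LastFailed acc) :
    prog P ((op, τ, u, l), acc) = .ret none :=
  (if_neg (show op ≠ 0 by omega)).trans ((if_neg (show op ≠ 1 by omega)).trans (if_pos h))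

lemma prog_elems : prog P ((Op.elems, τ, u, l), acc) = progElems l acc := rfl

lemma prog_sets : prog P ((Op.sets, τ, u, l), acc) = progSets l acc := rfl

variable (h : ¬LastFailed acc)
include h

lemma prog_coin (b : Bool) : prog P ((Op.coin b, τ, u, l), acc) = progCoin P τ l acc b := by
  cases b <;> exact if_neg h

lemma prog_filter : prog P ((Op.filter, τ, u, l), acc) = progFilter τ u l acc := if_neg h

lemma prog_chain : prog P ((Op.chain, τ, u, l), acc) = progChain P τ u l acc := if_neg h

end Programs

open Classical in
/-- The result of a subroutine that gives up if `F` holds and returns `l` otherwise. -/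
noncomputable def valUnless (F : Prop) (l : List ℕ) : Val := if F then none else some l

lemma valUnless_of {F : Prop} (h : F) (l : List ℕ) : valUnless F l = none := if_pos h

lemma valUnless_of_not {F : Prop} (h : ¬F) (l : List ℕ) : valUnless F l = some l := if_neg h

variable {P : Schedule} {I : SetSystem} {R : I.Representation} {ω : ℕ → Bool}

lemma Machine.EvLe.call_valUnless {op τ u : ℕ} {l l' m : List ℕ} {acc : List Val} {b : Task}
    {F G : Prop} {q q' : ℕ} (h : prog P ((op, τ, u, l), acc) = .inl b)
    (h₁ : EvLe (prog P) R ω b [] (valUnless F l') q) (hFG : F → G)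
    (h₂ : ¬F → EvLe (prog P) R ω (op, τ, u, l) (acc ++ [some l']) (valUnless G m) q')
    (hop : 2 ≤ op := by decide) :
    EvLe (prog P) R ω (op, τ, u, l) acc (valUnless G m) (q + q') := by
  refine .call h h₁ ?_
  by_cases hF : F
  · rw [valUnless_of hF, valUnless_of (hFG hF)]
    exact .ret (prog_of_lastFailed hop (lastFailed_append_singleton.2 rfl)) q'
  · rw [valUnless_of_not hF]
    exact h₂ hF

lemma Machine.Ev.list {b : Task} {N : List ℕ}
    (hquery : ∀ {acc v q}, ¬LastFailed acc →
      Ev (prog P) R ω b (acc ++ [N[acc.length]?.map fun n => [n]]) v q →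
        Ev (prog P) R ω b acc v (q + 1))
    (hret : ∀ {acc}, LastFailed acc → prog P (b, acc) = .ret (some (collect acc))) :
    Ev (prog P) R ω b [] (some N) (N.length + 1) := by
  suffices H : ∀ l₁ l₂, l₁ ++ l₂ = N →
      Ev (prog P) R ω b (l₁.map fun a => some [a]) (some N) (l₂.length + 1) from H [] N rfl
  intro l₁ l₂ hN
  induction l₂ generalizing l₁ with
  | nil =>
    refine hquery (not_lastFailed_map_some _ l₁) (.ret ?_)
    rw [hret (by simp [← hN])]
    simp [← hN, Instr.ret, collect, List.flatMap_map]
  | cons a l₂ ih =>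
    refine hquery (not_lastFailed_map_some _ l₁) ?_
    simpa [← hN] using ih (l₁ ++ [a]) (by simpa using hN)

lemma evLe_elems (S τ u : ℕ) :
    EvLe (prog P) R ω (Op.elems, τ, u, [S]) [] (some (R.setList S)) ((R.setList S).length + 1) :=
  ⟨_, le_rfl, .list (fun h => .querySet (by simp [prog_elems, progElems, h, Instr.act]))
    fun h => by simp [prog_elems, progElems, h]⟩

lemma evLe_sets (e τ u : ℕ) :
    EvLe (prog P) R ω (Op.sets, τ, u, [e]) [] (some (R.elemList e)) ((R.elemList e).length + 1) :=
  ⟨_, le_rfl, .list (fun h => .queryElem (by simp [prog_sets, progSets, h, Instr.act]))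
    fun h => by simp [prog_sets, progSets, h]⟩

lemma evLe_filter {τ u c : ℕ} {l : List ℕ} {F p : ℕ → Prop} [DecidablePred p]
    (h : ∀ a ∈ l,
      EvLe (prog P) R ω (u, τ, 0, [a]) [] (valUnless (F a) (if p a then [a] else [])) c) :
    EvLe (prog P) R ω (Op.filter, τ, u, l) [] (valUnless (∃ a ∈ l, F a) (l.filter fun a => p a))
      (l.length * c) := by
  suffices H : ∀ l₁ l₂, l₁ ++ l₂ = l → EvLe (prog P) R ω (Op.filter, τ, u, l)
      (l₁.map fun a => some (if p a then [a] else []))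
      (valUnless (∃ a ∈ l₂, F a) (l.filter fun a => p a)) (l₂.length * c) from H [] l rfl
  have hprog (l₁ : List ℕ) :=
    prog_filter (P := P) (τ := τ) (u := u) (l := l)
      (not_lastFailed_map_some (fun a => if p a then [a] else []) l₁)
  intro l₁ l₂ hl
  induction l₂ generalizing l₁ with
  | nil =>
    rw [List.append_nil] at hl
    subst hl
    rw [valUnless_of_not (by simp)]
    refine .ret ?_ _
    simp [hprog, progFilter, collect_map_some, flatMap_ite_singleton, Instr.ret]
  | cons a l₂ ih =>
    have hlen : l₁.length < l.length := by simp [← hl]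
    have hget : l.getI l₁.length = a := by simp [← hl, List.getI_append_right]
    rw [List.length_cons, Nat.succ_mul, add_comm]
    refine .call_valUnless (b := (u, τ, 0, [a])) ?_ (h a (by simp [← hl]))
      (fun hF => ⟨a, by simp, hF⟩) fun hF => ?_
    · simp [hprog, progFilter, hlen, hget, Instr.call]
    · simpa [hF] using ih (l₁ ++ [a]) (by simpa using hl)

/-- The coins in `x` show what is written on the tape `ω`. -/
def ReadsCoins (ω : ℕ → Bool) (x : Outcome P I) : Prop :=
  ∀ k ∈ keySet P I, (coin x k = true ↔ ∀ r < P.expo k.1 k.2.2, ω (tapePos k r) = true)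

variable {x : Outcome P I} (hx : ReadsCoins ω x)
include hx

lemma evLe_coin {b : Bool} {i τ : ℕ} (hk : (b, i, τ) ∈ keySet P I) (u : ℕ) :
    EvLe (prog P) R ω (Op.coin b, τ, u, [i]) []
      (some (if coin x (b, i, τ) then [i] else [])) 0 := by
  let bits (m : ℕ) : List Val :=
    (List.range m).map fun r => some [(ω (tapePos (b, i, τ) r)).toNat]
  have hprog (m : ℕ) : prog P ((Op.coin b, τ, u, [i]), bits m) = progCoin P τ [i] (bits m) b :=
    prog_coin (not_lastFailed_map_some _ _) b
  suffices H : ∀ m ≤ P.expo b τ, Ev (prog P) R ω (Op.coin b, τ, u, [i]) (bits m)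
      (some (if coin x (b, i, τ) then [i] else [])) 0 from ⟨0, le_rfl, H 0 (Nat.zero_le _)⟩
  intro m hm
  induction hm using Nat.decreasingInduction with
  | self =>
    refine .ret ?_
    simp [hprog, progCoin, bits, hx _ hk, Instr.ret]
  | of_succ m hm ih =>
    refine .readBit (j := tapePos (b, i, τ) m) ?_ ?_
    · simp [hprog, progCoin, bits, hm, Instr.act]
    · simpa [bits, List.range_succ] using ih

lemma evLe_filter_coin {b : Bool} {τ : ℕ} (hτ : τ < P.numRounds) {l : List ℕ}
    (hl : ∀ a ∈ l, a ∈ I.sets ∪ I.univ) :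
    EvLe (prog P) R ω (Op.filter, τ, (Op.coin b : ℕ), l) []
      (some (l.filter fun a => coin x (b, a, τ))) 0 := by
  have h := evLe_filter (F := fun _ => False) (p := fun a => coin x (b, a, τ) = true) fun a ha => by
    rw [valUnless_of_not not_false]
    exact evLe_coin (R := R) hx (mem_keySet.2 ⟨hl a ha, hτ⟩) 0
  simpa [valUnless_of_not] using h

end Subroutines

section Rounds

open Machine

lemma length_eq_card {l : List ℕ} {A : Finset ℕ} (hl : l.Nodup) (h : ∀ a, a ∈ l ↔ a ∈ A) :
    l.length = #A := by
  rw [← List.toFinset_card_of_nodup hl, show l.toFinset = A by ext a; rw [List.mem_toFinset, h]]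

variable {P : Schedule} {I : SetSystem}

/-- The subroutine `alive` is correct for round `τ` and makes at most `q` queries. -/
def AliveSpec (R : I.Representation) (ω : ℕ → Bool) (x : Outcome P I) (τ q : ℕ) : Prop :=
  ∀ e ∈ I.univ, EvLe (prog P) R ω (Op.alive, τ, 0, [e]) []
    (valUnless (Fail x false τ e) (if e ∈ alive x τ then [e] else [])) q

/-- The subroutine `test` is correct for round `τ` and makes at most `q` queries. -/
def TestSpec (R : I.Representation) (ω : ℕ → Bool) (x : Outcome P I) (τ q : ℕ) : Prop :=
  ∀ S ∈ I.sets, EvLe (prog P) R ω (Op.test, τ, 0, [S]) []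
    (valUnless (Fail x true τ S) (if Passes x τ S then [S] else [])) q

variable {R : I.Representation} {ω : ℕ → Bool} {x : Outcome P I} {s t : ℕ}

lemma evLe_test_of_preSample {τ q S : ℕ} (hS : S ∈ I.sets) (hround : AliveSpec R ω x τ q)
    {l₀ l₁ l₂ : List ℕ} (hl₂ : l₂.Nodup) (hmem : ∀ e, e ∈ l₂ ↔ e ∈ preSample x τ S)
    (hstart : ∀ e ∈ I.elts S, coin x (false, e, τ) = true → ¬Fail x false (P.start τ) e) :
    EvLe (prog P) R ω (Op.test, τ, 0, [S]) [some l₀, some l₁, some l₂]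
      (valUnless (Fail x true τ S) (if Passes x τ S then [S] else [])) (P.maxSample * q) := by
  let l₃ := l₂.filter fun e => e ∈ alive x τ
  have hstep : prog P ((Op.test, τ, 0, [S]), [some l₀, some l₁, some l₂]) =
    if P.maxSample < l₂.length then .ret none else .call Op.filter τ Op.alive l₂ := rfl
  have hresult : prog P ((Op.test, τ, 0, [S]), [some l₀, some l₁, some l₂, some l₃]) =
    .ret (some (if P.thr τ ≤ l₃.length then [S] else [])) := rfl
  have hmem₃ (e) : e ∈ l₃ ↔ e ∈ sample x (alive x τ) τ S := by
    have := @alive_antitone _ _ x _ _ (P.start_le τ) e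
    simp only [l₃, List.mem_filter, hmem, preSample, sample, mem_filter, mem_inter,
      decide_eq_true_eq]
    tauto
  have hlen₂ : l₂.length = #(preSample x τ S) := length_eq_card hl₂ hmem
  have hlen₃ : l₃.length = #(sample x (alive x τ) τ S) := length_eq_card (hl₂.filter _) hmem₃
  by_cases hcap : P.maxSample < l₂.length
  · rw [valUnless_of (.sample (hlen₂ ▸ hcap))]
    exact .ret (hstep.trans (if_pos hcap)) _
  refine EvLe.mono (q := l₂.length * q + 0) ?_ (Nat.mul_le_mul_right _ (not_lt.1 hcap))
  refine .call_valUnless (hstep.trans (if_neg hcap)) (evLe_filter fun e he => hround e ?_)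
    (fun ⟨e, he, hF⟩ => .elem ((hmem e).1 he) hF) fun hround' => ?_
  · exact I.elts_subset S hS (mem_inter.1 (mem_filter.1 ((hmem e).1 he)).1).1
  have hF : ¬Fail x true τ S := by
    rintro (_ | _ | _ | ⟨he, hc, hF⟩ | h | ⟨he, hF⟩)
    · exact hstart _ he hc hF
    · exact hcap (hlen₂ ▸ h)
    · exact hround' ⟨_, (hmem _).2 he, hF⟩
  rw [valUnless_of_not hF]
  simp only [Passes, ← hlen₃]
  exact .ret hresult _

lemma testSpec_of_aliveSpec (hx : ReadsCoins ω x) (hs : ∀ S ∈ I.sets, #(I.elts S) ≤ s) {τ q q' : ℕ}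
    (hτ : τ < P.numRounds) (hstart : AliveSpec R ω x (P.start τ) q)
    (hround : AliveSpec R ω x τ q') :
    TestSpec R ω x τ (s + 1 + s * q + P.maxSample * q') := by
  intro S hS
  let l₀ := R.setList S
  let l₁ := l₀.filter fun e => coin x (false, e, τ)
  have hmem₀ (e) : e ∈ l₀ ↔ e ∈ I.elts S := by simp [l₀, R.mem_setList, hS]
  have hmem₁ (e) : e ∈ l₁ ↔ e ∈ I.elts S ∧ coin x (false, e, τ) = true := by simp [l₁, hmem₀]
  have hlen₀ : l₀.length ≤ s := (length_eq_card (R.setList_nodup S) hmem₀).trans_le (hs S hS)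
  have hlen₁ : l₁.length ≤ s := (List.length_filter_le _ _).trans hlen₀
  have huniv {e} (he : e ∈ I.elts S) : e ∈ I.univ := I.elts_subset S hS he
  refine EvLe.mono (q := l₀.length + 1 + (0 + (l₁.length * q + P.maxSample * q'))) ?_ ?_
  · refine .call (b' := (Op.elems, 0, 0, [S])) rfl (evLe_elems S 0 0) <|
      .call (b' := (Op.filter, τ, Op.sampleCoin, l₀)) rfl
        (evLe_filter_coin (b := false) hx hτ fun e he =>
          mem_union_right _ (huniv ((hmem₀ e).1 he))) <|
      .call_valUnless (b := (Op.filter, P.start τ, Op.alive, l₁)) rfl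
        (evLe_filter fun e he => hstart e (huniv ((hmem₁ e).1 he).1))
        (fun ⟨e, he, hF⟩ => .start ((hmem₁ e).1 he).1 ((hmem₁ e).1 he).2 hF) fun hF => ?_
    refine evLe_test_of_preSample hS hround (((R.setList_nodup S).filter _).filter _) (fun e => ?_)
      fun e he hc h => hF ⟨e, (hmem₁ e).2 ⟨he, hc⟩, h⟩
    simp [l₁, hmem₀, preSample, sample, and_assoc, and_comm (a := e ∈ alive x (P.start τ))]
  · have := Nat.mul_le_mul_right q hlen₁
    omega

variable (x) in
/-- The sets in the race after `k` rounds of the stage of `τ`. -/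
def racing (τ : ℕ) : ℕ → Finset ℕ
  | 0 => I.sets
  | k + 1 => active x (P.start τ + k)

lemma racing_eq_cand {τ k : ℕ} (hk : k ≤ P.T) : racing x τ k = cand x (P.start τ + k) := by
  cases k with
  | zero => exact (cand_start x τ).symm
  | succ k => exact (cand_start_succ x hk).symm

lemma racing_succ {τ k : ℕ} (hk : k ≤ P.T) :
    racing x τ (k + 1) = {S ∈ racing x τ k | Passes x (P.start τ + k) S} := by
  rw [racing_eq_cand hk]
  rfl

lemma racing_round_succ (τ : ℕ) : racing x τ (P.round τ + 1) = active x τ := by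
  rw [racing, P.start_add_round]

variable (x) in
/-- The sets in the list `l` which may join in round `τ` and are in the race after `k` rounds of
the stage of `τ`. -/
def raceList (τ : ℕ) (l : List ℕ) (k : ℕ) : List ℕ :=
  (l.filter fun S => coin x (true, S, τ)).filter fun S => S ∈ racing x τ k

variable (x) in
/-- The local simulation gives up when it follows `raceList x τ l` from `k` to the round `τ`. -/
def RaceFails (τ : ℕ) (l : List ℕ) (k : ℕ) : Prop :=
  ∃ i, k ≤ i ∧ i ≤ P.round τ ∧ (P.cap (P.round τ - i) < (raceList x τ l i).length ∨
    ∃ S ∈ raceList x τ l i, Fail x true (P.start τ + i) S)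

lemma mem_raceList {τ k S : ℕ} {l : List ℕ} :
    S ∈ raceList x τ l k ↔ S ∈ l ∧ coin x (true, S, τ) = true ∧ S ∈ racing x τ k := by
  simp [raceList, and_comm (a := S ∈ racing x τ k)]

lemma mem_raceList_round_succ {τ S : ℕ} {l : List ℕ} :
    S ∈ raceList x τ l (P.round τ + 1) ↔ S ∈ l ∧ S ∈ joined x τ := by
  rw [mem_raceList, racing_round_succ, joined, mem_filter, and_comm (a := S ∈ active x τ)]

lemma raceList_zero {τ : ℕ} {l : List ℕ} (hl : ∀ S ∈ l, S ∈ I.sets) :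
    raceList x τ l 0 = l.filter fun S => coin x (true, S, τ) :=
  List.filter_eq_self.2 fun S hS => decide_eq_true (hl S (List.mem_filter.1 hS).1)

lemma filter_raceList {τ k : ℕ} (hk : k ≤ P.T) (l : List ℕ) :
    ((raceList x τ l k).filter fun S => Passes x (P.start τ + k) S) = raceList x τ l (k + 1) := by
  simp only [raceList, List.filter_filter, racing_succ hk, mem_filter, Bool.decide_and,
    Bool.and_assoc, Bool.and_left_comm]

/-- The number of queries made by `chain` in the rounds from `k` to `P.round τ` of a stage, if
`test` makes `cA τ` queries in round `τ`. -/
def Schedule.chainCost (P : Schedule) (cA : ℕ → ℕ) (τ k : ℕ) : ℕ :=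
  ∑ i ∈ Ico k (P.round τ + 1), P.cap (P.round τ - i) * cA (P.start τ + i)

lemma Schedule.chainCost_eq_add {τ k : ℕ} (hk : k ≤ P.round τ) (cA : ℕ → ℕ) :
    P.chainCost cA τ k =
      P.cap (P.round τ - k) * cA (P.start τ + k) + P.chainCost cA τ (k + 1) :=
  sum_eq_sum_Ico_succ_bot (Nat.lt_succ_of_le hk) _

lemma evLe_chain {cA : ℕ → ℕ} {τ k : ℕ} (hk : k ≤ P.round τ + 1)
    (htest : ∀ k ≤ P.round τ, TestSpec R ω x (P.start τ + k) (cA (P.start τ + k))) (l : List ℕ) :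
    EvLe (prog P) R ω (Op.chain, τ, k, raceList x τ l k) []
      (valUnless (RaceFails x τ l k) (raceList x τ l (P.round τ + 1))) (P.chainCost cA τ k) := by
  induction hk using Nat.decreasingInduction with
  | self =>
    rw [valUnless_of_not fun ⟨i, hki, hi, _⟩ => by omega]
    exact .ret (if_pos (P.round τ).lt_succ_self) _
  | of_succ k hk ih =>
    have hk : k ≤ P.round τ := Nat.le_of_lt_succ hk
    have hkT : k ≤ P.T := hk.trans (P.round_le τ)
    have hprog {acc : List Val} (h : ¬LastFailed acc) :=
      (prog_chain (P := P) (u := k) (l := raceList x τ l k) h).trans (if_neg hk.not_gt)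
    have hsets : ∀ S ∈ raceList x τ l k, S ∈ I.sets := fun S hS => by
      have := (mem_raceList.1 hS).2.2
      rw [racing_eq_cand hkT] at this
      exact cand_subset x _ this
    by_cases hcap : P.cap (P.round τ - k) < (raceList x τ l k).length
    · rw [valUnless_of ⟨k, le_rfl, hk, .inl hcap⟩]
      exact .ret ((hprog not_lastFailed_nil).trans (if_pos hcap)) _
    have hprog {acc : List Val} (h : ¬LastFailed acc) := (hprog h).trans (if_neg hcap)
    rw [P.chainCost_eq_add hk]
    refine EvLe.mono ?_ (Nat.add_le_add_right (Nat.mul_le_mul_right _ (not_lt.1 hcap)) _)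
    refine .call_valUnless (hprog not_lastFailed_nil)
      (evLe_filter fun S hS => htest k hk S (hsets S hS))
      (fun ⟨S, hS, hF⟩ => ⟨k, le_rfl, hk, .inr ⟨S, hS, hF⟩⟩) fun hF => ?_
    rw [filter_raceList hkT]
    refine .call_valUnless (q' := 0) (hprog (not_lastFailed_append_some _ _)) ih
      (fun ⟨i, hki, h⟩ => ⟨i, (Nat.le_succ k).trans hki, h⟩) fun hF' => ?_
    rw [valUnless_of_not]
    · exact .ret (hprog (not_lastFailed_append_some _ _)) _
    rintro ⟨i, hki, hi, h⟩
    rcases hki.eq_or_lt with rfl | hki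
    · exact h.elim hcap hF
    · exact hF' ⟨i, hki, hi, h⟩

variable (x) in
/-- The local simulation gives up when it looks for the sets that cover `e` in round `τ`. -/
def HitFails (τ e : ℕ) : Prop :=
  ∃ k ≤ P.round τ, P.cap (P.round τ - k) < #(hitList x τ e k) ∨
    ∃ S ∈ hitList x τ e k, Fail x true (P.start τ + k) S

lemma fail_false_succ_iff {τ e : ℕ} :
    Fail x false (τ + 1) e ↔ Fail x false τ e ∨ e ∈ alive x τ ∧ HitFails x τ e := by
  constructor
  · rintro (h | ⟨he, hk, h⟩ | ⟨he, hk, hS, h⟩)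
    · exact .inl h
    · exact .inr ⟨he, _, hk, .inl h⟩
    · exact .inr ⟨he, _, hk, .inr ⟨_, hS, h⟩⟩
  · rintro (h | ⟨he, k, hk, h | ⟨S, hS, h⟩⟩)
    · exact .prev h
    · exact .cap he hk h
    · exact .hit he hk hS h

lemma raceFails_elemList_iff {τ e : ℕ} : RaceFails x τ (R.elemList e) 0 ↔ HitFails x τ e := by
  have hmem {k : ℕ} (hk : k ≤ P.round τ) (S : ℕ) :
      S ∈ raceList x τ (R.elemList e) k ↔ S ∈ hitList x τ e k := by
    rw [mem_raceList, R.mem_elemList, racing_eq_cand (hk.trans (P.round_le τ)), hitList,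
      mem_filter, mem_inter, mem_setsOf]
    tauto
  simp only [RaceFails, HitFails, Nat.zero_le, true_and]
  refine exists_congr fun k => and_congr_right fun hk => ?_
  have hnodup : (raceList x τ (R.elemList e) k).Nodup := ((R.elemList_nodup e).filter _).filter _
  rw [length_eq_card hnodup (hmem hk)]
  simp only [hmem hk]

lemma evLe_hit (hx : ReadsCoins ω x) (ht : ∀ e ∈ I.univ, #(I.setsOf e) ≤ t) {cA : ℕ → ℕ} {τ e : ℕ}
    (hτ : τ < P.numRounds) (he : e ∈ I.univ)
    (htest : ∀ k ≤ P.round τ, TestSpec R ω x (P.start τ + k) (cA (P.start τ + k))) :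
    EvLe (prog P) R ω (Op.hit, τ, 0, [e]) []
      (valUnless (HitFails x τ e) (raceList x τ (R.elemList e) (P.round τ + 1)))
      (t + 1 + P.chainCost cA τ 0) := by
  have hmem (S) : S ∈ R.elemList e ↔ S ∈ I.setsOf e := by rw [R.mem_elemList, mem_setsOf]
  have hsets : ∀ S ∈ R.elemList e, S ∈ I.sets := fun S hS => (mem_setsOf.1 ((hmem S).1 hS)).1
  have hlen : (R.elemList e).length ≤ t :=
    (length_eq_card (R.elemList_nodup e) hmem).trans_le (ht e he)
  have hchain := evLe_chain (Nat.zero_le _) htest (R.elemList e)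
  rw [raceList_zero hsets, raceFails_elemList_iff] at hchain
  refine EvLe.mono (q := (R.elemList e).length + 1 + (0 + (P.chainCost cA τ 0 + 0))) ?_ (by omega)
  refine .call (b' := (Op.sets, 0, 0, [e])) rfl (evLe_sets e 0 0) <|
    .call (b' := (Op.filter, τ, Op.joinCoin, R.elemList e)) rfl
      (evLe_filter_coin (b := true) hx hτ fun S hS => mem_union_left _ (hsets S hS)) <|
    .call_valUnless rfl hchain id fun hF => ?_
  rw [valUnless_of_not hF]
  exact .ret rfl _

lemma raceList_elemList_eq_nil_iff {τ e : ℕ} (he : e ∈ alive x τ) :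
    raceList x τ (R.elemList e) (P.round τ + 1) = [] ↔ e ∈ alive x (τ + 1) := by
  simp only [List.eq_nil_iff_forall_not_mem, mem_raceList_round_succ, R.mem_elemList, alive_succ,
    mem_sdiff, he, mem_biUnion, true_and, not_exists, not_and]
  exact forall_congr' fun S => ⟨fun h hS heS => h ⟨joined_subset x τ hS, heS⟩ hS,
    fun h heS hS => h hS heS.2⟩

lemma aliveSpec_succ (hx : ReadsCoins ω x) (ht : ∀ e ∈ I.univ, #(I.setsOf e) ≤ t) {cA : ℕ → ℕ}
    {τ q : ℕ} (hτ : τ < P.numRounds) (halive : AliveSpec R ω x τ q)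
    (htest : ∀ k ≤ P.round τ, TestSpec R ω x (P.start τ + k) (cA (P.start τ + k))) :
    AliveSpec R ω x (τ + 1) (q + (t + 1 + P.chainCost cA τ 0)) := by
  intro e he
  refine .call_valUnless rfl (halive e he) .prev fun hF => ?_
  by_cases hal : e ∈ alive x τ
  · rw [if_pos hal]
    have hF_iff : Fail x false (τ + 1) e ↔ HitFails x τ e := by
      simp [fail_false_succ_iff, hF, hal]
    rw [hF_iff]
    refine .call_valUnless (q' := 0) (b := (Op.hit, τ, 0, [e])) rfl (evLe_hit hx ht hτ he htest) id
      fun hF' => ?_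
    rw [valUnless_of_not hF']
    simp only [← raceList_elemList_eq_nil_iff (R := R) hal]
    exact .ret rfl _
  · have hal' : e ∉ alive x (τ + 1) := fun h => hal (alive_antitone x τ.le_succ h)
    rw [valUnless_of_not (by simp [fail_false_succ_iff, hF, hal]), if_neg hal, if_neg hal']
    exact .ret rfl _

/-- `cU` and `cA` bound the numbers of queries made by `alive` and by `test`. -/
structure CostBound (P : Schedule) (s t : ℕ) (cU cA : ℕ → ℕ) : Prop where
  test_le : ∀ τ < P.numRounds, s + 1 + s * cU (P.start τ) + P.maxSample * cU τ ≤ cA τ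
  alive_le : ∀ τ < P.numRounds, cU τ + (t + 1 + P.chainCost cA τ 0) ≤ cU (τ + 1)

variable {cU cA : ℕ → ℕ}

lemma not_fail_false_zero (e : ℕ) : ¬Fail x false 0 e := nofun

lemma CostBound.aliveSpec (hc : CostBound P s t cU cA) (hx : ReadsCoins ω x) (hI : I.Bounded s t)
    {τ : ℕ} (hτ : τ ≤ P.numRounds) : AliveSpec R ω x τ (cU τ) := by
  induction τ using Nat.strong_induction_on with
  | _ τ ih =>
    cases τ with
    | zero =>
      intro e he
      rw [valUnless_of_not (not_fail_false_zero e), if_pos (show e ∈ alive x 0 from he)]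
      exact .ret rfl _
    | succ τ =>
      refine fun e he => EvLe.mono ?_ (hc.alive_le τ hτ)
      refine aliveSpec_succ hx hI.2 hτ (ih τ τ.lt_succ_self (by omega)) (fun k hk S hS => ?_) e he
      have hkτ : P.start τ + k ≤ τ := by have := P.start_add_round τ; omega
      have hstart := P.start_le (P.start τ + k)
      exact (testSpec_of_aliveSpec hx hI.1 (by omega) (ih _ (by omega) (by omega))
        (ih _ (by omega) (by omega)) S hS).mono (hc.test_le _ (by omega))

lemma CostBound.testSpec (hc : CostBound P s t cU cA) (hx : ReadsCoins ω x) (hI : I.Bounded s t)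
    {τ : ℕ} (hτ : τ < P.numRounds) : TestSpec R ω x τ (cA τ) := fun S hS =>
  (testSpec_of_aliveSpec hx hI.1 hτ (hc.aliveSpec hx hI ((P.start_le τ).trans hτ.le))
    (hc.aliveSpec hx hI hτ.le) S hS).mono (hc.test_le τ hτ)

variable (x) in
/-- The set `S` joins the cover in round `τ`, or the local simulation gives up when it asks. -/
def Selected (τ S : ℕ) : Prop :=
  S ∈ joined x τ ∨ coin x (true, S, τ) = true ∧
    ∃ k ≤ P.round τ, S ∈ cand x (P.start τ + k) ∧ Fail x true (P.start τ + k) S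

lemma mem_cover_iff {S : ℕ} (hS : S ∈ I.sets) :
    S ∈ cover x ↔ ∃ τ < P.numRounds, Selected x τ S := by
  classical
  rw [cover, mem_filter, and_iff_right hS]
  simp only [FailSet, Selected, and_or_left, exists_or]

lemma raceFails_singleton_iff {τ S : ℕ} :
    RaceFails x τ [S] 0 ↔ coin x (true, S, τ) = true ∧
      ∃ k ≤ P.round τ, S ∈ cand x (P.start τ + k) ∧ Fail x true (P.start τ + k) S := by
  have hmem {k : ℕ} (hk : k ≤ P.round τ) (S') : S' ∈ raceList x τ [S] k ↔
      S' = S ∧ coin x (true, S', τ) = true ∧ S' ∈ cand x (P.start τ + k) := by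
    rw [mem_raceList, racing_eq_cand (hk.trans (P.round_le τ)), List.mem_singleton]
  have hcap (k) : ¬P.cap (P.round τ - k) < (raceList x τ [S] k).length :=
    (((List.length_filter_le _ _).trans (List.length_filter_le _ [S])).trans
      Nat.one_le_two_pow).not_gt
  simp only [RaceFails, hcap, Nat.zero_le, true_and, false_or]
  constructor
  · rintro ⟨k, hk, S', hS', hF⟩
    obtain ⟨rfl, hcoin, hcand⟩ := (hmem hk S').1 hS'
    exact ⟨hcoin, k, hk, hcand, hF⟩
  · rintro ⟨hcoin, k, hk, hcand, hF⟩
    exact ⟨k, hk, S, (hmem hk S).2 ⟨rfl, hcoin, hcand⟩, hF⟩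

lemma valUnless_raceFails_singleton_ne_iff {τ S : ℕ} :
    valUnless (RaceFails x τ [S] 0) (raceList x τ [S] (P.round τ + 1)) ≠ some [] ↔
      Selected x τ S := by
  rw [Selected, ← raceFails_singleton_iff]
  by_cases hF : RaceFails x τ [S] 0
  · rw [valUnless_of hF]
    simp [hF]
  · rw [valUnless_of_not hF]
    simp [hF, List.eq_nil_iff_forall_not_mem, mem_raceList_round_succ]

lemma CostBound.evLe_top (hc : CostBound P s t cU cA) (hx : ReadsCoins ω x) (hI : I.Bounded s t)
    {S : ℕ} (hS : S ∈ I.sets) {τ : ℕ} (hτ : τ ≤ P.numRounds) :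
    ∃ v : Val, EvLe (prog P) R ω (Op.top, τ, 0, [S]) [] v (cU τ) ∧
      (v ≠ some [] ↔ ∃ τ' < τ, Selected x τ' S) := by
  induction τ with
  | zero => exact ⟨some [], .ret rfl _, by simp⟩
  | succ τ ih =>
    obtain ⟨v, hv, hv_iff⟩ := ih (Nat.le_of_succ_le hτ)
    have hcost := hc.alive_le τ hτ
    simp only [Nat.lt_succ_iff_lt_or_eq, or_and_right, exists_or, exists_eq_left, ← hv_iff]
    rcases v with _ | _ | ⟨a, l⟩
    · exact ⟨none, (EvLe.call (q' := 0) rfl hv (.ret rfl _)).mono (by omega), by simp⟩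
    · have hchain := evLe_chain (k := 0) (Nat.zero_le _) (fun k hk => hc.testSpec (R := R) hx hI
        (show P.start τ + k < P.numRounds by have := P.start_add_round τ; omega)) [S]
      rw [raceList_zero (by simpa using hS)] at hchain
      refine ⟨valUnless (RaceFails x τ [S] 0) (raceList x τ [S] (P.round τ + 1)),
        EvLe.mono (q := cU τ + (0 + (P.chainCost cA τ 0 + 0))) ?_ (by omega),
        valUnless_raceFails_singleton_ne_iff.trans (by simp)⟩
      refine .call (b' := (Op.top, τ, 0, [S])) rfl hv <|
        .call (b' := (Op.filter, τ, Op.joinCoin, [S])) rfl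
          (evLe_filter_coin (b := true) hx hτ (by simpa using mem_union_left _ hS)) <|
        .call_valUnless (b := (Op.chain, τ, 0, [S].filter fun S => coin x (true, S, τ))) rfl
          hchain id fun hF => ?_
      rw [valUnless_of_not hF]
      exact .ret rfl _
    · exact ⟨some (a :: l), (EvLe.call (q' := 0) rfl hv (.ret rfl _)).mono (by omega), by simp⟩

end Rounds

/-! ### The number of queries -/

section Cost

variable (P : Schedule) (s t : ℕ)

/-- The factor by which the bound for the number of queries grows from one round to the next. -/
def Schedule.roundFactor : ℕ := 2 ^ (2 * P.ℓ + 7)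

/-- A bound for the number of queries made by `alive`. The exponent of `s + t + 2` is the number of
stages begun before round `τ`: `test` multiplies by `s` the cost at the start of the stage only. -/
def aliveCost (τ : ℕ) : ℕ :=
  (s + t + 2) ^ ((τ + P.T) / (P.T + 1)) * P.roundFactor ^ τ

/-- A bound for the number of queries made by `test`. -/
def testCost (τ : ℕ) : ℕ :=
  s + 1 + s * aliveCost P s t (P.start τ) + P.maxSample * aliveCost P s t τ

variable {P s t}

lemma Schedule.div_start_add {τ k : ℕ} (hk : k ≤ P.T) :
    (P.start τ + k) / (P.T + 1) = τ / (P.T + 1) := by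
  rw [start_eq, mul_comm, Nat.mul_add_div P.T.succ_pos, Nat.div_eq_of_lt (Nat.lt_succ_of_le hk),
    add_zero]

lemma Schedule.roundFactor_pos : 0 < P.roundFactor := Nat.two_pow_pos _

lemma aliveCost_le (τ : ℕ) :
    aliveCost P s t τ ≤ (s + t + 2) ^ (τ / (P.T + 1) + 1) * P.roundFactor ^ τ := by
  refine Nat.mul_le_mul_right _ (Nat.pow_le_pow_right (by omega) ?_)
  rw [← Nat.add_div_right _ P.T.succ_pos]
  exact Nat.div_le_div_right (by omega)

lemma aliveCost_succ (τ : ℕ) :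
    aliveCost P s t (τ + 1) = (s + t + 2) ^ (τ / (P.T + 1) + 1) * P.roundFactor ^ (τ + 1) := by
  rw [aliveCost, add_assoc τ, add_comm 1, Nat.add_div_right _ P.T.succ_pos]

lemma aliveCost_start (τ : ℕ) :
    aliveCost P s t (P.start τ) =
      (s + t + 2) ^ (τ / (P.T + 1)) * P.roundFactor ^ P.start τ := by
  rw [aliveCost, Schedule.div_start_add le_rfl]

lemma aliveCost_numRounds :
    aliveCost P s t P.numRounds = (s + t + 2) ^ (P.L + 1) * P.roundFactor ^ P.numRounds := by
  have hdiv : (P.numRounds + P.T) / (P.T + 1) = P.L + 1 := by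
    rw [Schedule.numRounds, mul_comm, Nat.mul_add_div P.T.succ_pos,
      Nat.div_eq_of_lt P.T.lt_succ_self, add_zero]
  rw [aliveCost, hdiv]

lemma testCost_le (τ : ℕ) :
    testCost P s t τ ≤
      (P.maxSample + 2) * ((s + t + 2) ^ (τ / (P.T + 1) + 1) * P.roundFactor ^ τ) := by
  have hone : 1 ≤ aliveCost P s t (P.start τ) :=
    Nat.mul_pos (Nat.pow_pos (by omega)) (Nat.pow_pos P.roundFactor_pos)
  have hstart : (s + t + 2) * aliveCost P s t (P.start τ) ≤
      (s + t + 2) ^ (τ / (P.T + 1) + 1) * P.roundFactor ^ τ := by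
    rw [aliveCost_start, ← mul_assoc, ← pow_succ']
    exact Nat.mul_le_mul_left _ (Nat.pow_le_pow_right P.roundFactor_pos (P.start_le τ))
  have halive := Nat.mul_le_mul_left P.maxSample (aliveCost_le (P := P) (s := s) (t := t) τ)
  rw [testCost, add_mul]
  nlinarith

lemma sum_pow_mul_two_pow_le {K : ℕ} (hK : 4 ≤ K) (j : ℕ) :
    ∑ i ∈ range (j + 1), K ^ i * 2 ^ (j - i) ≤ 2 * K ^ j := by
  have hgeom := geom_sum₂_mul_of_ge (show 2 ≤ K by omega) (j + 1)
  rw [Nat.add_sub_cancel] at hgeom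
  refine Nat.le_of_mul_le_mul_right ?_ (show 0 < K by omega)
  calc (∑ i ∈ range (j + 1), K ^ i * 2 ^ (j - i)) * K
      ≤ (∑ i ∈ range (j + 1), K ^ i * 2 ^ (j - i)) * (2 * (K - 2)) :=
        Nat.mul_le_mul_left _ (by omega)
    _ = 2 * (K ^ (j + 1) - 2 ^ (j + 1)) := by rw [mul_left_comm, hgeom]
    _ ≤ 2 * K ^ j * K := by
        rw [mul_assoc, ← pow_succ]
        exact Nat.mul_le_mul_left _ (Nat.sub_le _ _)

lemma four_le_roundFactor : 4 ≤ P.roundFactor :=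
  Nat.pow_le_pow_right two_pos (show 2 ≤ 2 * P.ℓ + 7 by omega)

lemma chainCost_testCost_le (τ : ℕ) :
    P.chainCost (testCost P s t) τ 0 ≤ 2 ^ (P.ℓ + 2) * (P.maxSample + 2) *
      ((s + t + 2) ^ (τ / (P.T + 1) + 1) * P.roundFactor ^ τ) := by
  set D := (s + t + 2) ^ (τ / (P.T + 1) + 1)
  set K := P.roundFactor
  have hterm : ∀ i ∈ range (P.round τ + 1),
      P.cap (P.round τ - i) * testCost P s t (P.start τ + i) ≤
        2 ^ (P.ℓ + 1) * (P.maxSample + 2) * (D * K ^ P.start τ) *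
          (K ^ i * 2 ^ (P.round τ - i)) := by
    intro i hi
    have hi : i ≤ P.T := (Nat.le_of_lt_succ (mem_range.1 hi)).trans (P.round_le τ)
    have htest := testCost_le (P := P) (s := s) (t := t) (P.start τ + i)
    rw [Schedule.div_start_add hi] at htest
    refine (Nat.mul_le_mul_left _ htest).trans_eq ?_
    rw [Schedule.cap, pow_add, pow_add K]
    ring
  calc P.chainCost (testCost P s t) τ 0
      ≤ 2 ^ (P.ℓ + 1) * (P.maxSample + 2) * (D * K ^ P.start τ) *
          ∑ i ∈ range (P.round τ + 1), K ^ i * 2 ^ (P.round τ - i) := by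
        rw [Schedule.chainCost, ← range_eq_Ico, mul_sum]
        exact sum_le_sum hterm
    _ ≤ 2 ^ (P.ℓ + 1) * (P.maxSample + 2) * (D * K ^ P.start τ) * (2 * K ^ P.round τ) :=
        Nat.mul_le_mul_left _ (sum_pow_mul_two_pow_le four_le_roundFactor _)
    _ = 2 ^ (P.ℓ + 2) * (P.maxSample + 2) * (D * K ^ (P.start τ + P.round τ)) := by ring
    _ = _ := by rw [P.start_add_round]

lemma two_add_le_roundFactor : 2 + 2 ^ (P.ℓ + 2) * (P.maxSample + 2) ≤ P.roundFactor := by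
  have hpos : 1 ≤ 2 ^ P.ℓ := Nat.one_le_two_pow
  have hfactor : P.roundFactor = 128 * (2 ^ P.ℓ * 2 ^ P.ℓ) := by
    rw [Schedule.roundFactor]
    ring
  rw [hfactor, Schedule.maxSample, pow_add]
  nlinarith

lemma costBound : CostBound P s t (aliveCost P s t) (testCost P s t) where
  test_le _ _ := le_rfl
  alive_le τ _ := by
    have hlists : t + 1 ≤ (s + t + 2) ^ (τ / (P.T + 1) + 1) * P.roundFactor ^ τ :=
      calc t + 1 ≤ (s + t + 2) ^ (τ / (P.T + 1) + 1) :=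
            (show t + 1 ≤ s + t + 2 by omega).trans (Nat.le_self_pow (Nat.succ_ne_zero _) _)
        _ ≤ _ := Nat.le_mul_of_pos_right _ (Nat.pow_pos P.roundFactor_pos)
    have halive := aliveCost_le (P := P) (s := s) (t := t) τ
    have hchain := chainCost_testCost_le (P := P) (s := s) (t := t) τ
    rw [aliveCost_succ, pow_succ P.roundFactor, ← mul_assoc, mul_comm _ P.roundFactor]
    refine le_trans ?_ (Nat.mul_le_mul_right _ two_add_le_roundFactor)
    rw [add_mul]
    omega

end Cost

/-! ### The choice of the parameters -/

section Parameters

lemma le_two_pow_schedule_L (s t : ℕ) : s ≤ 2 ^ (schedule s t).L :=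
  (Nat.lt_pow_succ_log_self one_lt_two s).le

lemma le_two_pow_schedule_T (s t : ℕ) : t ≤ 2 ^ (schedule s t).T :=
  (Nat.lt_pow_succ_log_self one_lt_two t).le

lemma pow_four_le_two_pow_schedule_ℓ (s t : ℕ) :
    ((schedule s t).L + (schedule s t).T + 16) ^ 4 ≤ 2 ^ (schedule s t).ℓ := by
  set m := Nat.log 2 s + Nat.log 2 t + 18
  calc ((schedule s t).L + (schedule s t).T + 16) ^ 4
      = m ^ 4 := by simp only [schedule, m]; ring
    _ ≤ (2 ^ (Nat.log 2 m + 1)) ^ 4 :=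
        Nat.pow_le_pow_left (Nat.lt_pow_succ_log_self one_lt_two m).le 4
    _ = 2 ^ (schedule s t).ℓ := by rw [← pow_mul, mul_comm]; rfl

variable {P : Schedule} {s t : ℕ}

lemma Schedule.failBound_numerator_le (hsL : s ≤ 2 ^ P.L) (htT : t ≤ 2 ^ P.T)
    (hℓ : (P.L + P.T + 16) ^ 4 ≤ 2 ^ P.ℓ) :
    s * (t * (P.numRounds * ((P.T + 1) * (3 * s * ((8 * s * t * (P.T + 1)) ^ P.numRounds *
      (P.T + 2)))))) ≤ 2 ^ 2 ^ P.ℓ := by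
  set m := P.L + P.T + 16 with hm
  have hT : P.T + 1 ≤ 2 ^ P.T := Nat.lt_two_pow_self
  have hT' : P.T + 2 ≤ 2 ^ (P.T + 1) := Nat.lt_two_pow_self
  have hL : P.L + 1 ≤ 2 ^ P.L := Nat.lt_two_pow_self
  have hrounds : P.numRounds ≤ 2 ^ P.L * 2 ^ P.T := Nat.mul_le_mul hL hT
  have hrounds' : P.numRounds ≤ m * m := Nat.mul_le_mul (by omega) (by omega)
  have hexp : 3 * P.L + 4 * P.T + 3 + (3 + P.L + 2 * P.T) * P.numRounds ≤ m ^ 4 :=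
    calc 3 * P.L + 4 * P.T + 3 + (3 + P.L + 2 * P.T) * P.numRounds
        ≤ 4 * m + 2 * m * (m * m) := by gcongr <;> omega
      _ ≤ 16 * m ^ 3 := by linarith [Nat.le_self_pow three_ne_zero m]
      _ ≤ m * m ^ 3 := Nat.mul_le_mul_right _ (by omega)
      _ = m ^ 4 := by ring
  calc s * (t * (P.numRounds * ((P.T + 1) * (3 * s * ((8 * s * t * (P.T + 1)) ^ P.numRounds *
        (P.T + 2))))))
      ≤ 2 ^ P.L * (2 ^ P.T * (2 ^ P.L * 2 ^ P.T * (2 ^ P.T * (2 ^ 2 * 2 ^ P.L *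
        ((2 ^ 3 * 2 ^ P.L * 2 ^ P.T * 2 ^ P.T) ^ P.numRounds * 2 ^ (P.T + 1)))))) := by
        gcongr <;> norm_num
    _ = 2 ^ (3 * P.L + 4 * P.T + 3 + (3 + P.L + 2 * P.T) * P.numRounds) := by
        rw [pow_add _ (3 * P.L + 4 * P.T + 3), pow_mul 2 (3 + P.L + 2 * P.T)]
        ring
    _ ≤ 2 ^ 2 ^ P.ℓ := Nat.pow_le_pow_right two_pos (hexp.trans hℓ)

lemma Schedule.mul_failBound_le (hsL : s ≤ 2 ^ P.L) (htT : t ≤ 2 ^ P.T)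
    (hℓ : (P.L + P.T + 16) ^ 4 ≤ 2 ^ P.ℓ) : (s : ℝ) * (t * P.failBound s t) ≤ 1 := by
  have hnum : (s : ℝ) * (t * (P.numRounds * ((P.T + 1) * (3 * s * ((8 * s * t * (P.T + 1)) ^
      P.numRounds * (P.T + 2)))))) ≤ 2 ^ 2 ^ P.ℓ := by
    exact_mod_cast failBound_numerator_le hsL htT hℓ
  calc (s : ℝ) * (t * P.failBound s t)
      = s * (t * (P.numRounds * ((P.T + 1) * (3 * s * ((8 * s * t * (P.T + 1)) ^
          P.numRounds * (P.T + 2)))))) * (1 / 2) ^ 2 ^ P.ℓ := by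
        unfold failBound growth slack
        ring
    _ ≤ 2 ^ 2 ^ P.ℓ * (1 / 2) ^ 2 ^ P.ℓ := by gcongr
    _ = 1 := by rw [← mul_pow]; norm_num

lemma Schedule.slack_le_failBound (hs : 1 ≤ s) (ht : 1 ≤ t) : P.slack ≤ P.failBound s t := by
  have hgrowth := one_le_pow₀ (P.one_le_growth hs ht) (n := P.numRounds)
  have hrounds : (1 : ℝ) ≤ P.numRounds :=
    Nat.one_le_cast.2 (Nat.mul_pos P.L.succ_pos P.T.succ_pos)
  have hT : (1 : ℝ) ≤ P.T + 1 := by exact_mod_cast P.T.succ_pos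
  have hs' : (1 : ℝ) ≤ 3 * s := by exact_mod_cast (show 1 ≤ 3 * s by omega)
  calc P.slack ≤ P.numRounds * ((P.T + 1) * (3 * s * P.growth s t ^ P.numRounds)) * P.slack :=
        le_mul_of_one_le_left P.slack_nonneg <| one_le_mul_of_one_le_of_one_le hrounds <|
          one_le_mul_of_one_le_of_one_le hT <| one_le_mul_of_one_le_of_one_le hs' hgrowth
    _ = P.failBound s t := by rw [failBound]; ring

lemma one_le_logb_two {a : ℝ} (ha : 2 ≤ a) : 1 ≤ Real.logb 2 a := by
  rwa [Real.le_logb_iff_rpow_le one_lt_two (by linarith), Real.rpow_one]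

lemma schedule_L_le (s t : ℕ) : ((schedule s t).L : ℝ) ≤ Real.logb 2 s + 1 := by
  simpa [schedule] using Real.natLog_le_logb s 2

lemma schedule_T_le (s t : ℕ) : ((schedule s t).T : ℝ) ≤ Real.logb 2 t + 1 := by
  simpa [schedule] using Real.natLog_le_logb t 2

lemma schedule_ℓ_le (hs : 2 ≤ s) (ht : 2 ≤ t) : ((schedule s t).ℓ : ℝ) ≤
    4 * (Real.logb 2 (Real.logb 2 s) + Real.logb 2 (Real.logb 2 t) + 6) := by
  set a := Real.logb 2 s
  set b := Real.logb 2 t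
  have ha : 1 ≤ a := one_le_logb_two (by exact_mod_cast hs)
  have hb : 1 ≤ b := one_le_logb_two (by exact_mod_cast ht)
  have hab : ((Nat.log 2 s + Nat.log 2 t + 18 : ℕ) : ℝ) ≤ 2 ^ 5 * (a * b) := by
    have hs := Real.natLog_le_logb s 2
    have ht := Real.natLog_le_logb t 2
    push_cast at hs ht ⊢
    nlinarith
  have hlog : (Nat.log 2 (Nat.log 2 s + Nat.log 2 t + 18) : ℝ) ≤
      5 + (Real.logb 2 a + Real.logb 2 b) :=
    calc (Nat.log 2 (Nat.log 2 s + Nat.log 2 t + 18) : ℝ)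
        ≤ Real.logb 2 (Nat.log 2 s + Nat.log 2 t + 18 : ℕ) := Real.natLog_le_logb _ 2
      _ ≤ Real.logb 2 (2 ^ 5 * (a * b)) :=
          Real.logb_le_logb_of_le one_lt_two (by positivity) hab
      _ = 5 + (Real.logb 2 a + Real.logb 2 b) := by
          rw [Real.logb_mul (by norm_num) (by positivity),
            Real.logb_mul (by positivity) (by positivity), Real.logb_pow,
            Real.logb_self_eq_one one_lt_two]
          norm_num
  simp only [schedule]
  push_cast
  linarith

-- If `b ≤ 2 * a`, the first term on the right suffices; otherwise `2 ≤ b`, so `1 ≤ logb 2 b`.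
lemma mul_le_sq_add_mul_logb {a b : ℝ} (ha : 1 ≤ a) (hb : 1 ≤ b) :
    a * b ≤ 2 * (a * a) + a * b * (Real.logb 2 a + Real.logb 2 b) := by
  have hla : 0 ≤ Real.logb 2 a := Real.logb_nonneg one_lt_two ha
  have hlb : 0 ≤ Real.logb 2 b := Real.logb_nonneg one_lt_two hb
  rcases le_total b (2 * a) with h | h
  · have := mul_le_mul_of_nonneg_left h (zero_le_one.trans ha)
    have : 0 ≤ a * b * (Real.logb 2 a + Real.logb 2 b) := by positivity
    linarith
  · have : 1 ≤ Real.logb 2 b := one_le_logb_two (by linarith)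
    have : a * b ≤ a * b * (Real.logb 2 a + Real.logb 2 b) :=
      le_mul_of_one_le_right (by positivity) (by linarith)
    have : 0 ≤ a * a := by positivity
    linarith

lemma queryBound_eq_two_rpow (C : ℝ) (hs : 1 ≤ s) (ht : 1 ≤ t) :
    queryBound C s t = 2 ^ (C * (Real.logb 2 s * Real.logb 2 s + Real.logb 2 s * Real.logb 2 t *
      (Real.logb 2 (Real.logb 2 s) + Real.logb 2 (Real.logb 2 t)))) := by
  have hpow {n : ℕ} (hn : 1 ≤ n) (c : ℝ) : (n : ℝ) ^ c = 2 ^ (Real.logb 2 n * c) := by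
    rw [Real.rpow_mul zero_le_two, Real.rpow_logb two_pos (by norm_num) (by positivity)]
  rw [queryBound, hpow hs, hpow ht, ← Real.rpow_add two_pos]
  ring_nf

lemma schedule_exponent_le (hs : 2 ≤ s) (ht : 2 ≤ t) {L T ℓ : ℝ} (hT0 : 0 ≤ T) (hL0 : 0 ≤ L)
    (hL : L ≤ Real.logb 2 s + 1) (hT : T ≤ Real.logb 2 t + 1)
    (hℓ : ℓ ≤ 4 * (Real.logb 2 (Real.logb 2 s) + Real.logb 2 (Real.logb 2 t) + 6)) :
    (L + T + 1 + (2 * ℓ + 7) * (T + 1)) * (L + 1) ≤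
      1200 * (Real.logb 2 s * Real.logb 2 s + Real.logb 2 s * Real.logb 2 t *
        (Real.logb 2 (Real.logb 2 s) + Real.logb 2 (Real.logb 2 t))) := by
  set a := Real.logb 2 s
  set b := Real.logb 2 t
  set r := Real.logb 2 a + Real.logb 2 b
  have ha : 1 ≤ a := one_le_logb_two (by exact_mod_cast hs)
  have hb : 1 ≤ b := one_le_logb_two (by exact_mod_cast ht)
  have hr : 0 ≤ r := add_nonneg (Real.logb_nonneg one_lt_two ha) (Real.logb_nonneg one_lt_two hb)
  have hfactor : (2 * ℓ + 7) * (T + 1) ≤ (8 * r + 55) * (3 * b) :=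
    mul_le_mul (by linarith) (by linarith) (by linarith) (by linarith)
  calc (L + T + 1 + (2 * ℓ + 7) * (T + 1)) * (L + 1)
      ≤ (3 * a + 3 * b + (8 * r + 55) * (3 * b)) * (3 * a) :=
        mul_le_mul (by linarith) (by linarith) (by linarith) (by positivity)
    _ = 9 * (a * a) + 72 * (a * b * r) + 504 * (a * b) := by ring
    _ ≤ 1200 * (a * a + a * b * r) := by
        have := mul_le_sq_add_mul_logb ha hb
        have : 0 ≤ a * b * r := by positivity
        have : 0 ≤ a * a := by positivity
        linarith

lemma aliveCost_numRounds_le (hs : 2 ≤ s) (ht : 2 ≤ t) (hsL : s ≤ 2 ^ P.L) (htT : t ≤ 2 ^ P.T) :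
    aliveCost P s t P.numRounds ≤
      2 ^ ((P.L + P.T + 1 + (2 * P.ℓ + 7) * (P.T + 1)) * (P.L + 1)) := by
  have hst : s + t + 2 ≤ 2 ^ (P.L + P.T + 1) :=
    calc s + t + 2 ≤ s * t * 2 := by nlinarith
      _ ≤ 2 ^ P.L * 2 ^ P.T * 2 := by gcongr
      _ = 2 ^ (P.L + P.T + 1) := by ring
  calc aliveCost P s t P.numRounds = (s + t + 2) ^ (P.L + 1) * P.roundFactor ^ P.numRounds :=
        aliveCost_numRounds
    _ ≤ (2 ^ (P.L + P.T + 1)) ^ (P.L + 1) * P.roundFactor ^ P.numRounds := by gcongr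
    _ = 2 ^ ((P.L + P.T + 1 + (2 * P.ℓ + 7) * (P.T + 1)) * (P.L + 1)) := by
        rw [Schedule.roundFactor, Schedule.numRounds, ← pow_mul, ← pow_mul, ← pow_add]
        ring_nf

lemma aliveCost_schedule_le_queryBound (hs : 2 ≤ s) (ht : 2 ≤ t) :
    (aliveCost (schedule s t) s t (schedule s t).numRounds : ℝ) ≤ queryBound 1200 s t := by
  have hcost := aliveCost_numRounds_le hs ht (le_two_pow_schedule_L s t) (le_two_pow_schedule_T s t)
  rw [queryBound_eq_two_rpow _ (by omega) (by omega)]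
  refine (Nat.cast_le.2 hcost).trans ?_
  rw [Nat.cast_pow, Nat.cast_ofNat, ← Real.rpow_natCast]
  push_cast
  exact Real.rpow_le_rpow_of_exponent_le one_le_two (schedule_exponent_le hs ht (Nat.cast_nonneg _)
    (Nat.cast_nonneg _) (schedule_L_le s t) (schedule_T_le s t) (schedule_ℓ_le hs ht))

end Parameters

/-! ### The cover as a function of the random tape -/

section Tape

open MeasureTheory

variable (P : Schedule) (I : SetSystem)

/-- The coins read off a random tape: a coin shows `true` if its first `expo` bits all do. -/
def tapeOutcome (ω : ℕ → Bool) : Outcome P I :=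
  fun k => decide (∀ r < P.expo k.1.1 k.1.2.2, ω (tapePos k r))

/-- The cover computed from a random tape. -/
noncomputable def tapeCover (ω : ℕ → Bool) : Finset ℕ := cover (tapeOutcome P I ω)

variable {P I}

lemma readsCoins_tapeOutcome (ω : ℕ → Bool) : ReadsCoins ω (tapeOutcome P I ω) := by
  intro k hk
  by_cases h : P.expo k.1 k.2.2 = 0 <;> simp [coin, tapeOutcome, hk, h]

lemma measurable_tapeOutcome : Measurable (tapeOutcome P I) :=
  measurable_pi_lambda _ fun k =>
    (measurable_decide_forall_lt _).comp <| measurable_pi_lambda _ fun r =>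
      measurable_pi_apply (tapePos k r)

lemma map_tapeOutcome_tapeMeasure : tapeMeasure.map (tapeOutcome P I) = law P I :=
  map_coins_tapeMeasure (fun k : keySet P I => P.expo k.1.1 k.1.2.2) (pos := fun k => tapePos k) <|
    tapePos_injective.comp (Subtype.val_injective.prodMap Function.injective_id)

lemma integrable_card_tapeCover :
    Integrable (fun ω => (#(tapeCover P I ω) : ℝ)) tapeMeasure := by
  have hint : Integrable (fun x => (#(cover x) : ℝ)) (tapeMeasure.map (tapeOutcome P I)) := by
    rw [map_tapeOutcome_tapeMeasure]
    exact .of_finite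
  exact hint.comp_measurable measurable_tapeOutcome

lemma integral_card_tapeCover :
    ∫ ω, (#(tapeCover P I ω) : ℝ) ∂tapeMeasure = ∫ x, (#(cover x) : ℝ) ∂law P I := by
  rw [← map_tapeOutcome_tapeMeasure,
    integral_map measurable_tapeOutcome.aemeasurable (measurable_of_finite _).aestronglyMeasurable]
  rfl

lemma opt_nonneg : 0 ≤ I.opt := by
  refine Real.sInf_nonneg ?_
  rintro v ⟨x, hx, rfl⟩
  exact sum_nonneg hx.1

variable {s t : ℕ}

lemma integral_card_tapeCover_schedule_le (hs : 2 ≤ s) (ht : 2 ≤ t) (hI : I.Bounded s t) :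
    ∫ ω, (#(tapeCover (schedule s t) I ω) : ℝ) ∂tapeMeasure ≤ 1200 * Real.logb 2 s * I.opt := by
  have hsL := le_two_pow_schedule_L s t
  have htT := le_two_pow_schedule_T s t
  have hfail := Schedule.mul_failBound_le hsL htT (pow_four_le_two_pow_schedule_ℓ s t)
  have hslack : s * (schedule s t).slack ≤ 1 := by
    have ht' : (1 : ℝ) ≤ t := by exact_mod_cast one_le_two.trans ht
    have hle := Schedule.slack_le_failBound (P := schedule s t) (one_le_two.trans hs)
      (one_le_two.trans ht)
    have hnonneg := Schedule.slack_nonneg.trans hle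
    exact (mul_le_mul_of_nonneg_left (hle.trans (le_mul_of_one_le_left hnonneg ht'))
      s.cast_nonneg).trans hfail
  rw [integral_card_tapeCover]
  refine (integral_card_cover_le hI hsL htT (one_le_two.trans hs) (one_le_two.trans ht) hslack
    hfail).trans (mul_le_mul_of_nonneg_right ?_ opt_nonneg)
  have := schedule_L_le s t
  have := one_le_logb_two (a := s) (by exact_mod_cast hs)
  linarith

lemma algorithm_answers (hs : 2 ≤ s) (ht : 2 ≤ t) (hI : I.Bounded s t) (R : I.Representation)
    (ω : ℕ → Bool) {S : ℕ} (hS : S ∈ I.sets) :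
    algorithm.Answers s t S R ω (queryBound 1200 s t)
      (decide (S ∈ tapeCover (schedule s t) I ω)) := by
  obtain ⟨v, ⟨q, hq, hev⟩, hv⟩ :=
    costBound.evLe_top (R := R) (readsCoins_tapeOutcome ω) hI hS (P := schedule s t) le_rfl
  rw [← mem_cover_iff hS] at hv
  refine ⟨q, ?_, (Nat.cast_le.2 hq).trans (aliveCost_schedule_le_queryBound hs ht)⟩
  rw [tapeCover, ← decide_eq_decide.2 hv]
  exact hev.run_nil fun _ => rfl

end Tape

end LocalSetCover

theorem theorem1 :
    ∃ (C : ℝ) (A : LocalAlgorithm), 0 < C ∧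
      ∀ s t : ℕ, 2 ≤ s → 2 ≤ t → ∀ I : SetSystem, I.Bounded s t →
        ∃ D : (ℕ → Bool) → Finset ℕ,
          (∀ ω, I.IsCover (D ω)) ∧
          (∀ (R : I.Representation) (ω : ℕ → Bool), ∀ S ∈ I.sets,
            A.Answers s t S R ω (queryBound C s t) (decide (S ∈ D ω))) ∧
          MeasureTheory.Integrable (fun ω => ((D ω).card : ℝ)) tapeMeasure ∧
          ∫ ω, ((D ω).card : ℝ) ∂tapeMeasure ≤ C * Real.logb 2 s * I.opt := by
  refine ⟨1200, LocalSetCover.algorithm, by norm_num, fun s t hs ht I hI => ?_⟩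
  exact ⟨LocalSetCover.tapeCover (LocalSetCover.schedule s t) I,
    fun ω => LocalSetCover.isCover_cover _,
    fun R ω S hS => LocalSetCover.algorithm_answers hs ht hI R ω hS,
    LocalSetCover.integrable_card_tapeCover,
    LocalSetCover.integral_card_tapeCover_schedule_le hs ht hI⟩
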